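/- **The calculus.** There are two disjoint infinite sorts of names: innames $x,y,z,\dots$ and outnames $\alpha,\beta,\gamma,\dots$, each totally ordered. Raw terms are $$P,Q ::= \langle x.\alpha\rangle \mid \hat xP\hat\beta\cdot\alpha \mid P\hat\alpha[x]\hat yQ \mid P\hat\alpha\dagger\hat xQ \mid P\hat\alpha\nearrow\hat xQ \mid P\hat\alpha\nwarrow\hat xQ \mid x\odot P \mid P\odot\alpha \mid x{<}^{x_1}_{x_2}P] \mid [P]^{\alpha_1}_{\alpha_2}{>}\alpha$$ (capsule, exporter, importer, inactive cut, left-active cut, right-active cut, left and right eraser, left and right duplicator). The exporter binds $x,\beta$ in $P$; the importer binds $\alpha$ in $P$ and $y$ in $Q$; a cut binds $\alpha$ in $P$ and $x$ in $Q$; the duplicators bind $x_1,x_2$, resp. $\alpha_1,\alpha_2$, in $P$. $I(P)$, $O(P)$ are the sets of free innames and outnames, $N(P)$ is the set of all free names. A ${}^*\mathcal X$-*term* is a raw term, up to $\alpha$-conversion, that is *linear*: every name has at most one free occurrence, and every binder binds an actual occurrence. Bound names are chosen different from free names and from one another. $P\{y/x\}$ and $P\{\beta/\alpha\}$ denote renaming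 of a free name. The names $x,\alpha$ of $\langle x.\alpha\rangle$, the name $\alpha$ of $\hat xP\hat\beta\cdot\alpha$ and the name $x$ of $P\hat\alpha[x]\hat yQ$ are *L-principal* for these terms; they, and the name $x$, resp. $\alpha$, of the erasers $x\odot P$, $P\odot\alpha$ and of the duplicators $x{<}^{x_1}_{x_2}P]$, $[P]^{\alpha_1}_{\alpha_2}{>}\alpha$, are *principal*. **Congruence.** $\equiv$ is the least congruence that contains $\alpha$-conversion and: - $x{<}^{x_1}_{x_2}P]\equiv x{<}^{x_2}_{x_1}P]$; - $x{<}^{x_1}_{x_2}\,y{<}^{y_1}_{y_2}P]]\equiv y{<}^{y_1}_{y_2}\,x{<}^{x_1}_{x_2}P]]$ if $y\notin\{x_1,x_2\}$ and $x\notin\{y_1,y_2\}$; - $z{<}^{y}_{x_3}\,y{<}^{x_1}_{x_2}P]]\equiv z{<}^{x_1}_{y}\,y{<}^{x_2}_{x_3}P]]$ if $y\notin\{x_1,x_2,x_3\}$; - the symmetric rules for right duplicators; - $[x{<}^{x_1}_{x_2}P]]^{\alpha_1}_{\alpha_2}{>}\alpha\equiv x{<}^{x_1}_{x_2}[P]^{\alpha_1}_{\alpha_2}{>}\alpha]$;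 - $y\odot x\odot P\equiv x\odot y\odot P$, $\ P\odot\alpha\odot\beta\equiv P\odot\beta\odot\alpha$, $\ (x\odot P)\odot\alpha\equiv x\odot(P\odot\alpha)$. **Reduction.** $\to$ is the closure under arbitrary contexts and under $\equiv$ of the following rules. *Activation.* $P\hat\alpha\dagger\hat xQ\to P\hat\alpha\nearrow\hat xQ$ if $\alpha$ is not L-principal for $P$; $\ P\hat\alpha\dagger\hat xQ\to P\hat\alpha\nwarrow\hat xQ$ if $x$ is not L-principal for $Q$. *Deactivation.* $P\hat\alpha\nearrow\hat xQ\to P\hat\alpha\dagger\hat xQ$ if $\alpha$ is L-principal for $P$; $\ P\hat\alpha\nwarrow\hat xQ\to P\hat\alpha\dagger\hat xQ$ if $x$ is L-principal for $Q$. *Erasure.* $(P\odot\alpha)\hat\alpha\nearrow\hat xQ\to (I(Q)\setminus x)\odot P\odot O(Q)$; $\ P\hat\alpha\nwarrow\hat x(x\odot Q)\to I(P)\odot Q\odot(O(P)\setminus\alpha)$. Here $\mathcal I\odot P\odot\mathcal O$ stands for successive erasers for all names of $\mathcal I$ and $\mathcal O$. *Duplication.* $([P]^{\alpha_1}_{\alpha_2}{>}\alpha)\hat\alpha\nearrow\hat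 xQ\to P\{\alpha_1\,\alpha_2\nearrow x\,Q\}$; $\ P\hat\alpha\nwarrow\hat x(x{<}^{x_1}_{x_2}Q])\to\{P\,\alpha\nwarrow x_1\,x_2\}Q$. *Logical actions.* $\langle y.\alpha\rangle\hat\alpha\dagger\hat xQ\to Q\{y/x\}$; $\ P\hat\alpha\dagger\hat x\langle x.\beta\rangle\to P\{\beta/\alpha\}$; $\ (\hat yP\hat\beta\cdot\alpha)\hat\alpha\dagger\hat x(Q\hat\gamma[x]\hat zR)$ reduces both to $(Q\hat\gamma\dagger\hat yP)\hat\beta\dagger\hat zR$ and to $Q\hat\gamma\dagger\hat y(P\hat\beta\dagger\hat zR)$. *Left propagation.* - $(\hat xP\hat\gamma\cdot\alpha)\hat\beta\nearrow\hat yR\to\hat x(P\hat\beta\nearrow\hat yR)\hat\gamma\cdot\alpha$ if $\alpha\ne\beta$; - $(P\hat\alpha[x]\hat yQ)\hat\beta\nearrow\hat zR\to(P\hat\beta\nearrow\hat zR)\hat\alpha[x]\hat yQ$ if $\beta\in O(P)$, and $\to P\hat\alpha[x]\hat y(Q\hat\beta\nearrow\hat zR)$ if $\beta\in O(Q)$;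 - $(P\hat\alpha\dagger\hat x\langle x.\beta\rangle)\hat\beta\nearrow\hat yR\to P\hat\alpha\dagger\hat yR$; - $(P\hat\alpha\dagger\hat xQ)\hat\beta\nearrow\hat yR\to(P\hat\beta\nearrow\hat yR)\hat\alpha\dagger\hat xQ$ if $\beta\in O(P)$, and $\to P\hat\alpha\dagger\hat x(Q\hat\beta\nearrow\hat yR)$ if $\beta\in O(Q)$ and $Q\ne\langle x.\beta\rangle$; - an active cut $\hat\beta\nearrow\hat yR$ passes through $x\odot P$, $\ x{<}^{x_1}_{x_2}P]$ and, when $\alpha\neq\beta$, through $P\odot\alpha$ and $[P]^{\alpha_1}_{\alpha_2}{>}\alpha$, onto $P$. *Right propagation.* - $P\hat\alpha\nwarrow\hat x(\hat yQ\hat\beta\cdot\gamma)\to\hat y(P\hat\alpha\nwarrow\hat xQ)\hat\beta\cdot\gamma$; - $P\hat\alpha\nwarrow\hat x(Q\hat\beta[y]\hat zR)\to(P\hat\alpha\nwarrow\hat xQ)\hat\beta[y]\hat zR$ if $x\in I(Q)$, and $\to Q\hat\beta[y]\hat z(P\hat\alpha\nwarrow\hat xR)$ if $x\in I(R)$; -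 $P\hat\alpha\nwarrow\hat x(\langle x.\beta\rangle\hat\beta\dagger\hat yR)\to P\hat\alpha\dagger\hat yR$; - $P\hat\alpha\nwarrow\hat x(Q\hat\beta\dagger\hat yR)\to(P\hat\alpha\nwarrow\hat xQ)\hat\beta\dagger\hat yR$ if $x\in I(Q)$ and $Q\ne\langle x.\beta\rangle$, and $\to Q\hat\beta\dagger\hat y(P\hat\alpha\nwarrow\hat xR)$ if $x\in I(R)$; - an active cut $P\hat\alpha\nwarrow\hat x$ passes through $Q\odot\beta$, $\ [Q]^{\beta_1}_{\beta_2}{>}\beta$ and, when $x\ne y$, through $y\odot Q$ and $y{<}^{y_1}_{y_2}Q]$, onto $Q$. **Simultaneous substitutions.** $C\{R\}$ denotes an exporter, eraser or duplicator with immediate subterm $R$; $C\{R_1,R_2\}$ denotes an importer or an inactive cut with immediate subterms $R_1,R_2$. For $i=1,2$, $Q_i$ is $Q$ with its free names $z$ replaced injectively by new names $z_i$, the names of index $1$ being different from those of index $2$. $D_Q\{T\}$ is the term obtained from $T$ by applying, for every $z\in N(Q)\setminus x$, a duplicator that joins $z_1,z_2$ into $z$; $P_i$ and $D_P$ (for $z\in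 N(P)\setminus\alpha$) are defined in the same way. $P\{\alpha_1\,\alpha_2\nearrow x\,Q\}$ is: - $D_Q\{C\{R\,\hat\alpha_2\nearrow\hat x_2Q_2\}\,\hat\alpha_1\dagger\hat x_1Q_1\}$ if $P=C\{R\}$ has $\alpha_1$ as principal name, and the same with the indices $1,2$ exchanged if $\alpha_2$ is principal; - $C\{([R]^{\alpha_1}_{\alpha_2}{>}\alpha)\hat\alpha\nearrow\hat xQ\}$ if $P=C\{R\}$ and neither $\alpha_1$ nor $\alpha_2$ is principal; - $D_Q\{C\{R_1\hat\alpha_1\nearrow\hat x_1Q_1,\ R_2\hat\alpha_2\nearrow\hat x_2Q_2\}\}$ if $P=C\{R_1,R_2\}$, $\alpha_1\in O(R_1)$, $\alpha_2\in O(R_2)$, and likewise with $\alpha_1,\alpha_2$ (and the indices of $x,Q$) exchanged; - $C\{([R_1]^{\alpha_1}_{\alpha_2}{>}\alpha)\hat\alpha\nearrow\hat xQ,\ R_2\}$ if $P=C\{R_1,R_2\}$ and $\alpha_1,\alpha_2\in O(R_1)$, and likewise if $\alpha_1,\alpha_2\in O(R_2)$. $\{P\,\alpha\nwarrow x_1\,x_2\}Q$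 is defined symmetrically: for $Q=C\{R\}$ by $D_P\{P_1\hat\alpha_1\dagger\hat x_1\,C\{P_2\hat\alpha_2\nwarrow\hat x_2R\}\}$ if $x_1$ is principal, the same with $1,2$ exchanged if $x_2$ is principal, and $C\{P\hat\alpha\nwarrow\hat x(x{<}^{x_1}_{x_2}R])\}$ otherwise; for $Q=C\{R_1,R_2\}$ with principal name $x_1$ by $D_P\{P_1\hat\alpha_1\dagger\hat x_1\,C\{\cdot,\cdot\}\}$, where $P_2\hat\alpha_2\nwarrow\hat x_2$ is applied to the $R_j$ with $x_2\in I(R_j)$, the same with $1,2$ exchanged if $x_2$ is principal; otherwise by distributing $P_1\hat\alpha_1\nwarrow\hat x_1$ and $P_2\hat\alpha_2\nwarrow\hat x_2$ over the two subterms under $D_P$ if $x_1,x_2$ are free in different subterms, and by $P\hat\alpha\nwarrow\hat x(x{<}^{x_1}_{x_2}R_j])$ in place of $R_j$ if both are free in $R_j$. **Types.** $A,B::=T\mid A\to B$, with $T$ ranging over a given set of base types. Contexts $\Gamma,\Delta$ are sets of declarations $x:A$, resp. $\alpha:A$; a comma is union of contexts that declare different names. The rules of the judgement $P:\Gamma\vdash\Delta$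 are: - $\langle x.\alpha\rangle: x:A\vdash\alpha:A$; - if $P:\Gamma\vdash\alpha:A,\Delta$ and $Q:\Gamma',y:B\vdash\Delta'$, then $P\hat\alpha[x]\hat yQ:\Gamma,\Gamma',x:A\to B\vdash\Delta,\Delta'$; - if $P:\Gamma,x:A\vdash\beta:B,\Delta$, then $\hat xP\hat\beta\cdot\alpha:\Gamma\vdash\alpha:A\to B,\Delta$; - if $P:\Gamma\vdash\alpha:A,\Delta$ and $Q:\Gamma',x:A\vdash\Delta'$, then the cut of $P$ and $Q$ along $\hat\alpha,\hat x$, inactive or active, has type $\Gamma,\Gamma'\vdash\Delta,\Delta'$; - if $P:\Gamma\vdash\Delta$, then $x\odot P:\Gamma,x:A\vdash\Delta$ and $P\odot\alpha:\Gamma\vdash\alpha:A,\Delta$; - if $P:\Gamma,x_1:A,x_2:A\vdash\Delta$, then $x{<}^{x_1}_{x_2}P]:\Gamma,x:A\vdash\Delta$; - if $P:\Gamma\vdash\alpha_1:A,\alpha_2:A,\Delta$, then $[P]^{\alpha_1}_{\alpha_2}{>}\alpha:\Gamma\vdash\alpha:A,\Delta$. **Theorem (Witness reduction).** Let $S$ be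 a ${}^*\mathcal X$-term and let $\Gamma,\Delta$ be contexts. If $S:\Gamma\vdash\Delta$ and $S\to S'$, then $S':\Gamma\vdash\Delta$. -/

import Mathlib

namespace StarX

/-! ### Names, types, raw terms -/

/-- Innames `x, y, z, …`. -/
abbrev InName := ℕ

/-- Outnames `α, β, γ, …`. -/
abbrev OutName := ℕ

/-- Simple types `A, B ::= T | A → B`, where `T` ranges over the base types `𝔸`. -/
inductive Ty (𝔸 : Type*) where
  | base (T : 𝔸)
  | arr (A B : Ty 𝔸)

/-- The three states of a cut: `P α̂ † x̂ Q`, `P α̂ ↗ x̂ Q` (left-active), `P α̂ ↖ x̂ Q`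
(right-active). -/
inductive Mode where
  | inactive
  | left
  | right

/-- Raw terms; see `Term.Linear` for the terms of the calculus. -/
inductive Term where
  /-- capsule `⟨x.α⟩` -/
  | cap (x : InName) (α : OutName)
  /-- exporter `x̂ P β̂ · α`; binds `x` and `β` in `P` -/
  | exp (x : InName) (P : Term) (β α : OutName)
  /-- importer `P α̂ [x] ŷ Q`; binds `α` in `P` and `y` in `Q` -/
  | imp (P : Term) (α : OutName) (x y : InName) (Q : Term)
  /-- cut `P α̂ † x̂ Q`, in one of three states; binds `α` in `P` and `x` in `Q` -/
  | cut (m : Mode) (P : Term) (α : OutName) (x : InName) (Q : Term)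
  /-- left eraser `x ⊙ P` -/
  | erL (x : InName) (P : Term)
  /-- right eraser `P ⊙ α` -/
  | erR (P : Term) (α : OutName)
  /-- left duplicator `x <^{x₁}_{x₂} P]`; binds `x₁` and `x₂` in `P` -/
  | dupL (x x₁ x₂ : InName) (P : Term)
  /-- right duplicator `[P]^{α₁}_{α₂} > α`; binds `α₁` and `α₂` in `P` -/
  | dupR (P : Term) (α₁ α₂ α : OutName)

/-! ### Free names, bound names, linearity -/

/-- Free innames `I(P)`. -/
def Term.I : Term → Finset InName
  | .cap x _ => {x}
  | .exp x P _ _ => P.I.erase x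
  | .imp P _ x y Q => insert x (P.I ∪ Q.I.erase y)
  | .cut _ P _ x Q => P.I ∪ Q.I.erase x
  | .erL x P => insert x P.I
  | .erR P _ => P.I
  | .dupL x x₁ x₂ P => insert x ((P.I.erase x₁).erase x₂)
  | .dupR P _ _ _ => P.I

/-- Free outnames `O(P)`. -/
def Term.O : Term → Finset OutName
  | .cap _ α => {α}
  | .exp _ P β α => insert α (P.O.erase β)
  | .imp P α _ _ Q => P.O.erase α ∪ Q.O
  | .cut _ P α _ Q => P.O.erase α ∪ Q.O
  | .erL _ P => P.O
  | .erR P α => insert α P.O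
  | .dupL _ _ _ P => P.O
  | .dupR P α₁ α₂ α => insert α ((P.O.erase α₁).erase α₂)

/-- The innames bound in `P`, listed once per binder. -/
def Term.bndI : Term → List InName
  | .cap _ _ => []
  | .exp x P _ _ => x :: P.bndI
  | .imp P _ _ y Q => y :: (P.bndI ++ Q.bndI)
  | .cut _ P _ x Q => x :: (P.bndI ++ Q.bndI)
  | .erL _ P => P.bndI
  | .erR P _ => P.bndI
  | .dupL _ x₁ x₂ P => x₁ :: x₂ :: P.bndI
  | .dupR P _ _ _ => P.bndI

/-- The outnames bound in `P`, listed once per binder. -/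
def Term.bndO : Term → List OutName
  | .cap _ _ => []
  | .exp _ P β _ => β :: P.bndO
  | .imp P α _ _ Q => α :: (P.bndO ++ Q.bndO)
  | .cut _ P α _ Q => α :: (P.bndO ++ Q.bndO)
  | .erL _ P => P.bndO
  | .erR P _ => P.bndO
  | .dupL _ _ _ P => P.bndO
  | .dupR P α₁ α₂ _ => α₁ :: α₂ :: P.bndO

/-- `x` does not occur in `P`, neither free nor bound. -/
def Term.FreshI (P : Term) (x : InName) : Prop := x ∉ P.I ∧ x ∉ P.bndI

/-- `α` does not occur in `P`, neither free nor bound. -/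
def Term.FreshO (P : Term) (α : OutName) : Prop := α ∉ P.O ∧ α ∉ P.bndO

/-- The convention on names: bound names differ from free names (and from one another).
Terms being taken up to renaming of bound names, every term has such a representative. -/
def Term.Conv (P : Term) : Prop :=
  P.bndI.Nodup ∧ P.bndO.Nodup ∧ (∀ x ∈ P.bndI, x ∉ P.I) ∧ (∀ α ∈ P.bndO, α ∉ P.O)

/-- The linear terms, i.e. the terms of the calculus: every name has at most one free
occurrence, and every binder binds an actual occurrence. The conditions only compare names
that are free in the whole term, so linearity does not depend on the choice of bound names. -/
def Term.Linear : Term → Prop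
  | .cap _ _ => True
  | .exp x P β α => P.Linear ∧ x ∈ P.I ∧ β ∈ P.O ∧ α ∉ P.O.erase β
  | .imp P α x y Q => P.Linear ∧ Q.Linear ∧ α ∈ P.O ∧ y ∈ Q.I ∧ x ∉ P.I ∧ x ∉ Q.I.erase y ∧
      Disjoint P.I (Q.I.erase y) ∧ Disjoint (P.O.erase α) Q.O
  | .cut _ P α x Q => P.Linear ∧ Q.Linear ∧ α ∈ P.O ∧ x ∈ Q.I ∧
      Disjoint P.I (Q.I.erase x) ∧ Disjoint (P.O.erase α) Q.O
  | .erL x P => P.Linear ∧ x ∉ P.I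
  | .erR P α => P.Linear ∧ α ∉ P.O
  | .dupL x x₁ x₂ P => P.Linear ∧ x₁ ≠ x₂ ∧ x₁ ∈ P.I ∧ x₂ ∈ P.I ∧ x ∉ (P.I.erase x₁).erase x₂
  | .dupR P α₁ α₂ α => P.Linear ∧ α₁ ≠ α₂ ∧ α₁ ∈ P.O ∧ α₂ ∈ P.O ∧ α ∉ (P.O.erase α₁).erase α₂

/-! ### Renaming of free names -/

/-- Simultaneous renaming of the free innames by `f` and of the free outnames by `g`. Bound
names are left alone; it is used only with target names that are not bound in the term. -/
def Term.rename (f : InName → InName) (g : OutName → OutName) : Term → Term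
  | .cap x α => .cap (f x) (g α)
  | .exp x P β α =>
      .exp x (P.rename (Function.update f x x) (Function.update g β β)) β (g α)
  | .imp P α x y Q =>
      .imp (P.rename f (Function.update g α α)) α (f x) y (Q.rename (Function.update f y y) g)
  | .cut m P α x Q =>
      .cut m (P.rename f (Function.update g α α)) α x (Q.rename (Function.update f x x) g)
  | .erL x P => .erL (f x) (P.rename f g)
  | .erR P α => .erR (P.rename f g) (g α)
  | .dupL x x₁ x₂ P =>
      .dupL (f x) x₁ x₂ (P.rename (Function.update (Function.update f x₁ x₁) x₂ x₂) g)
  | .dupR P α₁ α₂ α =>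
      .dupR (P.rename f (Function.update (Function.update g α₁ α₁) α₂ α₂)) α₁ α₂ (g α)

/-- `P{y/x}`: the free inname `x` is replaced by `y`. -/
def Term.renI (P : Term) (y x : InName) : Term := P.rename (Function.update id x y) id

/-- `P{β/α}`: the free outname `α` is replaced by `β`. -/
def Term.renO (P : Term) (β α : OutName) : Term := P.rename id (Function.update id α β)

/-- `f₁, g₁` and `f₂, g₂` index the free names of `Q` by `1` and `2`, respectively: they map
these names injectively to names that are new for `T`, those of index `1` being different from
those of index `2`. The indexed terms `Q₁`, `Q₂` are `Q.rename f₁ g₁` and `Q.rename f₂ g₂`. -/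
structure Indexing (T Q : Term) (f₁ f₂ : InName → InName) (g₁ g₂ : OutName → OutName) :
    Prop where
  injI₁ : Set.InjOn f₁ Q.I
  injI₂ : Set.InjOn f₂ Q.I
  injO₁ : Set.InjOn g₁ Q.O
  injO₂ : Set.InjOn g₂ Q.O
  freshI₁ : ∀ x ∈ Q.I, T.FreshI (f₁ x)
  freshI₂ : ∀ x ∈ Q.I, T.FreshI (f₂ x)
  freshO₁ : ∀ α ∈ Q.O, T.FreshO (g₁ α)
  freshO₂ : ∀ α ∈ Q.O, T.FreshO (g₂ α)
  apartI : ∀ x ∈ Q.I, ∀ y ∈ Q.I, f₁ x ≠ f₂ y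
  apartO : ∀ α ∈ Q.O, ∀ β ∈ Q.O, g₁ α ≠ g₂ β

/-! ### Lists of erasers and duplicators -/

/-- `𝓘 ⊙ P ⊙ 𝓞`, the names being listed in increasing order. -/
def erBoth (𝓘 : Finset InName) (P : Term) (𝓞 : Finset OutName) : Term :=
  (𝓘.sort (· ≤ ·)).foldr .erL ((𝓞.sort (· ≤ ·)).foldl .erR P)

/-- `𝓘 <^{𝓘₁}_{𝓘₂} [P]^{𝓞₁}_{𝓞₂} > 𝓞`, where `𝓘ᵢ`, `𝓞ᵢ` are the images of the increasing lists
`𝓘`, `𝓞` under `fᵢ`, `gᵢ`. -/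
def dupBoth (𝓘 : Finset InName) (f₁ f₂ : InName → InName)
    (𝓞 : Finset OutName) (g₁ g₂ : OutName → OutName) (P : Term) : Term :=
  (𝓘.sort (· ≤ ·)).foldr (fun x T => .dupL x (f₁ x) (f₂ x) T)
    ((𝓞.sort (· ≤ ·)).foldl (fun T α => .dupR T (g₁ α) (g₂ α) α) P)

/-! ### Simple contexts and principal names -/

/-- Simple contexts of the terms with exactly one immediate subterm. -/
inductive Ctx1 where
  | exp (x : InName) (β α : OutName)
  | erL (x : InName)
  | erR (α : OutName)
  | dupL (x x₁ x₂ : InName)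
  | dupR (α₁ α₂ α : OutName)

def Ctx1.fill : Ctx1 → Term → Term
  | .exp x β α, R => .exp x R β α
  | .erL x, R => .erL x R
  | .erR α, R => .erR R α
  | .dupL x x₁ x₂, R => .dupL x x₁ x₂ R
  | .dupR α₁ α₂ α, R => .dupR R α₁ α₂ α

/-- The principal inname of a term `C{R}`, if any. -/
def Ctx1.prinI : Ctx1 → Option InName
  | .erL x => some x
  | .dupL x _ _ => some x
  | _ => none

/-- The principal outname of a term `C{R}`, if any. -/
def Ctx1.prinO : Ctx1 → Option OutName
  | .exp _ _ α => some α
  | .erR α => some α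
  | .dupR _ _ α => some α
  | _ => none

/-- Simple contexts with two holes. -/
inductive Ctx2 where
  | imp (α : OutName) (x y : InName)
  | cut (m : Mode) (α : OutName) (x : InName)

def Ctx2.fill : Ctx2 → Term → Term → Term
  | .imp α x y, R₁, R₂ => .imp R₁ α x y R₂
  | .cut m α x, R₁, R₂ => .cut m R₁ α x R₂

/-- The principal inname of a term `C{R₁, R₂}`, if any (such a term has no principal
outname). -/
def Ctx2.prinI : Ctx2 → Option InName
  | .imp _ x _ => some x
  | .cut _ _ _ => none

/-- The two-hole contexts an active cut can be pushed through: importers and inactive cuts. -/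
def Ctx2.Passive : Ctx2 → Prop
  | .imp _ _ _ => True
  | .cut m _ _ => m = .inactive

/-- `x` is an L-principal inname of the term. -/
def Term.LPrinI : Term → InName → Prop
  | .cap x _, z => z = x
  | .imp _ _ x _ _, z => z = x
  | _, _ => False

/-- `α` is an L-principal outname of the term. -/
def Term.LPrinO : Term → OutName → Prop
  | .cap _ α, γ => γ = α
  | .exp _ _ _ α, γ => γ = α
  | _, _ => False

/-! ### Simultaneous substitutions -/

/-- `SimL P α₁ α₂ α x Q S`: the term `S` is a result `P{α₁ α₂ ↗ x Q}` of the left simultaneous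
substitution that stems from `([P]^{α₁}_{α₂} > α) α̂ ↗ x̂ Q`. -/
inductive SimL (P : Term) (α₁ α₂ α : OutName) (x : InName) (Q : Term) : Term → Prop
  | prin₁ (C : Ctx1) (R : Term) (f₁ f₂ : InName → InName) (g₁ g₂ : OutName → OutName) :
      P = C.fill R → C.prinO = some α₁ →
      Indexing (.cut .left (.dupR P α₁ α₂ α) α x Q) Q f₁ f₂ g₁ g₂ →
      SimL P α₁ α₂ α x Q (dupBoth (Q.I.erase x) f₁ f₂ Q.O g₁ g₂
        (.cut .inactive (C.fill (.cut .left R α₂ (f₂ x) (Q.rename f₂ g₂)))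
          α₁ (f₁ x) (Q.rename f₁ g₁)))
  | prin₂ (C : Ctx1) (R : Term) (f₁ f₂ : InName → InName) (g₁ g₂ : OutName → OutName) :
      P = C.fill R → C.prinO = some α₂ →
      Indexing (.cut .left (.dupR P α₁ α₂ α) α x Q) Q f₁ f₂ g₁ g₂ →
      SimL P α₁ α₂ α x Q (dupBoth (Q.I.erase x) f₁ f₂ Q.O g₁ g₂
        (.cut .inactive (C.fill (.cut .left R α₁ (f₁ x) (Q.rename f₁ g₁)))
          α₂ (f₂ x) (Q.rename f₂ g₂)))
  | other (C : Ctx1) (R : Term) :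
      P = C.fill R → C.prinO ≠ some α₁ → C.prinO ≠ some α₂ →
      SimL P α₁ α₂ α x Q (C.fill (.cut .left (.dupR R α₁ α₂ α) α x Q))
  | split₁₂ (C : Ctx2) (R₁ R₂ : Term)
      (f₁ f₂ : InName → InName) (g₁ g₂ : OutName → OutName) :
      P = C.fill R₁ R₂ → C.Passive → α₁ ∈ R₁.O → α₂ ∈ R₂.O →
      Indexing (.cut .left (.dupR P α₁ α₂ α) α x Q) Q f₁ f₂ g₁ g₂ →
      SimL P α₁ α₂ α x Q (dupBoth (Q.I.erase x) f₁ f₂ Q.O g₁ g₂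
        (C.fill (.cut .left R₁ α₁ (f₁ x) (Q.rename f₁ g₁))
          (.cut .left R₂ α₂ (f₂ x) (Q.rename f₂ g₂))))
  | split₂₁ (C : Ctx2) (R₁ R₂ : Term)
      (f₁ f₂ : InName → InName) (g₁ g₂ : OutName → OutName) :
      P = C.fill R₁ R₂ → C.Passive → α₂ ∈ R₁.O → α₁ ∈ R₂.O →
      Indexing (.cut .left (.dupR P α₁ α₂ α) α x Q) Q f₁ f₂ g₁ g₂ →
      SimL P α₁ α₂ α x Q (dupBoth (Q.I.erase x) f₁ f₂ Q.O g₁ g₂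
        (C.fill (.cut .left R₁ α₂ (f₂ x) (Q.rename f₂ g₂))
          (.cut .left R₂ α₁ (f₁ x) (Q.rename f₁ g₁))))
  | both₁ (C : Ctx2) (R₁ R₂ : Term) :
      P = C.fill R₁ R₂ → C.Passive → α₁ ∈ R₁.O → α₂ ∈ R₁.O →
      SimL P α₁ α₂ α x Q (C.fill (.cut .left (.dupR R₁ α₁ α₂ α) α x Q) R₂)
  | both₂ (C : Ctx2) (R₁ R₂ : Term) :
      P = C.fill R₁ R₂ → C.Passive → α₁ ∈ R₂.O → α₂ ∈ R₂.O →
      SimL P α₁ α₂ α x Q (C.fill R₁ (.cut .left (.dupR R₂ α₁ α₂ α) α x Q))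

/-- `SimR P α x x₁ x₂ Q S`: the term `S` is a result `{P α ↖ x₁ x₂}Q` of the right simultaneous
substitution that stems from `P α̂ ↖ x̂ (x <^{x₁}_{x₂} Q])`. -/
inductive SimR (P : Term) (α : OutName) (x x₁ x₂ : InName) (Q : Term) : Term → Prop
  | prin₁ (C : Ctx1) (R : Term) (f₁ f₂ : InName → InName) (g₁ g₂ : OutName → OutName) :
      Q = C.fill R → C.prinI = some x₁ →
      Indexing (.cut .right P α x (.dupL x x₁ x₂ Q)) P f₁ f₂ g₁ g₂ →
      SimR P α x x₁ x₂ Q (dupBoth P.I f₁ f₂ (P.O.erase α) g₁ g₂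
        (.cut .inactive (P.rename f₁ g₁) (g₁ α) x₁
          (C.fill (.cut .right (P.rename f₂ g₂) (g₂ α) x₂ R))))
  | prin₂ (C : Ctx1) (R : Term) (f₁ f₂ : InName → InName) (g₁ g₂ : OutName → OutName) :
      Q = C.fill R → C.prinI = some x₂ →
      Indexing (.cut .right P α x (.dupL x x₁ x₂ Q)) P f₁ f₂ g₁ g₂ →
      SimR P α x x₁ x₂ Q (dupBoth P.I f₁ f₂ (P.O.erase α) g₁ g₂
        (.cut .inactive (P.rename f₂ g₂) (g₂ α) x₂
          (C.fill (.cut .right (P.rename f₁ g₁) (g₁ α) x₁ R))))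
  | other (C : Ctx1) (R : Term) :
      Q = C.fill R → C.prinI ≠ some x₁ → C.prinI ≠ some x₂ →
      SimR P α x x₁ x₂ Q (C.fill (.cut .right P α x (.dupL x x₁ x₂ R)))
  | prin₁_left (C : Ctx2) (R₁ R₂ : Term)
      (f₁ f₂ : InName → InName) (g₁ g₂ : OutName → OutName) :
      Q = C.fill R₁ R₂ → C.Passive → C.prinI = some x₁ → x₂ ∈ R₁.I →
      Indexing (.cut .right P α x (.dupL x x₁ x₂ Q)) P f₁ f₂ g₁ g₂ →
      SimR P α x x₁ x₂ Q (dupBoth P.I f₁ f₂ (P.O.erase α) g₁ g₂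
        (.cut .inactive (P.rename f₁ g₁) (g₁ α) x₁
          (C.fill (.cut .right (P.rename f₂ g₂) (g₂ α) x₂ R₁) R₂)))
  | prin₁_right (C : Ctx2) (R₁ R₂ : Term)
      (f₁ f₂ : InName → InName) (g₁ g₂ : OutName → OutName) :
      Q = C.fill R₁ R₂ → C.Passive → C.prinI = some x₁ → x₂ ∈ R₂.I →
      Indexing (.cut .right P α x (.dupL x x₁ x₂ Q)) P f₁ f₂ g₁ g₂ →
      SimR P α x x₁ x₂ Q (dupBoth P.I f₁ f₂ (P.O.erase α) g₁ g₂
        (.cut .inactive (P.rename f₁ g₁) (g₁ α) x₁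
          (C.fill R₁ (.cut .right (P.rename f₂ g₂) (g₂ α) x₂ R₂))))
  | prin₂_left (C : Ctx2) (R₁ R₂ : Term)
      (f₁ f₂ : InName → InName) (g₁ g₂ : OutName → OutName) :
      Q = C.fill R₁ R₂ → C.Passive → C.prinI = some x₂ → x₁ ∈ R₁.I →
      Indexing (.cut .right P α x (.dupL x x₁ x₂ Q)) P f₁ f₂ g₁ g₂ →
      SimR P α x x₁ x₂ Q (dupBoth P.I f₁ f₂ (P.O.erase α) g₁ g₂
        (.cut .inactive (P.rename f₂ g₂) (g₂ α) x₂
          (C.fill (.cut .right (P.rename f₁ g₁) (g₁ α) x₁ R₁) R₂)))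
  | prin₂_right (C : Ctx2) (R₁ R₂ : Term)
      (f₁ f₂ : InName → InName) (g₁ g₂ : OutName → OutName) :
      Q = C.fill R₁ R₂ → C.Passive → C.prinI = some x₂ → x₁ ∈ R₂.I →
      Indexing (.cut .right P α x (.dupL x x₁ x₂ Q)) P f₁ f₂ g₁ g₂ →
      SimR P α x x₁ x₂ Q (dupBoth P.I f₁ f₂ (P.O.erase α) g₁ g₂
        (.cut .inactive (P.rename f₂ g₂) (g₂ α) x₂
          (C.fill R₁ (.cut .right (P.rename f₁ g₁) (g₁ α) x₁ R₂))))
  | split₁₂ (C : Ctx2) (R₁ R₂ : Term)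
      (f₁ f₂ : InName → InName) (g₁ g₂ : OutName → OutName) :
      Q = C.fill R₁ R₂ → C.Passive → x₁ ∈ R₁.I → x₂ ∈ R₂.I →
      Indexing (.cut .right P α x (.dupL x x₁ x₂ Q)) P f₁ f₂ g₁ g₂ →
      SimR P α x x₁ x₂ Q (dupBoth P.I f₁ f₂ (P.O.erase α) g₁ g₂
        (C.fill (.cut .right (P.rename f₁ g₁) (g₁ α) x₁ R₁)
          (.cut .right (P.rename f₂ g₂) (g₂ α) x₂ R₂)))
  | split₂₁ (C : Ctx2) (R₁ R₂ : Term)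
      (f₁ f₂ : InName → InName) (g₁ g₂ : OutName → OutName) :
      Q = C.fill R₁ R₂ → C.Passive → x₂ ∈ R₁.I → x₁ ∈ R₂.I →
      Indexing (.cut .right P α x (.dupL x x₁ x₂ Q)) P f₁ f₂ g₁ g₂ →
      SimR P α x x₁ x₂ Q (dupBoth P.I f₁ f₂ (P.O.erase α) g₁ g₂
        (C.fill (.cut .right (P.rename f₂ g₂) (g₂ α) x₂ R₁)
          (.cut .right (P.rename f₁ g₁) (g₁ α) x₁ R₂)))
  | both₁ (C : Ctx2) (R₁ R₂ : Term) :
      Q = C.fill R₁ R₂ → C.Passive → x₁ ∈ R₁.I → x₂ ∈ R₁.I →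
      SimR P α x x₁ x₂ Q (C.fill (.cut .right P α x (.dupL x x₁ x₂ R₁)) R₂)
  | both₂ (C : Ctx2) (R₁ R₂ : Term) :
      Q = C.fill R₁ R₂ → C.Passive → x₁ ∈ R₂.I → x₂ ∈ R₂.I →
      SimR P α x x₁ x₂ Q (C.fill R₁ (.cut .right P α x (.dupL x x₁ x₂ R₂)))

/-! ### Congruence -/

/-- Structural congruence `≡`: the least congruence that contains α-conversion and the rules for
commuting and permuting duplicators and erasers. -/
inductive Cong : Term → Term → Prop
  | refl (P : Term) : Cong P P
  | symm {P Q : Term} : Cong P Q → Cong Q P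
  | trans {P Q R : Term} : Cong P Q → Cong Q R → Cong P R
  | ctx1 (C : Ctx1) {P P' : Term} : Cong P P' → Cong (C.fill P) (C.fill P')
  | ctx2 (C : Ctx2) {P P' Q Q' : Term} :
      Cong P P' → Cong Q Q' → Cong (C.fill P Q) (C.fill P' Q')
  -- renaming of bound names by new ones
  | alpha_exp {x x' : InName} {P : Term} {β β' α : OutName} :
      (Term.exp x P β α).FreshI x' → (Term.exp x P β α).FreshO β' →
      Cong (.exp x P β α)
        (.exp x' (P.rename (Function.update id x x') (Function.update id β β')) β' α)
  | alpha_imp {P Q : Term} {α α' : OutName} {x y y' : InName} :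
      (Term.imp P α x y Q).FreshO α' → (Term.imp P α x y Q).FreshI y' →
      Cong (.imp P α x y Q) (.imp (P.renO α' α) α' x y' (Q.renI y' y))
  | alpha_cut {m : Mode} {P Q : Term} {α α' : OutName} {x x' : InName} :
      (Term.cut m P α x Q).FreshO α' → (Term.cut m P α x Q).FreshI x' →
      Cong (.cut m P α x Q) (.cut m (P.renO α' α) α' x' (Q.renI x' x))
  | alpha_dupL {x x₁ x₂ x₁' x₂' : InName} {P : Term} :
      (Term.dupL x x₁ x₂ P).FreshI x₁' → (Term.dupL x x₁ x₂ P).FreshI x₂' → x₁' ≠ x₂' →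
      Cong (.dupL x x₁ x₂ P) (.dupL x x₁' x₂'
        (P.rename (Function.update (Function.update id x₁ x₁') x₂ x₂') id))
  | alpha_dupR {P : Term} {α₁ α₂ α₁' α₂' α : OutName} :
      (Term.dupR P α₁ α₂ α).FreshO α₁' → (Term.dupR P α₁ α₂ α).FreshO α₂' → α₁' ≠ α₂' →
      Cong (.dupR P α₁ α₂ α) (.dupR
        (P.rename id (Function.update (Function.update id α₁ α₁') α₂ α₂')) α₁' α₂' α)
  -- commuting names in a duplicator
  | commL {x x₁ x₂ : InName} {P : Term} : Cong (.dupL x x₁ x₂ P) (.dupL x x₂ x₁ P)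
  | commR {P : Term} {α₁ α₂ α : OutName} : Cong (.dupR P α₁ α₂ α) (.dupR P α₂ α₁ α)
  -- permuting independent duplicators
  | permLL {x x₁ x₂ y y₁ y₂ : InName} {P : Term} :
      y ≠ x₁ → y ≠ x₂ → x ≠ y₁ → x ≠ y₂ →
      Cong (.dupL x x₁ x₂ (.dupL y y₁ y₂ P)) (.dupL y y₁ y₂ (.dupL x x₁ x₂ P))
  | permRR {P : Term} {α α₁ α₂ β β₁ β₂ : OutName} :
      β ≠ α₁ → β ≠ α₂ → α ≠ β₁ → α ≠ β₂ →
      Cong (.dupR (.dupR P α₁ α₂ α) β₁ β₂ β) (.dupR (.dupR P β₁ β₂ β) α₁ α₂ α)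
  | permRL {P : Term} {x x₁ x₂ : InName} {α α₁ α₂ : OutName} :
      Cong (.dupR (.dupL x x₁ x₂ P) α₁ α₂ α) (.dupL x x₁ x₂ (.dupR P α₁ α₂ α))
  -- triplicating a name (the auxiliary name differs from the three copies)
  | assocL {x₁ x₂ x₃ y z : InName} {P : Term} :
      y ≠ x₁ → y ≠ x₂ → y ≠ x₃ →
      Cong (.dupL z y x₃ (.dupL y x₁ x₂ P)) (.dupL z x₁ y (.dupL y x₂ x₃ P))
  | assocR {P : Term} {α₁ α₂ α₃ β γ : OutName} :
      β ≠ α₁ → β ≠ α₂ → β ≠ α₃ →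
      Cong (.dupR (.dupR P α₁ α₂ β) β α₃ γ) (.dupR (.dupR P α₂ α₃ β) α₁ β γ)
  -- permuting erasers
  | erLL {x y : InName} {P : Term} : Cong (.erL y (.erL x P)) (.erL x (.erL y P))
  | erRR {P : Term} {α β : OutName} : Cong (.erR (.erR P α) β) (.erR (.erR P β) α)
  | erLR {x : InName} {P : Term} {α : OutName} :
      Cong (.erR (.erL x P) α) (.erL x (.erR P α))

/-! ### Reduction -/

/-- The reduction rules, applied at the root of a term. -/
inductive Root : Term → Term → Prop
  -- 1. activation
  | actL {P Q : Term} {α : OutName} {x : InName} : ¬ P.LPrinO α →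
      Root (.cut .inactive P α x Q) (.cut .left P α x Q)
  | actR {P Q : Term} {α : OutName} {x : InName} : ¬ Q.LPrinI x →
      Root (.cut .inactive P α x Q) (.cut .right P α x Q)
  -- 2. structural actions: erasure and duplication
  | erasL {P Q : Term} {α : OutName} {x : InName} :
      Root (.cut .left (.erR P α) α x Q) (erBoth (Q.I.erase x) P Q.O)
  | erasR {P Q : Term} {α : OutName} {x : InName} :
      Root (.cut .right P α x (.erL x Q)) (erBoth P.I Q (P.O.erase α))
  | duplL {P Q S : Term} {α₁ α₂ α : OutName} {x : InName} : SimL P α₁ α₂ α x Q S →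
      Root (.cut .left (.dupR P α₁ α₂ α) α x Q) S
  | duplR {P Q S : Term} {α : OutName} {x x₁ x₂ : InName} : SimR P α x x₁ x₂ Q S →
      Root (.cut .right P α x (.dupL x x₁ x₂ Q)) S
  -- 3. deactivation
  | deactL {P Q : Term} {α : OutName} {x : InName} : P.LPrinO α →
      Root (.cut .left P α x Q) (.cut .inactive P α x Q)
  | deactR {P Q : Term} {α : OutName} {x : InName} : Q.LPrinI x →
      Root (.cut .right P α x Q) (.cut .inactive P α x Q)
  -- 4. logical actions
  | renL {Q : Term} {α : OutName} {x y : InName} :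
      Root (.cut .inactive (.cap y α) α x Q) (Q.renI y x)
  | renR {P : Term} {α β : OutName} {x : InName} :
      Root (.cut .inactive P α x (.cap x β)) (P.renO β α)
  | insert₁ {P Q R : Term} {α β γ : OutName} {x y z : InName} :
      Root (.cut .inactive (.exp y P β α) α x (.imp Q γ x z R))
        (.cut .inactive (.cut .inactive Q γ y P) β z R)
  | insert₂ {P Q R : Term} {α β γ : OutName} {x y z : InName} :
      Root (.cut .inactive (.exp y P β α) α x (.imp Q γ x z R))
        (.cut .inactive Q γ y (.cut .inactive P β z R))
  -- 5. left propagation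
  | expL {P R : Term} {α β γ : OutName} {x y : InName} : α ≠ β →
      Root (.cut .left (.exp x P γ α) β y R) (.exp x (.cut .left P β y R) γ α)
  | impL₁ {P Q R : Term} {α β : OutName} {x y z : InName} : β ∈ P.O →
      Root (.cut .left (.imp P α x y Q) β z R) (.imp (.cut .left P β z R) α x y Q)
  | impL₂ {P Q R : Term} {α β : OutName} {x y z : InName} : β ∈ Q.O →
      Root (.cut .left (.imp P α x y Q) β z R) (.imp P α x y (.cut .left Q β z R))
  | cutcL {P R : Term} {α β : OutName} {x y : InName} :
      Root (.cut .left (.cut .inactive P α x (.cap x β)) β y R) (.cut .inactive P α y R)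
  | cutL₁ {P Q R : Term} {α β : OutName} {x y : InName} : β ∈ P.O →
      Root (.cut .left (.cut .inactive P α x Q) β y R)
        (.cut .inactive (.cut .left P β y R) α x Q)
  | cutL₂ {P Q R : Term} {α β : OutName} {x y : InName} : β ∈ Q.O → Q ≠ .cap x β →
      Root (.cut .left (.cut .inactive P α x Q) β y R)
        (.cut .inactive P α x (.cut .left Q β y R))
  | erLL {P R : Term} {β : OutName} {x y : InName} :
      Root (.cut .left (.erL x P) β y R) (.erL x (.cut .left P β y R))
  | erRL {P R : Term} {α β : OutName} {y : InName} : α ≠ β →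
      Root (.cut .left (.erR P α) β y R) (.erR (.cut .left P β y R) α)
  | dupLL {P R : Term} {β : OutName} {x x₁ x₂ y : InName} :
      Root (.cut .left (.dupL x x₁ x₂ P) β y R) (.dupL x x₁ x₂ (.cut .left P β y R))
  | dupRL {P R : Term} {α α₁ α₂ β : OutName} {y : InName} : α ≠ β →
      Root (.cut .left (.dupR P α₁ α₂ α) β y R) (.dupR (.cut .left P β y R) α₁ α₂ α)
  -- 5. right propagation
  | expR {P Q : Term} {α β γ : OutName} {x y : InName} :
      Root (.cut .right P α x (.exp y Q β γ)) (.exp y (.cut .right P α x Q) β γ)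
  | impR₁ {P Q R : Term} {α β : OutName} {x y z : InName} : x ∈ Q.I →
      Root (.cut .right P α x (.imp Q β y z R)) (.imp (.cut .right P α x Q) β y z R)
  | impR₂ {P Q R : Term} {α β : OutName} {x y z : InName} : x ∈ R.I →
      Root (.cut .right P α x (.imp Q β y z R)) (.imp Q β y z (.cut .right P α x R))
  | cutcR {P R : Term} {α β : OutName} {x y : InName} :
      Root (.cut .right P α x (.cut .inactive (.cap x β) β y R)) (.cut .inactive P α y R)
  | cutR₁ {P Q R : Term} {α β : OutName} {x y : InName} : x ∈ Q.I → Q ≠ .cap x β →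
      Root (.cut .right P α x (.cut .inactive Q β y R))
        (.cut .inactive (.cut .right P α x Q) β y R)
  | cutR₂ {P Q R : Term} {α β : OutName} {x y : InName} : x ∈ R.I →
      Root (.cut .right P α x (.cut .inactive Q β y R))
        (.cut .inactive Q β y (.cut .right P α x R))
  | erLR {P Q : Term} {α : OutName} {x y : InName} : x ≠ y →
      Root (.cut .right P α x (.erL y Q)) (.erL y (.cut .right P α x Q))
  | erRR {P Q : Term} {α β : OutName} {x : InName} :
      Root (.cut .right P α x (.erR Q β)) (.erR (.cut .right P α x Q) β)
  | dupLR {P Q : Term} {α : OutName} {x y y₁ y₂ : InName} : x ≠ y →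
      Root (.cut .right P α x (.dupL y y₁ y₂ Q)) (.dupL y y₁ y₂ (.cut .right P α x Q))
  | dupRR {P Q : Term} {α β β₁ β₂ : OutName} {x : InName} :
      Root (.cut .right P α x (.dupR Q β₁ β₂ β)) (.dupR (.cut .right P α x Q) β₁ β₂ β)

/-- The reduction relation `→`: the rules are applied to redexes that obey the convention on
names, in any context, and up to congruence (α-conversion included). -/
inductive Red : Term → Term → Prop
  | root {T T' : Term} : T.Conv → Root T T' → Red T T'
  | ctx1 (C : Ctx1) {P P' : Term} : Red P P' → Red (C.fill P) (C.fill P')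
  | ctx2_left (C : Ctx2) {P P' : Term} (Q : Term) : Red P P' → Red (C.fill P Q) (C.fill P' Q)
  | ctx2_right (C : Ctx2) (P : Term) {Q Q' : Term} : Red Q Q' → Red (C.fill P Q) (C.fill P Q')
  | cong {S T T' S' : Term} : Cong S T → Red T T' → Cong T' S' → Red S S'

/-! ### The type assignment system -/

/-- Contexts: sets of pairs (name, type). The contexts of a typable term are finite, with at most
one type for a name. -/
abbrev Cxt (𝔸 : Type*) := Set (ℕ × Ty 𝔸)

/-- The names declared in a context. -/
def dom {𝔸 : Type*} (Γ : Cxt 𝔸) : Set ℕ := Prod.fst '' Γ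

/-- `Typed Γ P Δ` is the judgement `P : Γ ⊢ Δ`. A comma is the union of sets of declarations of
different names. Active cuts are typed as cuts. -/
inductive Typed {𝔸 : Type*} : Cxt 𝔸 → Term → Cxt 𝔸 → Prop
  | ax (x : InName) (α : OutName) (A : Ty 𝔸) : Typed {(x, A)} (.cap x α) {(α, A)}
  | arrL {Γ Γ' Δ Δ' : Cxt 𝔸} {P Q : Term} {α : OutName} {x y : InName} {A B : Ty 𝔸} :
      Typed Γ P (insert (α, A) Δ) → Typed (insert (y, B) Γ') Q Δ' →
      α ∉ dom Δ → y ∉ dom Γ' →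
      Disjoint (dom Γ) (dom Γ') → Disjoint (dom Δ) (dom Δ') → x ∉ dom Γ → x ∉ dom Γ' →
      Typed (insert (x, .arr A B) (Γ ∪ Γ')) (.imp P α x y Q) (Δ ∪ Δ')
  | arrR {Γ Δ : Cxt 𝔸} {P : Term} {x : InName} {β α : OutName} {A B : Ty 𝔸} :
      Typed (insert (x, A) Γ) P (insert (β, B) Δ) →
      x ∉ dom Γ → β ∉ dom Δ → α ∉ dom Δ →
      Typed Γ (.exp x P β α) (insert (α, .arr A B) Δ)
  | cut {Γ Γ' Δ Δ' : Cxt 𝔸} {m : Mode} {P Q : Term} {α : OutName} {x : InName} {A : Ty 𝔸} :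
      Typed Γ P (insert (α, A) Δ) → Typed (insert (x, A) Γ') Q Δ' →
      α ∉ dom Δ → x ∉ dom Γ' →
      Disjoint (dom Γ) (dom Γ') → Disjoint (dom Δ) (dom Δ') →
      Typed (Γ ∪ Γ') (.cut m P α x Q) (Δ ∪ Δ')
  | weakL {Γ Δ : Cxt 𝔸} {P : Term} {x : InName} {A : Ty 𝔸} :
      Typed Γ P Δ → x ∉ dom Γ → Typed (insert (x, A) Γ) (.erL x P) Δ
  | weakR {Γ Δ : Cxt 𝔸} {P : Term} {α : OutName} {A : Ty 𝔸} :
      Typed Γ P Δ → α ∉ dom Δ → Typed Γ (.erR P α) (insert (α, A) Δ)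
  | contL {Γ Δ : Cxt 𝔸} {P : Term} {x x₁ x₂ : InName} {A : Ty 𝔸} :
      Typed (insert (x₁, A) (insert (x₂, A) Γ)) P Δ →
      x₁ ≠ x₂ → x₁ ∉ dom Γ → x₂ ∉ dom Γ → x ∉ dom Γ →
      Typed (insert (x, A) Γ) (.dupL x x₁ x₂ P) Δ
  | contR {Γ Δ : Cxt 𝔸} {P : Term} {α α₁ α₂ : OutName} {A : Ty 𝔸} :
      Typed Γ P (insert (α₁, A) (insert (α₂, A) Δ)) →
      α₁ ≠ α₂ → α₁ ∉ dom Δ → α₂ ∉ dom Δ → α ∉ dom Δ →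
      Typed Γ (.dupR P α₁ α₂ α) (insert (α, A) Δ)

end StarX

set_option linter.unusedSimpArgs false
set_option linter.unnecessarySeqFocus false

/-! In a linear term the free names of a subterm determine which declarations it receives, so the
splitting of contexts in a derivation carries no information of its own. `WellTyped` therefore
replaces contexts by total assignments of types to innames and outnames and keeps only the equations
between types; a binder overrides the assignment at the bound name. `Typed.wellTyped` and
`WellTyped.typed` pass between the two views: the contexts of a typed term consist of the
declarations of its free names, and conversely linearity supplies every side condition of the typing
rules.

It then suffices that a reduction step keeps linearity, keeps the free names, and preserves
`WellTyped` for all assignments. This is `Refines`. Since it quantifies over all assignments, it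
passes under binders, and it is transitive. Congruence may be used in either direction, so
refinement is proved both ways for it (`Cong.interchangeable`).

There remain the rules at the root (`Root.refines`). Only the types of free names matter
(`WellTyped.congr`), and by the convention on names a subterm that enters or leaves the scope of a
binder does not contain the bound name free; hence propagation affects no type. A capsule equates
the types of its two names. An exporter facing an importer gives `A → B = A' → B'`, so the smaller
cuts are well typed. Erasure drops a subterm and restores its names by erasers.

In a duplication, both indexed copies of a name receive the type of the original. The indexed names
being new and distinct, such an assignment exists (`exists_splits`); the copies are well typed under
it by pulling types back along the renaming (`wellTyped_rename`), and the duplicators join the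
copies again (`Refines.dupBoth`). Only the place of the copies depends on the shape of the term;
`CopiesL` and `CopiesR` isolate this part. -/

namespace StarX

/-! ### Typability under assignments, and renaming -/

/-- Typability of a term under assignments of types to all names. -/
def WellTyped {𝔸 : Type*} : (InName → Ty 𝔸) → (OutName → Ty 𝔸) → Term → Prop
  | γ, δ, .cap x α => γ x = δ α
  | γ, δ, .exp x P β α => ∃ A B, δ α = .arr A B ∧
      WellTyped (Function.update γ x A) (Function.update δ β B) P
  | γ, δ, .imp P α x y Q => ∃ A B, γ x = .arr A B ∧
      WellTyped γ (Function.update δ α A) P ∧ WellTyped (Function.update γ y B) δ Q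
  | γ, δ, .cut _ P α x Q => ∃ A,
      WellTyped γ (Function.update δ α A) P ∧ WellTyped (Function.update γ x A) δ Q
  | γ, δ, .erL _ P => WellTyped γ δ P
  | γ, δ, .erR P _ => WellTyped γ δ P
  | γ, δ, .dupL x x₁ x₂ P =>
      WellTyped (Function.update (Function.update γ x₁ (γ x)) x₂ (γ x)) δ P
  | γ, δ, .dupR P α₁ α₂ α =>
      WellTyped γ (Function.update (Function.update δ α₁ (δ α)) α₂ (δ α)) P

/-- A binder overrides the assignment at the bound name, so values at names that are not free are
never consulted. This is the tool for every change of scope below. -/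
theorem WellTyped.congr {𝔸 : Type*} {P : Term} {γ γ' : InName → Ty 𝔸} {δ δ' : OutName → Ty 𝔸}
    (h : WellTyped γ δ P) (hγ : ∀ x ∈ P.I, γ' x = γ x) (hδ : ∀ α ∈ P.O, δ' α = δ α) :
    WellTyped γ' δ' P := by
  induction P generalizing γ γ' δ δ' with
  | cap x α => simp_all [WellTyped, Term.I, Term.O]
  | exp x P β α ih =>
    obtain ⟨A, B, h1, h2⟩ := h
    exact ⟨A, B, by grind [Term.O], ih h2 (by grind [Term.I, Function.update_apply])
      (by grind [Term.O, Function.update_apply])⟩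
  | imp P α x y Q ihP ihQ =>
    obtain ⟨A, B, h1, h2, h3⟩ := h
    exact ⟨A, B, by grind [Term.I], ihP h2 (by grind [Term.I, Function.update_apply])
      (by grind [Term.O, Function.update_apply]), ihQ h3 (by grind [Term.I, Function.update_apply])
      (by grind [Term.O, Function.update_apply])⟩
  | cut m P α x Q ihP ihQ =>
    obtain ⟨A, h2, h3⟩ := h
    exact ⟨A, ihP h2 (by grind [Term.I, Function.update_apply])
      (by grind [Term.O, Function.update_apply]), ihQ h3 (by grind [Term.I, Function.update_apply])
      (by grind [Term.O, Function.update_apply])⟩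
  | erL x P ih => exact ih (γ := γ) (δ := δ) h (by grind [Term.I]) (by grind [Term.O])
  | erR P x ih => exact ih (γ := γ) (δ := δ) h (by grind [Term.I]) (by grind [Term.O])
  | dupL x x₁ x₂ P ih =>
    exact ih h (by grind [Term.I, Function.update_apply]) (by grind [Term.O])
  | dupR P x₁ x₂ x ih =>
    exact ih h (by grind [Term.I]) (by grind [Term.O, Function.update_apply])

/-- The renaming `f`, `g` of free names is not captured by a binder of `P`. -/
structure NoCapture (f : InName → InName) (g : OutName → OutName) (P : Term) : Prop where
  I : ∀ x ∈ P.I, f x = x ∨ f x ∉ P.bndI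
  O : ∀ α ∈ P.O, g α = α ∨ g α ∉ P.bndO

/-- Below a binder the renaming is made to fix the bound name. That name may be bound once more
further inside, which is why `NoCapture` admits the alternative `f x = x`. -/
theorem NoCapture.exp {f g x P β α} (h : NoCapture f g (.exp x P β α)) :
    NoCapture (Function.update f x x) (Function.update g β β) P := by
  obtain ⟨h1, h2⟩ := h
  constructor <;> grind [Term.I, Term.O, Term.bndI, Term.bndO, Function.update_apply]

theorem NoCapture.imp_left {f g P α x y Q} (h : NoCapture f g (.imp P α x y Q)) :
    NoCapture f (Function.update g α α) P := by
  obtain ⟨h1, h2⟩ := h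
  constructor <;> grind [Term.I, Term.O, Term.bndI, Term.bndO, Function.update_apply]

theorem NoCapture.imp_right {f g P α x y Q} (h : NoCapture f g (.imp P α x y Q)) :
    NoCapture (Function.update f y y) g Q := by
  obtain ⟨h1, h2⟩ := h
  constructor <;> grind [Term.I, Term.O, Term.bndI, Term.bndO, Function.update_apply]

theorem NoCapture.cut_left {f g m P α x Q} (h : NoCapture f g (.cut m P α x Q)) :
    NoCapture f (Function.update g α α) P := by
  obtain ⟨h1, h2⟩ := h
  constructor <;> grind [Term.I, Term.O, Term.bndI, Term.bndO, Function.update_apply]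

theorem NoCapture.cut_right {f g m P α x Q} (h : NoCapture f g (.cut m P α x Q)) :
    NoCapture (Function.update f x x) g Q := by
  obtain ⟨h1, h2⟩ := h
  constructor <;> grind [Term.I, Term.O, Term.bndI, Term.bndO, Function.update_apply]

theorem NoCapture.erL {f g x P} (h : NoCapture f g (.erL x P)) : NoCapture f g P := by
  obtain ⟨h1, h2⟩ := h
  constructor <;> grind [Term.I, Term.O, Term.bndI, Term.bndO]

theorem NoCapture.erR {f g x P} (h : NoCapture f g (.erR P x)) : NoCapture f g P := by
  obtain ⟨h1, h2⟩ := h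
  constructor <;> grind [Term.I, Term.O, Term.bndI, Term.bndO]

theorem NoCapture.dupL {f g x x₁ x₂ P} (h : NoCapture f g (.dupL x x₁ x₂ P)) :
    NoCapture (Function.update (Function.update f x₁ x₁) x₂ x₂) g P := by
  obtain ⟨h1, h2⟩ := h
  constructor <;> grind [Term.I, Term.O, Term.bndI, Term.bndO, Function.update_apply]

theorem NoCapture.dupR {f g x x₁ x₂ P} (h : NoCapture f g (.dupR P x₁ x₂ x)) :
    NoCapture f (Function.update (Function.update g x₁ x₁) x₂ x₂) P := by
  obtain ⟨h1, h2⟩ := h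
  constructor <;> grind [Term.I, Term.O, Term.bndI, Term.bndO, Function.update_apply]

/-- The hypothesis is the absence of capture: no other name is sent to the bound one. Under it,
renaming commutes with binding. -/
theorem image_update_self_erase {f : ℕ → ℕ} {s : Finset ℕ} {x : ℕ}
    (h : ∀ z ∈ s.erase x, f z ≠ x) :
    (s.image (Function.update f x x)).erase x = (s.erase x).image f := by
  ext z; simp only [Finset.mem_erase, Finset.mem_image, Function.update_apply]; grind

theorem image_update_self_erase_erase {f : ℕ → ℕ} {s : Finset ℕ} {x y : ℕ}
    (h : ∀ z ∈ (s.erase x).erase y, f z ≠ x ∧ f z ≠ y) :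
    ((s.image (Function.update (Function.update f x x) y y)).erase x).erase y =
      ((s.erase x).erase y).image f := by
  ext z; simp only [Finset.mem_erase, Finset.mem_image, Function.update_apply]; grind

theorem Term.free_rename {P : Term} {f g} (h : NoCapture f g P) :
    (P.rename f g).I = P.I.image f ∧ (P.rename f g).O = P.O.image g := by
  induction P generalizing f g with
  | cap x α => simp [Term.rename, Term.I, Term.O]
  | exp x P β α ih =>
    have := ih h.exp
    obtain ⟨h1, h2⟩ := h
    simp only [Term.rename, Term.I, Term.O, this, Finset.image_insert]
    constructor
    · rw [image_update_self_erase]; grind [Term.I, Term.bndI]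
    · rw [image_update_self_erase]; grind [Term.O, Term.bndO]
  | imp P α x y Q ihP ihQ =>
    have hP := ihP h.imp_left
    have hQ := ihQ h.imp_right
    obtain ⟨h1, h2⟩ := h
    simp only [Term.rename, Term.I, Term.O, hP, hQ, Finset.image_insert, Finset.image_union]
    constructor
    · rw [image_update_self_erase]; grind [Term.I, Term.bndI]
    · rw [image_update_self_erase]; grind [Term.O, Term.bndO]
  | cut m P α x Q ihP ihQ =>
    have hP := ihP h.cut_left
    have hQ := ihQ h.cut_right
    obtain ⟨h1, h2⟩ := h
    simp only [Term.rename, Term.I, Term.O, hP, hQ, Finset.image_union]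
    constructor
    · rw [image_update_self_erase]; grind [Term.I, Term.bndI]
    · rw [image_update_self_erase]; grind [Term.O, Term.bndO]
  | erL x P ih => simp [Term.rename, Term.I, Term.O, ih h.erL]
  | erR P x ih => simp [Term.rename, Term.I, Term.O, ih h.erR]
  | dupL x x₁ x₂ P ih =>
    have := ih h.dupL
    obtain ⟨h1, h2⟩ := h
    simp only [Term.rename, Term.I, Term.O, this, Finset.image_insert, and_true]
    rw [image_update_self_erase_erase]; grind [Term.I, Term.bndI]
  | dupR P x₁ x₂ x ih =>
    have := ih h.dupR
    obtain ⟨h1, h2⟩ := h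
    simp only [Term.rename, Term.I, Term.O, this, Finset.image_insert, true_and]
    rw [image_update_self_erase_erase]; grind [Term.O, Term.bndO]

/-- Types are pulled back along the renaming. At a binder, updating after or before the composition
with `f` gives the same values on the free names of the body, because no other free name is sent to
the bound one. Injectivity plays no role here. -/
theorem wellTyped_rename {𝔸 : Type*} {P : Term} {f g} {γ : InName → Ty 𝔸} {δ : OutName → Ty 𝔸}
    (h : NoCapture f g P) : WellTyped γ δ (P.rename f g) ↔ WellTyped (γ ∘ f) (δ ∘ g) P := by
  induction P generalizing f g γ δ with
  | cap x α => simp [Term.rename, WellTyped]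
  | exp x P β α ih =>
    simp only [Term.rename, WellTyped, ih h.exp]
    obtain ⟨h1, h2⟩ := h
    refine exists_congr fun A => exists_congr fun B => and_congr_right' ⟨fun h => h.congr ?_ ?_,
      fun h => h.congr ?_ ?_⟩ <;>
      grind [Term.I, Term.bndI, Term.O, Term.bndO, Function.update_apply]
  | imp P α x y Q ihP ihQ =>
    simp only [Term.rename, WellTyped, ihP h.imp_left, ihQ h.imp_right]
    obtain ⟨h1, h2⟩ := h
    refine exists_congr fun A => exists_congr fun B => and_congr_right' (and_congr
      ⟨fun h => h.congr ?_ ?_, fun h => h.congr ?_ ?_⟩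
      ⟨fun h => h.congr ?_ ?_, fun h => h.congr ?_ ?_⟩) <;>
      grind [Term.I, Term.bndI, Term.O, Term.bndO, Function.update_apply]
  | cut m P α x Q ihP ihQ =>
    simp only [Term.rename, WellTyped, ihP h.cut_left, ihQ h.cut_right]
    obtain ⟨h1, h2⟩ := h
    refine exists_congr fun A => and_congr
      ⟨fun h => h.congr ?_ ?_, fun h => h.congr ?_ ?_⟩
      ⟨fun h => h.congr ?_ ?_, fun h => h.congr ?_ ?_⟩ <;>
      grind [Term.I, Term.bndI, Term.O, Term.bndO, Function.update_apply]
  | erL x P ih => simp only [Term.rename, WellTyped, ih h.erL]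
  | erR P x ih => simp only [Term.rename, WellTyped, ih h.erR]
  | dupL x x₁ x₂ P ih =>
    simp only [Term.rename, WellTyped, ih h.dupL]
    obtain ⟨h1, h2⟩ := h
    refine ⟨fun h => h.congr ?_ ?_, fun h => h.congr ?_ ?_⟩ <;>
      grind [Term.I, Term.bndI, Term.O, Term.bndO, Function.update_apply]
  | dupR P x₁ x₂ x ih =>
    simp only [Term.rename, WellTyped, ih h.dupR]
    obtain ⟨h1, h2⟩ := h
    refine ⟨fun h => h.congr ?_ ?_, fun h => h.congr ?_ ?_⟩ <;>
      grind [Term.I, Term.bndI, Term.O, Term.bndO, Function.update_apply]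

/-- Injectivity prevents two free occurrences from receiving the same name. It passes to the body of
a binder because the bound name stays fixed and, by `NoCapture`, is not the image of another free
name. -/
theorem Term.linear_rename {P : Term} {f g} (h : NoCapture f g P) (hf : Set.InjOn f P.I)
    (hg : Set.InjOn g P.O) : (P.rename f g).Linear ↔ P.Linear := by
  induction P generalizing f g with
  | cap x α => simp [Term.rename, Term.Linear]
  | exp x P β α ih =>
    have e := free_rename h.exp
    have ih := ih h.exp ?_ ?_
    · obtain ⟨h1, h2⟩ := h
      simp only [Term.rename, Term.Linear, ih, e, Term.I, Term.O, Set.InjOn, Term.bndI, Term.bndO, Finset.mem_image, Finset.mem_erase,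
        Finset.mem_insert, Finset.mem_coe, Function.update_apply, List.mem_cons] at h1 h2 hf hg ⊢
      grind
    · obtain ⟨h1, h2⟩ := h
      grind [Set.InjOn, Term.I, Term.O, Term.bndI, Term.bndO, Function.update_apply]
    · obtain ⟨h1, h2⟩ := h
      grind [Set.InjOn, Term.I, Term.O, Term.bndI, Term.bndO, Function.update_apply]
  | imp P α x y Q ihP ihQ =>
    have eP := free_rename h.imp_left
    have eQ := free_rename h.imp_right
    have ihP := ihP h.imp_left ?_ ?_
    have ihQ := ihQ h.imp_right ?_ ?_
    · obtain ⟨h1, h2⟩ := h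
      simp only [Term.rename, Term.Linear, ihP, ihQ, eP, eQ, Term.I, Term.O, Set.InjOn, Term.bndI, Term.bndO, Finset.mem_image, Finset.mem_erase,
        Finset.mem_insert, Finset.mem_union, Finset.mem_coe, Function.update_apply, List.mem_cons, List.mem_append, Finset.disjoint_left] at h1 h2 hf hg ⊢
      grind
    all_goals
      obtain ⟨h1, h2⟩ := h
      grind [Set.InjOn, Term.I, Term.O, Term.bndI, Term.bndO, Function.update_apply]
  | cut m P α x Q ihP ihQ =>
    have eP := free_rename h.cut_left
    have eQ := free_rename h.cut_right
    have ihP := ihP h.cut_left ?_ ?_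
    have ihQ := ihQ h.cut_right ?_ ?_
    · obtain ⟨h1, h2⟩ := h
      simp only [Term.rename, Term.Linear, ihP, ihQ, eP, eQ, Term.I, Term.O, Set.InjOn, Term.bndI, Term.bndO, Finset.mem_image, Finset.mem_erase,
        Finset.mem_union, Finset.mem_coe, Function.update_apply, List.mem_cons, List.mem_append, Finset.disjoint_left] at h1 h2 hf hg ⊢
      grind
    all_goals
      obtain ⟨h1, h2⟩ := h
      grind [Set.InjOn, Term.I, Term.O, Term.bndI, Term.bndO, Function.update_apply]
  | erL x P ih =>
    have ih := ih h.erL (by grind [Set.InjOn, Term.I]) hg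
    have e := free_rename h.erL
    simp only [Term.rename, Term.Linear, ih, e, Finset.mem_image, Set.InjOn, Term.I] at hf ⊢
    grind
  | erR P x ih =>
    have ih := ih h.erR hf (by grind [Set.InjOn, Term.O])
    have e := free_rename h.erR
    simp only [Term.rename, Term.Linear, ih, e, Finset.mem_image, Set.InjOn, Term.O] at hg ⊢
    grind
  | dupL x x₁ x₂ P ih =>
    have ih := ih h.dupL ?_ hg
    · have e := free_rename h.dupL
      obtain ⟨h1, h2⟩ := h
      simp only [Term.rename, Term.Linear, ih, e, Term.I, Set.InjOn, Term.bndI, Finset.mem_image, Finset.mem_erase,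
        Finset.mem_insert, Finset.mem_coe, Function.update_apply, List.mem_cons] at h1 hf ⊢
      grind
    · obtain ⟨h1, h2⟩ := h
      grind [Set.InjOn, Term.I, Term.bndI, Function.update_apply]
  | dupR P x₁ x₂ x ih =>
    have ih := ih h.dupR hf ?_
    · have e := free_rename h.dupR
      obtain ⟨h1, h2⟩ := h
      simp only [Term.rename, Term.Linear, ih, e, Term.O, Set.InjOn, Term.bndO, Finset.mem_image, Finset.mem_erase,
        Finset.mem_insert, Finset.mem_coe, Function.update_apply, List.mem_cons] at h2 hg ⊢
      grind
    · obtain ⟨h1, h2⟩ := h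
      grind [Set.InjOn, Term.O, Term.bndO, Function.update_apply]

/-! ### Contexts versus assignments -/

/-- The declarations `x : γ x` for `x ∈ s`. -/
def declarations {𝔸 : Type*} (γ : ℕ → Ty 𝔸) (s : Finset ℕ) : Cxt 𝔸 :=
  {p | p.1 ∈ s ∧ p.2 = γ p.1}

theorem dom_declarations {𝔸 : Type*} (γ : ℕ → Ty 𝔸) (s : Finset ℕ) :
    dom (declarations γ s) = s := by
  ext x; simp [dom, declarations]

theorem mem_dom {𝔸 : Type*} {Γ : Cxt 𝔸} {x : ℕ} : x ∈ dom Γ ↔ ∃ A, (x, A) ∈ Γ := by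
  simp [dom]

theorem dom_insert {𝔸 : Type*} (Γ : Cxt 𝔸) (p : ℕ × Ty 𝔸) :
    dom (insert p Γ) = insert p.1 (dom Γ) := Set.image_insert_eq

theorem dom_union {𝔸 : Type*} (Γ Γ' : Cxt 𝔸) : dom (Γ ∪ Γ') = dom Γ ∪ dom Γ' :=
  Set.image_union ..

/-- Every name has at most one type. -/
def Functional {𝔸 : Type*} (Γ : Cxt 𝔸) : Prop :=
  ∀ x A B, (x, A) ∈ Γ → (x, B) ∈ Γ → A = B

/-- The assignment `γ` agrees with the declarations of `Γ`. -/
def Agrees {𝔸 : Type*} (γ : ℕ → Ty 𝔸) (Γ : Cxt 𝔸) : Prop := ∀ x A, (x, A) ∈ Γ → γ x = A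

theorem Agrees.update {𝔸 : Type*} {γ : ℕ → Ty 𝔸} {Γ : Cxt 𝔸} {x : ℕ} {A : Ty 𝔸}
    (h : Agrees γ Γ) (hx : x ∉ dom Γ) : Agrees (Function.update γ x A) (insert (x, A) Γ) := by
  intro y B hy
  rw [mem_dom] at hx
  have := h y B
  grind [Function.update_apply]

theorem Functional.insert {𝔸 : Type*} {Γ : Cxt 𝔸} {x : ℕ} {A : Ty 𝔸}
    (h : Functional Γ) (hx : x ∉ dom Γ) : Functional (insert (x, A) Γ) := by
  intro y B C
  rw [mem_dom] at hx
  have := h y B C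
  grind

theorem Functional.union {𝔸 : Type*} {Γ Γ' : Cxt 𝔸} (h : Functional Γ) (h' : Functional Γ')
    (hd : Disjoint (dom Γ) (dom Γ')) : Functional (Γ ∪ Γ') := by
  intro y B C hB hC
  have h1 := h y B C
  have h2 := h' y B C
  have : y ∈ dom Γ → y ∉ dom Γ' := fun h => Set.disjoint_left.1 hd h
  rw [mem_dom, mem_dom] at this
  have hC' : (y, C) ∈ Γ → (y, B) ∉ Γ' := fun k k' => this ⟨C, k⟩ ⟨B, k'⟩
  have hB' : (y, B) ∈ Γ → (y, C) ∉ Γ' := fun k k' => this ⟨B, k⟩ ⟨C, k'⟩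
  grind

theorem Functional.mono {𝔸 : Type*} {Γ Γ' : Cxt 𝔸} (h : Functional Γ') (hs : Γ ⊆ Γ') :
    Functional Γ := fun x A B hA hB => h x A B (hs hA) (hs hB)

/-- Weakening is explicit in the term, as an eraser, so a derivation cannot declare a name that does
not occur free. -/
theorem Typed.dom_eq {𝔸 : Type*} {Γ Δ : Cxt 𝔸} {P : Term} (h : Typed Γ P Δ) :
    dom Γ = P.I ∧ dom Δ = P.O := by
  induction h with
  | ax => simp [dom, Term.I, Term.O]
  | _ =>
    simp only [dom_insert, dom_union, Set.ext_iff, Term.I, Term.O, Set.mem_insert_iff,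
      Set.mem_union, Finset.mem_coe, Finset.mem_insert, Finset.mem_union, Finset.mem_erase,
      Set.disjoint_left] at *
    grind

/-- A comma joins declarations of different names only, so no rule can give a name a second type. -/
theorem Typed.functional {𝔸 : Type*} {Γ Δ : Cxt 𝔸} {P : Term} (h : Typed Γ P Δ) :
    Functional Γ ∧ Functional Δ := by
  induction h with
  | ax => constructor <;> intro y B C <;> simp +contextual
  | arrL _ _ _ _ hΓ hΔ hx hx' ih ih' =>
    refine ⟨((ih.1.union (ih'.1.mono (Set.subset_insert ..)) hΓ).insert ?_),
      (ih.2.mono (Set.subset_insert ..)).union ih'.2 hΔ⟩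
    rw [dom_union]; exact fun h => h.elim hx hx'
  | arrR _ _ _ hα ih =>
    exact ⟨ih.1.mono (Set.subset_insert ..), (ih.2.mono (Set.subset_insert ..)).insert hα⟩
  | cut _ _ _ _ hΓ hΔ ih ih' =>
    exact ⟨ih.1.union (ih'.1.mono (Set.subset_insert ..)) hΓ,
      (ih.2.mono (Set.subset_insert ..)).union ih'.2 hΔ⟩
  | weakL _ h ih => exact ⟨ih.1.insert h, ih.2⟩
  | weakR _ h ih => exact ⟨ih.1, ih.2.insert h⟩
  | contL _ _ _ _ h ih =>
    exact ⟨(ih.1.mono ((Set.subset_insert ..).trans (Set.subset_insert ..))).insert h, ih.2⟩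
  | contR _ _ _ _ h ih =>
    exact ⟨ih.1, (ih.2.mono ((Set.subset_insert ..).trans (Set.subset_insert ..))).insert h⟩

/-- Total assignments need a default type for undeclared names. Without base types there is none,
but then there is no derivation either. -/
theorem Typed.nonempty {𝔸 : Type*} {Γ Δ : Cxt 𝔸} {P : Term} (h : Typed Γ P Δ) :
    Nonempty (Ty 𝔸) := by
  induction h <;> first | assumption | exact ⟨‹Ty 𝔸›⟩

theorem Functional.exists_eq_declarations {𝔸 : Type*} [Nonempty (Ty 𝔸)] {Γ : Cxt 𝔸}
    {s : Finset ℕ} (h : Functional Γ) (hs : dom Γ = s) : ∃ γ, Agrees γ Γ ∧ Γ = declarations γ s := by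
  classical
  have h1 : ∀ x, ∃ A, ∀ B, (x, B) ∈ Γ → A = B := by
    intro x
    by_cases hx : ∃ A, (x, A) ∈ Γ
    · obtain ⟨A, hA⟩ := hx
      exact ⟨A, fun B hB => h x A B hA hB⟩
    -- An undeclared name receives an arbitrary type; `declarations γ s` does not see it.
    · exact ⟨Classical.arbitrary _, fun B hB => (hx ⟨B, hB⟩).elim⟩
  choose γ hγ using h1
  refine ⟨γ, hγ, ?_⟩
  ext ⟨x, A⟩
  have hx : x ∈ dom Γ ↔ x ∈ s := by rw [hs]; simp
  rw [mem_dom] at hx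
  simp only [declarations, Set.mem_ofPred_eq]
  constructor
  · exact fun hA => ⟨hx.1 ⟨A, hA⟩, (hγ x A hA).symm⟩
  · rintro ⟨h1, rfl⟩
    obtain ⟨B, hB⟩ := hx.2 h1
    rwa [hγ x B hB]

/-- The premises of a rule declare part of the context of the conclusion together with the bound
names, and these are new for that part; so the updated assignment again agrees with the premise
(`Agrees.update`). -/
theorem Typed.wellTyped {𝔸 : Type*} {Γ Δ : Cxt 𝔸} {P : Term} (h : Typed Γ P Δ)
    {γ : InName → Ty 𝔸} {δ : OutName → Ty 𝔸} (hγ : Agrees γ Γ) (hδ : Agrees δ Δ) :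
    WellTyped γ δ P := by
  induction h generalizing γ δ with
  | ax x α A => simp [WellTyped, hγ x A rfl, hδ α A rfl]
  | arrL _ _ hα hy _ _ _ _ ih ih' =>
    refine ⟨_, _, hγ _ _ (.inl rfl), ih ?_ ?_, ih' ?_ ?_⟩
    · exact fun z B hB => hγ z B (.inr (.inl hB))
    · exact .update (fun z B hB => hδ z B (.inl hB)) hα
    · exact .update (fun z B hB => hγ z B (.inr (.inr hB))) hy
    · exact fun z B hB => hδ z B (.inr hB)
  | arrR _ hx hβ _ ih =>
    exact ⟨_, _, hδ _ _ (.inl rfl), ih (hγ.update hx)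
      (.update (fun z B hB => hδ z B (.inr hB)) hβ)⟩
  | @cut _ _ _ _ _ _ _ _ _ A _ _ hα hy _ _ ih ih' =>
    refine ⟨A, ih ?_ ?_, ih' ?_ ?_⟩
    · exact fun z B hB => hγ z B (.inl hB)
    · exact .update (fun z B hB => hδ z B (.inl hB)) hα
    · exact .update (fun z B hB => hγ z B (.inr hB)) hy
    · exact fun z B hB => hδ z B (.inr hB)
  | weakL _ _ ih => exact ih (fun z B hB => hγ z B (.inr hB)) hδ
  | weakR _ _ ih => exact ih hγ (fun z B hB => hδ z B (.inr hB))
  | contL _ hne h1 h2 _ ih =>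
    -- In the premise `x₁` is declared outside `x₂`, whereas `WellTyped` updates at `x₁` first; as
    -- `x₁ ≠ x₂`, the updates commute.
    rw [WellTyped, hγ _ _ (.inl rfl), Function.update_comm hne]
    refine ih (.update (.update (fun z B hB => hγ z B (.inr hB)) h2) ?_) hδ
    simp [dom_insert, hne, h1]
  | contR _ hne h1 h2 _ ih =>
    rw [WellTyped, hδ _ _ (.inl rfl), Function.update_comm hne]
    refine ih hγ (.update (.update (fun z B hB => hδ z B (.inr hB)) h2) ?_)
    simp [dom_insert, hne, h1]

theorem declarations_insert {𝔸 : Type*} (γ : ℕ → Ty 𝔸) (s : Finset ℕ) (x : ℕ) :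
    declarations γ (insert x s) = insert (x, γ x) (declarations γ s) := by
  ext ⟨y, B⟩; simp only [declarations]; grind

theorem declarations_union {𝔸 : Type*} (γ : ℕ → Ty 𝔸) (s t : Finset ℕ) :
    declarations γ (s ∪ t) = declarations γ s ∪ declarations γ t := by
  ext ⟨y, B⟩; simp only [declarations]; grind

/-- The hypothesis `x ∈ s` is the linearity condition that a binder binds an actual occurrence: it
makes the bound name split off as the declaration that the typing rule requires. -/
theorem declarations_update {𝔸 : Type*} (γ : ℕ → Ty 𝔸) {s : Finset ℕ} {x : ℕ} (A : Ty 𝔸)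
    (hx : x ∈ s) : declarations (Function.update γ x A) s =
      insert (x, A) (declarations γ (s.erase x)) := by
  ext ⟨y, B⟩
  simp only [declarations, Set.mem_ofPred_eq, Set.mem_insert_iff, Function.update_apply]
  grind

/-- Linearity supplies what assignments forget: the bound names occur, and the declarations used by
the two subterms of an importer or a cut have disjoint names. -/
theorem WellTyped.typed {𝔸 : Type*} {P : Term} {γ : InName → Ty 𝔸} {δ : OutName → Ty 𝔸}
    (h : WellTyped γ δ P) (hP : P.Linear) :
    Typed (declarations γ P.I) P (declarations δ P.O) := by
  induction P generalizing γ δ with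
  | cap x α =>
    have h : γ x = δ α := h
    have e : ∀ (γ : ℕ → Ty 𝔸) x, declarations γ {x} = {(x, γ x)} := by
      intro γ x; ext ⟨y, B⟩; simp only [declarations]; grind
    simpa only [Term.I, Term.O, e, h] using Typed.ax x α (δ α)
  | exp x P β α ih =>
    obtain ⟨A, B, h1, h2⟩ := h
    obtain ⟨hl, hx, hβ, hα⟩ := hP
    have := ih h2 hl
    rw [declarations_update γ A hx, declarations_update δ B hβ] at this
    rw [Term.I, Term.O, declarations_insert, h1]
    exact .arrR this (by simp [dom_declarations]) (by simp [dom_declarations])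
      (by simpa only [dom_declarations, Finset.mem_coe] using hα)
  | imp P α x y Q ihP ihQ =>
    obtain ⟨A, B, h1, h2, h3⟩ := h
    obtain ⟨hP, hQ, hα, hy, hx, hx', hI, hO⟩ := hP
    have hP := ihP h2 hP
    have hQ := ihQ h3 hQ
    rw [declarations_update γ B hy] at hQ
    rw [declarations_update δ A hα] at hP
    rw [Term.I, Term.O, declarations_insert, h1, declarations_union, declarations_union]
    refine .arrL hP hQ ?_ ?_ ?_ ?_ ?_ ?_ <;>
      simp only [dom_declarations, Finset.disjoint_coe, Finset.mem_coe] <;> first | assumption | simp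
  | cut m P α x Q ihP ihQ =>
    obtain ⟨A, h2, h3⟩ := h
    obtain ⟨hP, hQ, hα, hx, hI, hO⟩ := hP
    have hP := ihP h2 hP
    have hQ := ihQ h3 hQ
    rw [declarations_update γ A hx] at hQ
    rw [declarations_update δ A hα] at hP
    rw [Term.I, Term.O, declarations_union, declarations_union]
    refine .cut hP hQ ?_ ?_ ?_ ?_ <;>
      simp only [dom_declarations, Finset.disjoint_coe, Finset.mem_coe] <;> first | assumption | simp
  | erL x P ih =>
    rw [Term.I, Term.O, declarations_insert]
    exact .weakL (ih h hP.1) (by simpa only [dom_declarations, Finset.mem_coe] using hP.2)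
  | erR P x ih =>
    rw [Term.I, Term.O, declarations_insert]
    exact .weakR (ih h hP.1) (by simpa only [dom_declarations, Finset.mem_coe] using hP.2)
  | dupL x x₁ x₂ P ih =>
    obtain ⟨hl, hne, h1, h2, hx⟩ := hP
    have := ih h hl
    rw [Function.update_comm hne, declarations_update _ _ h1,
      declarations_update _ _ (Finset.mem_erase.2 ⟨hne.symm, h2⟩)] at this
    rw [Term.I, Term.O, declarations_insert]
    refine .contL this hne ?_ ?_ ?_ <;>
      simp only [dom_declarations, Finset.mem_coe] <;> first | assumption | simp
  | dupR P x₁ x₂ x ih =>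
    obtain ⟨hl, hne, h1, h2, hx⟩ := hP
    have := ih h hl
    rw [Function.update_comm hne, declarations_update _ _ h1,
      declarations_update _ _ (Finset.mem_erase.2 ⟨hne.symm, h2⟩)] at this
    rw [Term.I, Term.O, declarations_insert]
    refine .contR this hne ?_ ?_ ?_ <;>
      simp only [dom_declarations, Finset.mem_coe] <;> first | assumption | simp

/-! ### Refinement, the invariant of a step -/

/-- Simplification rules for membership of names in finite sets and lists. -/
theorem nameSimps :
    (∀ (a b : ℕ) (s : Finset ℕ), a ∈ insert b s ↔ a = b ∨ a ∈ s) ∧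
    (∀ (a b : ℕ) (s : Finset ℕ), a ∈ s.erase b ↔ a ≠ b ∧ a ∈ s) ∧
    (∀ (a : ℕ) (s t : Finset ℕ), a ∈ s ∪ t ↔ a ∈ s ∨ a ∈ t) ∧
    (∀ a b : ℕ, a ∈ ({b} : Finset ℕ) ↔ a = b) ∧
    (∀ s t : Finset ℕ, Disjoint s t ↔ ∀ ⦃a⦄, a ∈ s → a ∉ t) ∧
    (∀ (a b : ℕ) (l : List ℕ), a ∈ b :: l ↔ a = b ∨ a ∈ l) ∧
    (∀ (a : ℕ) (l l' : List ℕ), a ∈ l ++ l' ↔ a ∈ l ∨ a ∈ l') ∧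
    (∀ (a : ℕ) (l : List ℕ), (a :: l).Nodup ↔ a ∉ l ∧ l.Nodup) ∧
    (∀ l l' : List ℕ, (l ++ l').Nodup ↔
      l.Nodup ∧ l'.Nodup ∧ ∀ a ∈ l, ∀ b ∈ l', a ≠ b) :=
  ⟨fun _ _ _ => Finset.mem_insert, fun _ _ _ => Finset.mem_erase, fun _ _ _ => Finset.mem_union,
    fun _ _ => Finset.mem_singleton, fun _ _ => Finset.disjoint_left, fun _ _ _ => List.mem_cons,
    fun _ _ _ => List.mem_append, fun _ _ => List.nodup_cons, fun _ _ => List.nodup_append⟩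

/-- `Q` is linear, has the free names of `P`, and inherits the types of `P`. -/
structure Refines (𝔸 : Type*) (P Q : Term) : Prop where
  linear : Q.Linear
  I_eq : Q.I = P.I
  O_eq : Q.O = P.O
  wellTyped : ∀ (γ : InName → Ty 𝔸) (δ : OutName → Ty 𝔸), WellTyped γ δ P → WellTyped γ δ Q

theorem Refines.refl {𝔸 : Type*} {P : Term} (h : P.Linear) : Refines 𝔸 P P :=
  ⟨h, rfl, rfl, fun _ _ h => h⟩

theorem Refines.trans {𝔸 : Type*} {P Q R : Term} (h : Refines 𝔸 P Q) (h' : Refines 𝔸 Q R) :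
    Refines 𝔸 P R :=
  ⟨h'.linear, h'.I_eq.trans h.I_eq, h'.O_eq.trans h.O_eq,
    fun γ δ t => h'.wellTyped γ δ (h.wellTyped γ δ t)⟩

/-- The linearity conditions of the context mention only the free names of the term in its hole, and
these do not change. The binder of the context updates the assignment, which is harmless since a
refinement concerns all assignments. -/
theorem Refines.ctx1 {𝔸 : Type*} (C : Ctx1) {P P' : Term} (h : P.Linear → Refines 𝔸 P P')
    (hl : (C.fill P).Linear) : Refines 𝔸 (C.fill P) (C.fill P') := by
  have hP : P.Linear := by cases C <;> exact hl.1
  obtain ⟨h1, h2, h3, h4⟩ := h hP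
  cases C <;> simp only [Ctx1.fill] at hl ⊢ <;>
    refine ⟨by simp_all [Term.Linear], by simp [Term.I, h2], by simp [Term.O, h3], ?_⟩
  · rintro γ δ ⟨A, B, e, t⟩
    exact ⟨A, B, e, h4 _ _ t⟩
  all_goals exact fun γ δ t => h4 _ _ t

theorem Refines.ctx2 {𝔸 : Type*} (C : Ctx2) {P P' Q Q' : Term}
    (hP : P.Linear → Refines 𝔸 P P') (hQ : Q.Linear → Refines 𝔸 Q Q')
    (hl : (C.fill P Q).Linear) : Refines 𝔸 (C.fill P Q) (C.fill P' Q') := by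
  have hPl : P.Linear := by cases C <;> exact hl.1
  have hQl : Q.Linear := by cases C <;> exact hl.2.1
  obtain ⟨h1, h2, h3, h4⟩ := hP hPl
  obtain ⟨k1, k2, k3, k4⟩ := hQ hQl
  cases C <;> simp only [Ctx2.fill] at hl ⊢ <;>
    refine ⟨by simp_all [Term.Linear], by simp [Term.I, h2, k2], by simp [Term.O, h3, k3], ?_⟩
  · rintro γ δ ⟨A, B, e, t, t'⟩
    exact ⟨A, B, e, h4 _ _ t, k4 _ _ t'⟩
  · rintro γ δ ⟨A, t, t'⟩
    exact ⟨A, h4 _ _ t, k4 _ _ t'⟩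

/-! ### Congruence -/

/-- Mutual refinement of the terms `P` and `Q`, provided that one of them is linear. -/
def Interchangeable (𝔸 : Type*) (P Q : Term) : Prop :=
  (P.Linear → Refines 𝔸 P Q) ∧ (Q.Linear → Refines 𝔸 Q P)

/-- The equivalence of types may be proved for linear terms only. Permuting duplicators needs this:
linearity separates `x₁`, `x₂` from `y₁`, `y₂`, and otherwise the inner duplicator could override
the outer one. -/
theorem Interchangeable.of_iff {𝔸 : Type*} {P Q : Term} (hl : P.Linear ↔ Q.Linear)
    (h : P.Linear → Q.I = P.I ∧ Q.O = P.O ∧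
      ∀ (γ : InName → Ty 𝔸) (δ : OutName → Ty 𝔸), WellTyped γ δ P ↔ WellTyped γ δ Q) :
    Interchangeable 𝔸 P Q := by
  refine ⟨fun hP => ?_, fun hQ => ?_⟩
  · obtain ⟨h1, h2, h3⟩ := h hP
    exact ⟨hl.1 hP, h1, h2, fun γ δ => (h3 γ δ).1⟩
  · obtain ⟨h1, h2, h3⟩ := h (hl.2 hQ)
    exact ⟨hl.2 hQ, h1.symm, h2.symm, fun γ δ => (h3 γ δ).2⟩

theorem wellTyped_congr_iff {𝔸 : Type*} {P : Term} {γ γ' : InName → Ty 𝔸}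
    {δ δ' : OutName → Ty 𝔸} (hγ : ∀ x ∈ P.I, γ' x = γ x) (hδ : ∀ α ∈ P.O, δ' α = δ α) :
    WellTyped γ δ P ↔ WellTyped γ' δ' P :=
  ⟨fun h => h.congr hγ hδ, fun h => h.congr (fun x hx => (hγ x hx).symm)
    (fun α hα => (hδ α hα).symm)⟩

/-- Facts on the renaming `f`, `g` of the free names of `P`. -/
theorem Term.rename_spec {𝔸 : Type*} {P : Term} {f g} (hI : ∀ x ∈ P.I, f x = x ∨ f x ∉ P.bndI)
    (hO : ∀ α ∈ P.O, g α = α ∨ g α ∉ P.bndO) (hf : ∀ x ∈ P.I, ∀ y ∈ P.I, f x = f y → x = y)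
    (hg : ∀ x ∈ P.O, ∀ y ∈ P.O, g x = g y → x = y) :
    (P.rename f g).I = P.I.image f ∧ (P.rename f g).O = P.O.image g ∧
    ((P.rename f g).Linear ↔ P.Linear) ∧
    ∀ (γ : InName → Ty 𝔸) (δ : OutName → Ty 𝔸),
      WellTyped γ δ (P.rename f g) ↔ WellTyped (γ ∘ f) (δ ∘ g) P := by
  have h : NoCapture f g P := ⟨hI, hO⟩
  exact ⟨(free_rename h).1, (free_rename h).2,
    linear_rename h (fun x hx y hy => hf x hx y hy) (fun x hx y hy => hg x hx y hy),
    fun _ _ => wellTyped_rename h⟩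

/-- Freshness of the new names has two effects on the renaming of the body: a new name is not bound
there, so nothing is captured, and it is not already free there, so the renaming is injective. The
other four forms of α-conversion hold for the same reason. -/
theorem Interchangeable.alpha_exp {𝔸 : Type*} {x x' : InName} {P : Term} {β β' α : OutName}
    (hx : (Term.exp x P β α).FreshI x') (hβ : (Term.exp x P β α).FreshO β') :
    Interchangeable 𝔸 (.exp x P β α)
      (.exp x' (P.rename (Function.update id x x') (Function.update id β β')) β' α) := by
  simp only [Term.FreshI, Term.FreshO, Term.I, Term.O, Term.bndI, Term.bndO, nameSimps] at hx hβ
  obtain ⟨hI, hO, hl, ht⟩ := Term.rename_spec (𝔸 := 𝔸) (P := P) (f := Function.update id x x')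
    (g := Function.update id β β') (by grind [Function.update_apply])
    (by grind [Function.update_apply]) (by grind [Function.update_apply])
    (by grind [Function.update_apply])
  refine .of_iff ?_ fun _ => ⟨?_, ?_, fun γ δ => ?_⟩
  · simp only [Term.Linear, hl, hI, hO, Finset.mem_image, Finset.mem_erase, Function.update_apply]
    grind
  · ext z
    simp only [Term.I, hI, Finset.mem_image, Finset.mem_erase, Function.update_apply]
    grind
  · ext z
    simp only [Term.O, hO, Finset.mem_image, Function.update_apply, nameSimps]
    grind
  · simp only [WellTyped, ht]
    refine exists_congr fun A => exists_congr fun B => and_congr_right' (wellTyped_congr_iff ?_ ?_)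
      <;> grind [Function.update_apply]

theorem Interchangeable.alpha_imp {𝔸 : Type*} {P Q : Term} {α α' : OutName} {x y y' : InName}
    (hα : (Term.imp P α x y Q).FreshO α') (hy : (Term.imp P α x y Q).FreshI y') :
    Interchangeable 𝔸 (.imp P α x y Q) (.imp (P.renO α' α) α' x y' (Q.renI y' y)) := by
  simp only [Term.FreshI, Term.FreshO, Term.I, Term.O, Term.bndI, Term.bndO, nameSimps] at hy hα
  obtain ⟨hI, hO, hl, ht⟩ := Term.rename_spec (𝔸 := 𝔸) (P := P) (f := id)
    (g := Function.update id α α') (by grind)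
    (by grind [Function.update_apply]) (by grind)
    (by grind [Function.update_apply])
  obtain ⟨hI', hO', hl', ht'⟩ := Term.rename_spec (𝔸 := 𝔸) (P := Q) (f := Function.update id y y')
    (g := id) (by grind [Function.update_apply])
    (by grind) (by grind [Function.update_apply])
    (by grind)
  refine .of_iff ?_ fun _ => ⟨?_, ?_, fun γ δ => ?_⟩
  · simp only [Term.Linear, Term.renI, Term.renO, hl, hI, hO, hl', hI', hO', Finset.mem_image, Function.update_apply, Finset.image_id, nameSimps]
    grind
  · ext z
    simp only [Term.I, Term.renI, Term.renO, hI, hI', Finset.mem_image, Function.update_apply, Finset.image_id, nameSimps]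
    grind
  · ext z
    simp only [Term.O, Term.renI, Term.renO, hO, hO', Finset.mem_image, Function.update_apply, Finset.image_id, nameSimps]
    grind
  · simp only [WellTyped, Term.renI, Term.renO, ht, ht']
    refine exists_congr fun A => exists_congr fun B => and_congr_right'
      (and_congr (wellTyped_congr_iff ?_ ?_) (wellTyped_congr_iff ?_ ?_))
      <;> grind [Function.update_apply]

theorem Interchangeable.alpha_cut {𝔸 : Type*} {m : Mode} {P Q : Term} {α α' : OutName}
    {x x' : InName} (hα : (Term.cut m P α x Q).FreshO α') (hy : (Term.cut m P α x Q).FreshI x') :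
    Interchangeable 𝔸 (.cut m P α x Q) (.cut m (P.renO α' α) α' x' (Q.renI x' x)) := by
  simp only [Term.FreshI, Term.FreshO, Term.I, Term.O, Term.bndI, Term.bndO, nameSimps] at hy hα
  obtain ⟨hI, hO, hl, ht⟩ := Term.rename_spec (𝔸 := 𝔸) (P := P) (f := id)
    (g := Function.update id α α') (by grind)
    (by grind [Function.update_apply]) (by grind)
    (by grind [Function.update_apply])
  obtain ⟨hI', hO', hl', ht'⟩ := Term.rename_spec (𝔸 := 𝔸) (P := Q) (f := Function.update id x x')
    (g := id) (by grind [Function.update_apply])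
    (by grind) (by grind [Function.update_apply])
    (by grind)
  refine .of_iff ?_ fun _ => ⟨?_, ?_, fun γ δ => ?_⟩
  · simp only [Term.Linear, Term.renI, Term.renO, hl, hI, hO, hl', hI', hO', Finset.mem_image, Function.update_apply, Finset.image_id, nameSimps]
    grind
  · ext z
    simp only [Term.I, Term.renI, Term.renO, hI, hI', Finset.mem_image, Function.update_apply, Finset.image_id, nameSimps]
    grind
  · ext z
    simp only [Term.O, Term.renI, Term.renO, hO, hO', Finset.mem_image, Function.update_apply, Finset.image_id, nameSimps]
    grind
  · simp only [WellTyped, Term.renI, Term.renO, ht, ht']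
    refine exists_congr fun A =>
      (and_congr (wellTyped_congr_iff ?_ ?_) (wellTyped_congr_iff ?_ ?_))
      <;> grind [Function.update_apply]

theorem Interchangeable.alpha_dupL {𝔸 : Type*} {x x₁ x₂ x₁' x₂' : InName} {P : Term}
    (h1 : (Term.dupL x x₁ x₂ P).FreshI x₁') (h2 : (Term.dupL x x₁ x₂ P).FreshI x₂')
    (hne : x₁' ≠ x₂') :
    Interchangeable 𝔸 (.dupL x x₁ x₂ P) (.dupL x x₁' x₂'
      (P.rename (Function.update (Function.update id x₁ x₁') x₂ x₂') id)) := by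
  simp only [Term.FreshI, Term.I, Term.bndI, nameSimps] at h1 h2
  obtain ⟨hI, hO, hl, ht⟩ := Term.rename_spec (𝔸 := 𝔸) (P := P)
    (f := Function.update (Function.update id x₁ x₁') x₂ x₂')
    (g := id) (by grind [Function.update_apply])
    (by grind) (by grind [Function.update_apply]) (by grind)
  refine .of_iff ?_ fun hlin => ⟨?_, ?_, fun γ δ => ?_⟩
  · simp only [Term.Linear, hl, hI, Finset.mem_image, Finset.mem_erase, Function.update_apply]
    grind
  · ext z
    simp only [Term.I, hI, Finset.mem_image, Function.update_apply, nameSimps]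
    grind
  · simp [Term.O, hO]
  · simp only [WellTyped, ht]
    have := hlin.2.1
    refine wellTyped_congr_iff ?_ ?_ <;> grind [Function.update_apply]

theorem Interchangeable.alpha_dupR {𝔸 : Type*} {α α₁ α₂ α₁' α₂' : OutName} {P : Term}
    (h1 : (Term.dupR P α₁ α₂ α).FreshO α₁') (h2 : (Term.dupR P α₁ α₂ α).FreshO α₂')
    (hne : α₁' ≠ α₂') :
    Interchangeable 𝔸 (.dupR P α₁ α₂ α) (.dupR
      (P.rename id (Function.update (Function.update id α₁ α₁') α₂ α₂')) α₁' α₂' α) := by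
  simp only [Term.FreshO, Term.O, Term.bndO, nameSimps] at h1 h2
  obtain ⟨hI, hO, hl, ht⟩ := Term.rename_spec (𝔸 := 𝔸) (P := P) (f := id)
    (g := Function.update (Function.update id α₁ α₁') α₂ α₂') (by grind)
    (by grind [Function.update_apply]) (by grind) (by grind [Function.update_apply])
  refine .of_iff ?_ fun hlin => ⟨?_, ?_, fun γ δ => ?_⟩
  · simp only [Term.Linear, hl, hO, Finset.mem_image, Finset.mem_erase, Function.update_apply]
    grind
  · simp [Term.I, hI]
  · ext z
    simp only [Term.O, hO, Finset.mem_image, Function.update_apply, nameSimps]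
    grind
  · simp only [WellTyped, ht]
    have := hlin.2.1
    refine wellTyped_congr_iff ?_ ?_ <;> grind [Function.update_apply]

/-- Symmetry forces both directions into the induction. In a chain, the linearity of the middle term
comes from the refinement just obtained. -/
theorem Cong.interchangeable (𝔸 : Type*) {P Q : Term} (h : Cong P Q) :
    Interchangeable 𝔸 P Q := by
  induction h with
  | refl P => exact ⟨.refl, .refl⟩
  | symm _ ih => exact ih.symm
  | trans _ _ ih ih' =>
    exact ⟨fun h => (ih.1 h).trans (ih'.1 (ih.1 h).linear),
      fun h => (ih'.2 h).trans (ih.2 (ih'.2 h).linear)⟩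
  | ctx1 C _ ih => exact ⟨.ctx1 C ih.1, .ctx1 C ih.2⟩
  | ctx2 C _ _ ih ih' => exact ⟨.ctx2 C ih.1 ih'.1, .ctx2 C ih.2 ih'.2⟩
  | alpha_exp h1 h2 => exact .alpha_exp h1 h2
  | alpha_imp h1 h2 => exact .alpha_imp h1 h2
  | alpha_cut h1 h2 => exact .alpha_cut h1 h2
  | alpha_dupL h1 h2 h3 => exact .alpha_dupL h1 h2 h3
  | alpha_dupR h1 h2 h3 => exact .alpha_dupR h1 h2 h3
  -- The commutation and permutation rules: the free names agree as sets, and the assignments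
  -- reaching the common subterm agree on its free names.
  | _ =>
    refine .of_iff ?_ fun hl => ⟨?_, ?_, fun γ δ => ?_⟩
    · simp only [Term.Linear, Term.I, Term.O, nameSimps]; grind
    · ext z
      simp only [Term.Linear, Term.I, Term.O, nameSimps] at * <;> grind
    · ext z
      simp only [Term.Linear, Term.I, Term.O, nameSimps] at * <;> grind
    · simp only [Term.Linear, Term.I, Term.O, nameSimps] at hl
      simp only [WellTyped] <;> apply wellTyped_congr_iff <;> grind [Function.update_apply]

/-! ### Lists of erasers -/

theorem foldl_erR (𝔸 : Type*) (L : List OutName) (P : Term) :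
    (L.foldl .erR P).I = P.I ∧ (∀ α, α ∈ (L.foldl .erR P).O ↔ α ∈ L ∨ α ∈ P.O) ∧
    (P.Linear → L.Nodup → (∀ α ∈ L, α ∉ P.O) → (L.foldl .erR P).Linear) ∧
    ∀ (γ : InName → Ty 𝔸) (δ : OutName → Ty 𝔸),
      WellTyped γ δ (L.foldl .erR P) ↔ WellTyped γ δ P := by
  induction L generalizing P with
  | nil => simp +contextual
  | cons a L ih =>
    obtain ⟨h1, h2, h3, h4⟩ := ih (.erR P a)
    refine ⟨h1, fun α => ?_, fun hP hL hd => h3 ?_ ?_ ?_, h4⟩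
    · rw [List.foldl_cons, h2]; grind [Term.O]
    · exact ⟨hP, hd a (by simp)⟩
    · grind
    · grind [Term.O]

theorem foldr_erL (𝔸 : Type*) (L : List InName) (P : Term) :
    (L.foldr .erL P).O = P.O ∧ (∀ x, x ∈ (L.foldr .erL P).I ↔ x ∈ L ∨ x ∈ P.I) ∧
    (P.Linear → L.Nodup → (∀ x ∈ L, x ∉ P.I) → (L.foldr .erL P).Linear) ∧
    ∀ (γ : InName → Ty 𝔸) (δ : OutName → Ty 𝔸),
      WellTyped γ δ (L.foldr .erL P) ↔ WellTyped γ δ P := by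
  induction L with
  | nil => simp +contextual
  | cons a L ih =>
    obtain ⟨h1, h2, h3, h4⟩ := ih
    refine ⟨h1, fun α => ?_, fun hP hL hd => ⟨h3 ?_ ?_ ?_, ?_⟩, h4⟩ <;> grind [Term.I]

theorem erBoth_spec (𝔸 : Type*) (s : Finset InName) (P : Term) (t : Finset OutName) :
    (erBoth s P t).I = s ∪ P.I ∧ (erBoth s P t).O = t ∪ P.O ∧
    (P.Linear → Disjoint s P.I → Disjoint t P.O → (erBoth s P t).Linear) ∧
    ∀ (γ : InName → Ty 𝔸) (δ : OutName → Ty 𝔸), WellTyped γ δ P → WellTyped γ δ (erBoth s P t) := by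
  obtain ⟨h1, h2, h3, h4⟩ := foldl_erR 𝔸 (t.sort (· ≤ ·)) P
  obtain ⟨k1, k2, k3, k4⟩ := foldr_erL 𝔸 (s.sort (· ≤ ·)) ((t.sort (· ≤ ·)).foldl .erR P)
  refine ⟨?_, ?_, fun hP hs ht => k3 (h3 hP (t.sort_nodup _) ?_) (s.sort_nodup _) ?_,
    fun γ δ h => (k4 γ δ).2 ((h4 γ δ).2 h)⟩
  · ext z; simp [erBoth, k2, h1]
  · ext z; simp [erBoth, k1, h2]
  · simpa [Finset.disjoint_left] using ht
  · simpa [Finset.disjoint_left, h1] using hs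

/-! ### Lists of duplicators -/

/-- The names `f₁ a`, `f₂ a` for `a ∈ L` are pairwise distinct elements of `s`, and `L` is disjoint
from `s`. -/
structure Joins (f₁ f₂ : ℕ → ℕ) (L : List ℕ) (s : Finset ℕ) : Prop where
  nodup : L.Nodup
  notMem : ∀ a ∈ L, a ∉ s
  mem : ∀ a ∈ L, f₁ a ∈ s ∧ f₂ a ∈ s
  inj₁ : ∀ a ∈ L, ∀ b ∈ L, f₁ a = f₁ b → a = b
  inj₂ : ∀ a ∈ L, ∀ b ∈ L, f₂ a = f₂ b → a = b
  apart : ∀ a ∈ L, ∀ b ∈ L, f₁ a ≠ f₂ b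

/-- The assignment `γ'` on `s` comes from `γ` by splitting every `a ∈ L` into `f₁ a`, `f₂ a`. -/
structure Splits {𝔸 : Type*} (f₁ f₂ : ℕ → ℕ) (L : List ℕ) (s : Finset ℕ) (γ γ' : ℕ → Ty 𝔸) :
    Prop where
  left : ∀ a ∈ L, γ' (f₁ a) = γ a
  right : ∀ a ∈ L, γ' (f₂ a) = γ a
  other : ∀ z ∈ s, (∀ a ∈ L, z ≠ f₁ a ∧ z ≠ f₂ a) → γ' z = γ z

/-- For `foldr`: the head becomes the outermost duplicator, so the tail acts on the original term.
-/
theorem Joins.of_cons {f₁ f₂ : ℕ → ℕ} {a : ℕ} {L : List ℕ} {s : Finset ℕ}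
    (h : Joins f₁ f₂ (a :: L) s) : Joins f₁ f₂ L s where
  nodup := (List.nodup_cons.1 h.nodup).2
  notMem b hb := h.notMem b (.tail _ hb)
  mem b hb := h.mem b (.tail _ hb)
  inj₁ b hb c hc := h.inj₁ b (.tail _ hb) c (.tail _ hc)
  inj₂ b hb c hc := h.inj₂ b (.tail _ hb) c (.tail _ hc)
  apart b hb c hc := h.apart b (.tail _ hb) c (.tail _ hc)

theorem Joins.head_ne {f₁ f₂ : ℕ → ℕ} {a b : ℕ} {L : List ℕ} {s : Finset ℕ}
    (h : Joins f₁ f₂ (a :: L) s) (hb : b ∈ L) :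
    b ≠ a ∧ f₁ b ≠ f₁ a ∧ f₁ b ≠ f₂ a ∧ f₂ b ≠ f₁ a ∧ f₂ b ≠ f₂ a ∧ f₁ b ≠ a ∧ f₂ b ≠ a ∧
      b ≠ f₁ a ∧ b ≠ f₂ a := by
  have hne : b ≠ a := fun e => (List.nodup_cons.1 h.nodup).1 (e ▸ hb)
  have hb : b ∈ a :: L := .tail _ hb
  have ha : a ∈ a :: L := .head _
  exact ⟨hne, fun e => hne (h.inj₁ b hb a ha e), h.apart b hb a ha, (h.apart a ha b hb).symm,
    fun e => hne (h.inj₂ b hb a ha e), fun e => h.notMem a ha (e ▸ (h.mem b hb).1),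
    fun e => h.notMem a ha (e ▸ (h.mem b hb).2), fun e => h.notMem b hb (e ▸ (h.mem a ha).1),
    fun e => h.notMem b hb (e ▸ (h.mem a ha).2)⟩

/-- For `foldl`: the head becomes the innermost duplicator, so the tail acts on a term in which `f₁
a`, `f₂ a` have already been joined into `a`. -/
theorem Joins.tail {f₁ f₂ : ℕ → ℕ} {a : ℕ} {L : List ℕ} {s : Finset ℕ}
    (h : Joins f₁ f₂ (a :: L) s) :
    Joins f₁ f₂ L (insert a ((s.erase (f₁ a)).erase (f₂ a))) where
  nodup := h.of_cons.nodup
  notMem b hb := by simp [h.head_ne hb, h.of_cons.notMem b hb]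
  mem b hb := by simp [h.head_ne hb, h.of_cons.mem b hb]
  inj₁ := h.of_cons.inj₁
  inj₂ := h.of_cons.inj₂
  apart := h.of_cons.apart

/-- The assignment on the left is the one that reaches the tail of a `foldr` from the outermost
duplicator. -/
theorem Splits.of_cons {𝔸 : Type*} {f₁ f₂ : ℕ → ℕ} {a : ℕ} {L : List ℕ} {s : Finset ℕ}
    {γ γ' : ℕ → Ty 𝔸} (h : Joins f₁ f₂ (a :: L) s) (hs : Splits f₁ f₂ (a :: L) s γ γ') :
    Splits f₁ f₂ L s (Function.update (Function.update γ (f₁ a) (γ a)) (f₂ a) (γ a)) γ' where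
  left b hb := by simp [h.head_ne hb, hs.left b (.tail _ hb)]
  right b hb := by simp [h.head_ne hb, hs.right b (.tail _ hb)]
  other z hz hL := by
    simp only [Function.update_apply]
    split_ifs with e e'
    · exact e ▸ hs.right a (.head _)
    · exact e' ▸ hs.left a (.head _)
    · exact hs.other z hz (List.forall_mem_cons.2 ⟨⟨e', e⟩, hL⟩)

theorem Splits.tail {𝔸 : Type*} {f₁ f₂ : ℕ → ℕ} {a : ℕ} {L : List ℕ} {s : Finset ℕ}
    {γ γ' : ℕ → Ty 𝔸} (h : Joins f₁ f₂ (a :: L) s) (hs : Splits f₁ f₂ (a :: L) s γ γ') :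
    Splits f₁ f₂ L (insert a ((s.erase (f₁ a)).erase (f₂ a))) γ (Function.update γ' a (γ a)) where
  left b hb := by simp [h.head_ne hb, hs.left b (.tail _ hb)]
  right b hb := by simp [h.head_ne hb, hs.right b (.tail _ hb)]
  other z hz hL := by
    simp only [Function.update_apply]
    split_ifs with e
    · rw [e]
    · simp only [Finset.mem_insert, Finset.mem_erase, e, false_or] at hz
      exact hs.other z hz.2.2 (List.forall_mem_cons.2 ⟨⟨hz.2.1, hz.1⟩, hL⟩)

theorem foldl_dupR (𝔸 : Type*) {g₁ g₂ : OutName → OutName} {L : List OutName} {P : Term}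
    (hP : P.Linear) (h : Joins g₁ g₂ L P.O) :
    letI T := L.foldl (fun T α => Term.dupR T (g₁ α) (g₂ α) α) P
    T.Linear ∧ T.I = P.I ∧
    (∀ z, z ∈ T.O ↔ z ∈ L ∨ z ∈ P.O ∧ ∀ a ∈ L, z ≠ g₁ a ∧ z ≠ g₂ a) ∧
    ∀ (γ : InName → Ty 𝔸) (δ δ' : OutName → Ty 𝔸), Splits g₁ g₂ L P.O δ δ' →
      WellTyped γ δ' P → WellTyped γ δ T := by
  induction L generalizing P with
  | nil =>
    refine ⟨hP, rfl, by simp, fun γ δ δ' hs t => t.congr (fun _ _ => rfl) fun α hα => ?_⟩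
    exact (hs.other α hα (by simp)).symm
  | cons a L ih =>
    have ha := h.mem a (.head _)
    have ha' := h.notMem a (.head _)
    obtain ⟨k1, k2, k3, k4⟩ := ih (P := .dupR P (g₁ a) (g₂ a) a)
      ⟨hP, h.apart a (.head _) a (.head _), ha.1, ha.2, by simp [ha']⟩ h.tail
    refine ⟨k1, k2, fun z => ?_, fun γ δ δ' hs t =>
      -- Nothing is known about `δ' a`, since `a` is not free in `P`; once the copies are joined,
      -- `a` is free and must have the type `δ a`.
      k4 γ δ (Function.update δ' a (δ a)) (hs.tail h) (t.congr (fun _ _ => rfl) fun z hz => ?_)⟩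
    · rw [List.foldl_cons, k3, List.forall_mem_cons]
      simp only [Term.O, nameSimps]
      have hne : ∀ b ∈ L, a ≠ g₁ b ∧ a ≠ g₂ b :=
        fun b hb => ⟨(h.head_ne hb).2.2.2.2.2.1.symm, (h.head_ne hb).2.2.2.2.2.2.1.symm⟩
      by_cases hz : z = a
      · subst hz; tauto
      · tauto
    · have hz' : z ≠ a := fun e => ha' (e ▸ hz)
      simp only [Function.update_apply, if_true, hz', if_false]
      split_ifs with e e'
      · exact e ▸ (hs.right a (.head _)).symm
      · exact e' ▸ (hs.left a (.head _)).symm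
      · rfl

theorem foldr_dupL (𝔸 : Type*) {f₁ f₂ : InName → InName} {L : List InName} {P : Term}
    (hP : P.Linear) (h : Joins f₁ f₂ L P.I) :
    letI T := L.foldr (fun x T => Term.dupL x (f₁ x) (f₂ x) T) P
    T.Linear ∧ T.O = P.O ∧
    (∀ z, z ∈ T.I ↔ z ∈ L ∨ z ∈ P.I ∧ ∀ a ∈ L, z ≠ f₁ a ∧ z ≠ f₂ a) ∧
    ∀ (γ γ' : InName → Ty 𝔸) (δ : OutName → Ty 𝔸), Splits f₁ f₂ L P.I γ γ' →
      WellTyped γ' δ P → WellTyped γ δ T := by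
  induction L with
  | nil =>
    refine ⟨hP, rfl, by simp, fun γ γ' δ hs t => t.congr (fun x hx => ?_) fun _ _ => rfl⟩
    exact (hs.other x hx (by simp)).symm
  | cons a L ih =>
    have ha := h.mem a (.head _)
    have ha' := h.notMem a (.head _)
    have hne : ∀ b ∈ L, (f₁ a ≠ f₁ b ∧ f₁ a ≠ f₂ b) ∧ (f₂ a ≠ f₁ b ∧ f₂ a ≠ f₂ b) ∧
        b ≠ f₁ a ∧ b ≠ f₂ a ∧ b ≠ a := fun b hb => by
      have := h.head_ne hb
      tauto
    obtain ⟨k1, k2, k3, k4⟩ := ih h.of_cons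
    refine ⟨⟨k1, h.apart a (.head _) a (.head _), ?_, ?_, ?_⟩, k2, fun z => ?_,
      fun γ γ' δ hs t => k4 _ γ' δ (hs.of_cons h) t⟩
    · exact (k3 _).2 (.inr ⟨ha.1, fun b hb => (hne b hb).1⟩)
    · exact (k3 _).2 (.inr ⟨ha.2, fun b hb => (hne b hb).2.1⟩)
    · simp only [Finset.mem_erase, k3]
      have : a ∉ L := (List.nodup_cons.1 h.nodup).1
      tauto
    · rw [List.forall_mem_cons]
      simp only [List.foldr_cons, Term.I, k3, nameSimps]
      have := hne z
      tauto

/-- The copies of all names of `s` are pairwise distinct, so a copy determines its original and can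
be given the type of that original. -/
theorem exists_splits {𝔸 : Type*} {f₁ f₂ : ℕ → ℕ} {s : Finset ℕ} (γ : ℕ → Ty 𝔸)
    (h1 : ∀ a ∈ s, ∀ b ∈ s, f₁ a = f₁ b → a = b) (h2 : ∀ a ∈ s, ∀ b ∈ s, f₂ a = f₂ b → a = b)
    (h3 : ∀ a ∈ s, ∀ b ∈ s, f₁ a ≠ f₂ b) :
    ∃ γ' : ℕ → Ty 𝔸, (∀ a ∈ s, γ' (f₁ a) = γ a) ∧ (∀ a ∈ s, γ' (f₂ a) = γ a) ∧
      ∀ z, (∀ a ∈ s, z ≠ f₁ a ∧ z ≠ f₂ a) → γ' z = γ z := by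
  have h : ∀ z, ∃ A, (∀ a ∈ s, z = f₁ a ∨ z = f₂ a → A = γ a) ∧
      ((∀ a ∈ s, z ≠ f₁ a ∧ z ≠ f₂ a) → A = γ z) := by
    intro z
    by_cases hz : ∃ a ∈ s, z = f₁ a ∨ z = f₂ a
    · obtain ⟨a, ha, hz⟩ := hz
      refine ⟨γ a, fun b hb hb' => ?_, by grind⟩
      have : a = b := by grind
      rw [this]
    · exact ⟨γ z, by grind, fun _ => rfl⟩
  choose γ' hγ' using h
  exact ⟨γ', fun a ha => (hγ' _).1 a ha (.inl rfl), fun a ha => (hγ' _).1 a ha (.inr rfl),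
    fun z => (hγ' z).2⟩

/-- `dupBoth` refines `T₀` if its body has the free names of `T₀`, with those of `s` and `t` split,
and inherits the types of `T₀`. -/
theorem Refines.dupBoth {𝔸 : Type*} {T₀ T : Term} {s : Finset InName} {t : Finset OutName}
    {f₁ f₂ : InName → InName} {g₁ g₂ : OutName → OutName}
    (hf₁ : ∀ a ∈ s, ∀ b ∈ s, f₁ a = f₁ b → a = b) (hf₂ : ∀ a ∈ s, ∀ b ∈ s, f₂ a = f₂ b → a = b)
    (hf : ∀ a ∈ s, ∀ b ∈ s, f₁ a ≠ f₂ b) (hfs : ∀ a ∈ s, f₁ a ∉ T₀.I ∧ f₂ a ∉ T₀.I)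
    (hg₁ : ∀ a ∈ t, ∀ b ∈ t, g₁ a = g₁ b → a = b) (hg₂ : ∀ a ∈ t, ∀ b ∈ t, g₂ a = g₂ b → a = b)
    (hg : ∀ a ∈ t, ∀ b ∈ t, g₁ a ≠ g₂ b) (hgs : ∀ a ∈ t, g₁ a ∉ T₀.O ∧ g₂ a ∉ T₀.O)
    (hs : s ⊆ T₀.I) (ht : t ⊆ T₀.O) (hT : T.Linear)
    (hI : ∀ z, z ∈ T.I ↔ z ∈ T₀.I ∧ z ∉ s ∨ z ∈ s.image f₁ ∨ z ∈ s.image f₂)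
    (hO : ∀ z, z ∈ T.O ↔ z ∈ T₀.O ∧ z ∉ t ∨ z ∈ t.image g₁ ∨ z ∈ t.image g₂)
    (hW : ∀ (γ γ' : InName → Ty 𝔸) (δ δ' : OutName → Ty 𝔸), WellTyped γ δ T₀ →
      (∀ z ∈ T₀.I, γ' z = γ z) → (∀ z ∈ T₀.O, δ' z = δ z) →
      (∀ z ∈ s, γ' (f₁ z) = γ z ∧ γ' (f₂ z) = γ z) →
      (∀ z ∈ t, δ' (g₁ z) = δ z ∧ δ' (g₂ z) = δ z) → WellTyped γ' δ' T) :
    Refines 𝔸 T₀ (dupBoth s f₁ f₂ t g₁ g₂ T) := by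
  simp only [Finset.mem_image] at hI hO
  obtain ⟨k1, k2, k3, k4⟩ := foldl_dupR 𝔸 (L := t.sort (· ≤ ·)) (g₁ := g₁) (g₂ := g₂) hT
    ⟨t.sort_nodup _, by simp only [Finset.mem_sort]; grind, by simp only [Finset.mem_sort]; grind,
      by simpa, by simpa, by simpa⟩
  obtain ⟨l1, l2, l3, l4⟩ := foldr_dupL 𝔸 (L := s.sort (· ≤ ·)) (f₁ := f₁) (f₂ := f₂) k1
    ⟨s.sort_nodup _, by simp only [Finset.mem_sort]; grind, by simp only [Finset.mem_sort]; grind,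
      by simpa, by simpa, by simpa⟩
  simp only [Finset.mem_sort] at k3 l3
  refine ⟨l1, ?_, ?_, fun γ δ h => ?_⟩
  · ext z
    rw [StarX.dupBoth, l3, k2]
    grind
  · ext z
    rw [StarX.dupBoth, l2, k3]
    grind
  -- These assignments type both copies like the original. They agree with `γ`, `δ` on the free
  -- names of `T₀`, as the indexed names are new for it.
  · obtain ⟨γ', h1, h2, h3⟩ := exists_splits γ hf₁ hf₂ hf
    obtain ⟨δ', m1, m2, m3⟩ := exists_splits δ hg₁ hg₂ hg
    refine l4 γ γ' δ ⟨by simpa, by simpa, ?_⟩ (k4 γ' δ δ' ⟨by simpa, by simpa, ?_⟩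
      (hW γ γ' δ δ' h ?_ ?_ ?_ ?_))
    · intro z _ hz; simp only [Finset.mem_sort] at hz; exact h3 z hz
    · intro z _ hz; simp only [Finset.mem_sort] at hz; exact m3 z hz
    · intro z hz; exact h3 z (by grind)
    · intro z hz; exact m3 z (by grind)
    · exact fun z hz => ⟨h1 z hz, h2 z hz⟩
    · exact fun z hz => ⟨m1 z hz, m2 z hz⟩

theorem Refines.of_wellTyped {𝔸 : Type*} {T T' : Term} (h : T'.Linear ∧
    (∀ x, x ∈ T'.I ↔ x ∈ T.I) ∧ ∀ α, α ∈ T'.O ↔ α ∈ T.O)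
    (h' : ∀ (γ : InName → Ty 𝔸) (δ : OutName → Ty 𝔸), WellTyped γ δ T → WellTyped γ δ T') :
    Refines 𝔸 T T' :=
  ⟨h.1, Finset.ext h.2.1, Finset.ext h.2.2, h'⟩

/-! ### Indexed copies of a duplicated subterm -/

/-- Two linear terms whose free names are new for `T₀` and different from one another. -/
structure Fresh (T₀ Q₁ Q₂ : Term) : Prop where
  linear₁ : Q₁.Linear
  linear₂ : Q₂.Linear
  freshI₁ : ∀ z ∈ Q₁.I, z ∉ T₀.I ∧ z ∉ T₀.bndI
  freshI₂ : ∀ z ∈ Q₂.I, z ∉ T₀.I ∧ z ∉ T₀.bndI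
  freshO₁ : ∀ z ∈ Q₁.O, z ∉ T₀.O ∧ z ∉ T₀.bndO
  freshO₂ : ∀ z ∈ Q₂.O, z ∉ T₀.O ∧ z ∉ T₀.bndO
  apartI : ∀ z ∈ Q₁.I, z ∉ Q₂.I
  apartO : ∀ z ∈ Q₁.O, z ∉ Q₂.O

/-- The names bound in `Q` are also bound in `T₀`; hence indexed names, being new for `T₀`, cannot
be captured in `Q`. -/
theorem Indexing.rename_spec (𝔸 : Type*) {T₀ Q : Term} {f₁ f₂ : InName → InName}
    {g₁ g₂ : OutName → OutName} (h : Indexing T₀ Q f₁ f₂ g₁ g₂) (hQ : Q.Linear)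
    (hI : ∀ z ∈ Q.bndI, z ∈ T₀.bndI) (hO : ∀ z ∈ Q.bndO, z ∈ T₀.bndO) :
    Fresh T₀ (Q.rename f₁ g₁) (Q.rename f₂ g₂) ∧
    (Q.rename f₁ g₁).I = Q.I.image f₁ ∧ (Q.rename f₂ g₂).I = Q.I.image f₂ ∧
    (Q.rename f₁ g₁).O = Q.O.image g₁ ∧ (Q.rename f₂ g₂).O = Q.O.image g₂ ∧
    ∀ (γ : InName → Ty 𝔸) (δ : OutName → Ty 𝔸),
      (WellTyped γ δ (Q.rename f₁ g₁) ↔ WellTyped (γ ∘ f₁) (δ ∘ g₁) Q) ∧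
      (WellTyped γ δ (Q.rename f₂ g₂) ↔ WellTyped (γ ∘ f₂) (δ ∘ g₂) Q) := by
  obtain ⟨a1, a2, a3, a4⟩ := Term.rename_spec (𝔸 := 𝔸) (P := Q) (f := f₁) (g := g₁)
    (fun z hz => .inr fun k => (h.freshI₁ z hz).2 (hI _ k))
    (fun z hz => .inr fun k => (h.freshO₁ z hz).2 (hO _ k))
    (fun z hz z' hz' => h.injI₁ hz hz') (fun z hz z' hz' => h.injO₁ hz hz')
  obtain ⟨b1, b2, b3, b4⟩ := Term.rename_spec (𝔸 := 𝔸) (P := Q) (f := f₂) (g := g₂)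
    (fun z hz => .inr fun k => (h.freshI₂ z hz).2 (hI _ k))
    (fun z hz => .inr fun k => (h.freshO₂ z hz).2 (hO _ k))
    (fun z hz z' hz' => h.injI₂ hz hz') (fun z hz z' hz' => h.injO₂ hz hz')
  refine ⟨⟨a3.2 hQ, b3.2 hQ, ?_, ?_, ?_, ?_, ?_, ?_⟩, a1, b1, a2, b2,
    fun γ δ => ⟨a4 γ δ, b4 γ δ⟩⟩
  · simpa [a1, Term.FreshI, Term.FreshO] using fun z hz => h.freshI₁ z hz
  · simpa [b1, Term.FreshI, Term.FreshO] using fun z hz => h.freshI₂ z hz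
  · simpa [a2, Term.FreshI, Term.FreshO] using fun z hz => h.freshO₁ z hz
  · simpa [b2, Term.FreshI, Term.FreshO] using fun z hz => h.freshO₂ z hz
  · simp only [a1, b1, Finset.mem_image, not_exists, not_and]
    rintro _ ⟨z, hz, rfl⟩ z' hz' e
    exact h.apartI z hz z' hz' e.symm
  · simp only [a2, b2, Finset.mem_image, not_exists, not_and]
    rintro _ ⟨z, hz, rfl⟩ z' hz' e
    exact h.apartO z hz z' hz' e.symm

/-- `T` contains `Q₁`, `Q₂` in place of the subterm `Q` of `T₀` in which `x` is bound. -/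
structure CopiesL (𝔸 : Type*) (T₀ : Term) (x : InName) (Q : Term) (x₁ : InName) (Q₁ : Term)
    (x₂ : InName) (Q₂ : Term) (T : Term) : Prop where
  linear : T.Linear
  I_iff : ∀ z, z ∈ T.I ↔ z ∈ T₀.I ∧ ¬ (z ≠ x ∧ z ∈ Q.I) ∨ (z ≠ x₁ ∧ z ∈ Q₁.I) ∨
    (z ≠ x₂ ∧ z ∈ Q₂.I)
  O_iff : ∀ z, z ∈ T.O ↔ z ∈ T₀.O ∧ z ∉ Q.O ∨ z ∈ Q₁.O ∨ z ∈ Q₂.O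
  wellTyped : ∀ (γ γ' : InName → Ty 𝔸) (δ δ' : OutName → Ty 𝔸), WellTyped γ δ T₀ →
    (∀ z ∈ T₀.I, γ' z = γ z) → (∀ z ∈ T₀.O, δ' z = δ z) →
    (∀ A, WellTyped (Function.update γ x A) δ Q →
      WellTyped (Function.update γ' x₁ A) δ' Q₁ ∧ WellTyped (Function.update γ' x₂ A) δ' Q₂) →
    WellTyped γ' δ' T

/-- `T` contains `P₁`, `P₂` in place of the subterm `P` of `T₀` in which `α` is bound. -/
structure CopiesR (𝔸 : Type*) (T₀ : Term) (α : OutName) (P : Term) (α₁ : OutName) (P₁ : Term)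
    (α₂ : OutName) (P₂ : Term) (T : Term) : Prop where
  linear : T.Linear
  I_iff : ∀ z, z ∈ T.I ↔ z ∈ T₀.I ∧ z ∉ P.I ∨ z ∈ P₁.I ∨ z ∈ P₂.I
  O_iff : ∀ z, z ∈ T.O ↔ z ∈ T₀.O ∧ ¬ (z ≠ α ∧ z ∈ P.O) ∨ (z ≠ α₁ ∧ z ∈ P₁.O) ∨
    (z ≠ α₂ ∧ z ∈ P₂.O)
  wellTyped : ∀ (γ γ' : InName → Ty 𝔸) (δ δ' : OutName → Ty 𝔸), WellTyped γ δ T₀ →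
    (∀ z ∈ T₀.I, γ' z = γ z) → (∀ z ∈ T₀.O, δ' z = δ z) →
    (∀ A, WellTyped γ (Function.update δ α A) P →
      WellTyped γ' (Function.update δ' α₁ A) P₁ ∧ WellTyped γ' (Function.update δ' α₂ A) P₂) →
    WellTyped γ' δ' T

theorem mem_image_erase {f : ℕ → ℕ} {s : Finset ℕ} {x : ℕ} (hf : Set.InjOn f s) (hx : x ∈ s)
    (z : ℕ) : z ∈ (s.erase x).image f ↔ z ≠ f x ∧ z ∈ s.image f := by
  simp only [Finset.mem_image, Finset.mem_erase]
  constructor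
  · rintro ⟨a, ⟨h, ha⟩, rfl⟩
    exact ⟨fun e => h (hf ha hx e), a, ha, rfl⟩
  · rintro ⟨h, a, ha, rfl⟩
    exact ⟨a, ⟨fun e => h (e ▸ rfl), ha⟩, rfl⟩

/-- The body under the duplicators is abstracted to a function `F` of the two copies and their bound
names. What remains to prove about `F` (`CopiesL`) concerns arbitrary fresh terms that are typed
whenever `Q` is; renamings no longer appear in it. -/
theorem Indexing.refines_dupBoth_left {𝔸 : Type*} {T₀ Q : Term} {x : InName}
    {f₁ f₂ : InName → InName} {g₁ g₂ : OutName → OutName} (h : Indexing T₀ Q f₁ f₂ g₁ g₂)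
    (F : InName → Term → InName → Term → Term)
    (hQ : Q.Linear) (hx : x ∈ Q.I)
    (hbI : ∀ z ∈ Q.bndI, z ∈ T₀.bndI) (hbO : ∀ z ∈ Q.bndO, z ∈ T₀.bndO)
    (hI : Q.I.erase x ⊆ T₀.I) (hO : Q.O ⊆ T₀.O)
    (hF : ∀ x₁ Q₁ x₂ Q₂, Fresh T₀ Q₁ Q₂ → x₁ ∈ Q₁.I → x₂ ∈ Q₂.I →
      CopiesL 𝔸 T₀ x Q x₁ Q₁ x₂ Q₂ (F x₁ Q₁ x₂ Q₂)) :
    Refines 𝔸 T₀ (StarX.dupBoth (Q.I.erase x) f₁ f₂ Q.O g₁ g₂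
      (F (f₁ x) (Q.rename f₁ g₁) (f₂ x) (Q.rename f₂ g₂))) := by
  obtain ⟨k, i1, i2, o1, o2, w⟩ := h.rename_spec 𝔸 hQ hbI hbO
  obtain ⟨c1, c2, c3, c4⟩ := hF (f₁ x) _ (f₂ x) _ k (i1 ▸ Finset.mem_image_of_mem _ hx)
    (i2 ▸ Finset.mem_image_of_mem _ hx)
  have m : ∀ {z}, z ∈ Q.I.erase x → z ∈ Q.I := fun hz => (Finset.mem_erase.1 hz).2
  refine .dupBoth (fun a ha b hb => h.injI₁ (m ha) (m hb))
    (fun a ha b hb => h.injI₂ (m ha) (m hb)) (fun a ha b hb => h.apartI a (m ha) b (m hb))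
    (fun a ha => ⟨(h.freshI₁ a (m ha)).1, (h.freshI₂ a (m ha)).1⟩)
    (fun a ha b hb => h.injO₁ ha hb) (fun a ha b hb => h.injO₂ ha hb) h.apartO
    (fun a ha => ⟨(h.freshO₁ a ha).1, (h.freshO₂ a ha).1⟩) hI hO c1 ?_ ?_ ?_
  · simpa only [mem_image_erase h.injI₁ hx, mem_image_erase h.injI₂ hx, ← i1, ← i2,
      Finset.mem_erase] using c2
  · simpa only [← o1, ← o2] using c3
  · refine fun γ γ' δ δ' t hγ hδ hs ht => c4 γ γ' δ δ' t hγ hδ fun A hA =>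
      ⟨(w _ _).1.2 (hA.congr (fun z hz => ?_) fun z hz => (ht z hz).1),
        (w _ _).2.2 (hA.congr (fun z hz => ?_) fun z hz => (ht z hz).2)⟩
    -- The indexed bound name receives the type of the cut. By injectivity the other indexed names
    -- differ from it, so their types survive the update.
    · by_cases e : z = x
      · simp [e]
      · have : f₁ z ≠ f₁ x := fun k => e (h.injI₁ hz hx k)
        simp [e, this, (hs z (Finset.mem_erase.2 ⟨e, hz⟩)).1]
    · by_cases e : z = x
      · simp [e]
      · have : f₂ z ≠ f₂ x := fun k => e (h.injI₂ hz hx k)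
        simp [e, this, (hs z (Finset.mem_erase.2 ⟨e, hz⟩)).2]

theorem Indexing.refines_dupBoth_right {𝔸 : Type*} {T₀ P : Term} {α : OutName}
    {f₁ f₂ : InName → InName} {g₁ g₂ : OutName → OutName} (h : Indexing T₀ P f₁ f₂ g₁ g₂)
    (F : OutName → Term → OutName → Term → Term)
    (hP : P.Linear) (hα : α ∈ P.O)
    (hbI : ∀ z ∈ P.bndI, z ∈ T₀.bndI) (hbO : ∀ z ∈ P.bndO, z ∈ T₀.bndO)
    (hI : P.I ⊆ T₀.I) (hO : P.O.erase α ⊆ T₀.O)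
    (hF : ∀ α₁ P₁ α₂ P₂, Fresh T₀ P₁ P₂ → α₁ ∈ P₁.O → α₂ ∈ P₂.O →
      CopiesR 𝔸 T₀ α P α₁ P₁ α₂ P₂ (F α₁ P₁ α₂ P₂)) :
    Refines 𝔸 T₀ (StarX.dupBoth P.I f₁ f₂ (P.O.erase α) g₁ g₂
      (F (g₁ α) (P.rename f₁ g₁) (g₂ α) (P.rename f₂ g₂))) := by
  obtain ⟨k, i1, i2, o1, o2, w⟩ := h.rename_spec 𝔸 hP hbI hbO
  obtain ⟨c1, c2, c3, c4⟩ := hF (g₁ α) _ (g₂ α) _ k (o1 ▸ Finset.mem_image_of_mem _ hα)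
    (o2 ▸ Finset.mem_image_of_mem _ hα)
  have m : ∀ {z}, z ∈ P.O.erase α → z ∈ P.O := fun hz => (Finset.mem_erase.1 hz).2
  refine .dupBoth (fun a ha b hb => h.injI₁ ha hb) (fun a ha b hb => h.injI₂ ha hb) h.apartI
    (fun a ha => ⟨(h.freshI₁ a ha).1, (h.freshI₂ a ha).1⟩)
    (fun a ha b hb => h.injO₁ (m ha) (m hb))
    (fun a ha b hb => h.injO₂ (m ha) (m hb)) (fun a ha b hb => h.apartO a (m ha) b (m hb))
    (fun a ha => ⟨(h.freshO₁ a (m ha)).1, (h.freshO₂ a (m ha)).1⟩) hI hO c1 ?_ ?_ ?_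
  · simpa only [← i1, ← i2] using c2
  · simpa only [mem_image_erase h.injO₁ hα, mem_image_erase h.injO₂ hα, ← o1, ← o2,
      Finset.mem_erase] using c3
  · refine fun γ γ' δ δ' t hγ hδ hs ht => c4 γ γ' δ δ' t hγ hδ fun A hA =>
      ⟨(w _ _).1.2 (hA.congr (fun z hz => (hs z hz).1) fun z hz => ?_),
        (w _ _).2.2 (hA.congr (fun z hz => (hs z hz).2) fun z hz => ?_)⟩
    · by_cases e : z = α
      · simp [e]
      · have : g₁ z ≠ g₁ α := fun k => e (h.injO₁ hz hα k)
        simp [e, this, (ht z (Finset.mem_erase.2 ⟨e, hz⟩)).1]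
    · by_cases e : z = α
      · simp [e]
      · have : g₂ z ≠ g₂ α := fun k => e (h.injO₂ hz hα k)
        simp [e, this, (ht z (Finset.mem_erase.2 ⟨e, hz⟩)).2]

/-! ### Left simultaneous substitution -/

set_option maxHeartbeats 1000000 in
-- The duplicator gives `α₁` and `α₂` the type `A` of the cut on `α`, so each copy of `Q` can be cut
-- at `A`. The principal `α₁` is consumed by the outer cut, while `α₂`, distinct from it, is free in
-- `R` and is consumed inside.
theorem CopiesL.prin {𝔸 : Type*} {C : Ctx1} {R Q Q₁ Q₂ : Term} {α₁ α₂ α : OutName}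
    {x x₁ x₂ : InName} (h₁ : C.prinO = some α₁)
    (hc : (Term.cut .left (.dupR (C.fill R) α₁ α₂ α) α x Q).Conv)
    (hl : (Term.cut .left (.dupR (C.fill R) α₁ α₂ α) α x Q).Linear)
    (hf : Fresh (.cut .left (.dupR (C.fill R) α₁ α₂ α) α x Q) Q₁ Q₂) (h1 : x₁ ∈ Q₁.I)
    (h2 : x₂ ∈ Q₂.I) :
    CopiesL 𝔸 (.cut .left (.dupR (C.fill R) α₁ α₂ α) α x Q) x Q x₁ Q₁ x₂ Q₂
      (.cut .inactive (C.fill (.cut .left R α₂ x₂ Q₂)) α₁ x₁ Q₁) := by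
  obtain ⟨f1, f2, f3, f4, f5, f6, f7, f8⟩ := hf
  cases C <;> simp only [Ctx1.prinO, Option.some.injEq, reduceCtorEq] at h₁ <;> subst h₁ <;>
    simp only [Ctx1.fill] at hc hl f3 f4 f5 f6 ⊢
  all_goals simp only [Term.Conv, Term.bndI, Term.bndO, Term.Linear, Term.I, Term.O, nameSimps] at hc hl f3 f4 f5 f6
  all_goals simp only [not_or] at hc
  all_goals obtain ⟨⟨c1, c2, -, -⟩, ⟨d1, d2, -, -⟩, c3, d3⟩ := hc
  all_goals refine ⟨?_, ?_, ?_, fun γ γ' δ δ' ⟨A, h, hD⟩ hγ hδ hA => ?_⟩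
  case exp.refine_4 =>
    obtain ⟨B, C, e, h⟩ := h
    obtain ⟨k1, k2⟩ := hA A hD
    simp only [Term.I, Term.O, nameSimps] at hγ hδ
    refine ⟨A, ⟨B, C, by grind only [= Function.update_apply], A, h.congr ?_ ?_, k2.congr ?_ ?_⟩,
      k1.congr ?_ ?_⟩ <;>
      grind only [= Function.update_apply]
  case erR.refine_4 =>
    simp only [WellTyped] at h
    obtain ⟨k1, k2⟩ := hA A hD
    simp only [Term.I, Term.O, nameSimps] at hγ hδ
    refine ⟨A, ⟨A, h.congr ?_ ?_, k2.congr ?_ ?_⟩, k1.congr ?_ ?_⟩ <;>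
      grind only [= Function.update_apply]
  case dupR.refine_4 =>
    simp only [WellTyped] at h
    obtain ⟨k1, k2⟩ := hA A hD
    simp only [Term.I, Term.O, nameSimps] at hγ hδ
    refine ⟨A, ⟨A, h.congr ?_ ?_, k2.congr ?_ ?_⟩, k1.congr ?_ ?_⟩ <;>
      grind only [= Function.update_apply]
  all_goals simp only [Term.Linear, Term.I, Term.O, nameSimps]
  all_goals grind only

set_option maxHeartbeats 1000000 in
-- Each subterm contains one of the two names and receives its own copy; both cuts have the type of
-- the original one. The copies have no free name in common, which keeps the result linear.
theorem CopiesL.split {𝔸 : Type*} {C : Ctx2} {R₁ R₂ Q Q₁ Q₂ : Term} {α₁ α₂ α : OutName}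
    {x x₁ x₂ : InName} (h₁ : α₁ ∈ R₁.O) (h₂ : α₂ ∈ R₂.O)
    (hc : (Term.cut .left (.dupR (C.fill R₁ R₂) α₁ α₂ α) α x Q).Conv)
    (hl : (Term.cut .left (.dupR (C.fill R₁ R₂) α₁ α₂ α) α x Q).Linear)
    (hf : Fresh (.cut .left (.dupR (C.fill R₁ R₂) α₁ α₂ α) α x Q) Q₁ Q₂) (h1 : x₁ ∈ Q₁.I)
    (h2 : x₂ ∈ Q₂.I) :
    CopiesL 𝔸 (.cut .left (.dupR (C.fill R₁ R₂) α₁ α₂ α) α x Q) x Q x₁ Q₁ x₂ Q₂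
      (C.fill (.cut .left R₁ α₁ x₁ Q₁) (.cut .left R₂ α₂ x₂ Q₂)) := by
  obtain ⟨f1, f2, f3, f4, f5, f6, f7, f8⟩ := hf
  cases C <;> simp only [Ctx2.fill] at hc hl f3 f4 f5 f6 ⊢
  all_goals simp only [Term.Conv, Term.bndI, Term.bndO, Term.Linear, Term.I, Term.O, nameSimps] at hc hl f3 f4 f5 f6
  all_goals simp only [not_or] at hc
  all_goals obtain ⟨⟨c1, c2, -, -⟩, ⟨d1, d2, -, -⟩, c3, d3⟩ := hc
  all_goals refine ⟨?_, ?_, ?_, fun γ γ' δ δ' ⟨A, h, hD⟩ hγ hδ hA => ?_⟩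
  case imp.refine_4 =>
    obtain ⟨B, C, e, h, h'⟩ := h
    obtain ⟨k1, k2⟩ := hA A hD
    simp only [Term.I, Term.O, nameSimps] at hγ hδ
    refine ⟨B, C, by grind, ⟨A, h.congr ?_ ?_, k1.congr ?_ ?_⟩, A, h'.congr ?_ ?_,
      k2.congr ?_ ?_⟩ <;>
      grind only [= Function.update_apply]
  case cut.refine_4 =>
    obtain ⟨B, h, h'⟩ := h
    obtain ⟨k1, k2⟩ := hA A hD
    simp only [Term.I, Term.O, nameSimps] at hγ hδ
    refine ⟨B, ⟨A, h.congr ?_ ?_, k1.congr ?_ ?_⟩, A, h'.congr ?_ ?_, k2.congr ?_ ?_⟩ <;>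
      grind only [= Function.update_apply]
  all_goals simp only [Term.Linear, Term.I, Term.O, nameSimps]
  all_goals grind only

theorem Fresh.symm {T₀ Q₁ Q₂ : Term} (h : Fresh T₀ Q₁ Q₂) : Fresh T₀ Q₂ Q₁ :=
  ⟨h.2, h.1, h.4, h.3, h.6, h.5, fun z hz hz' => h.7 z hz' hz, fun z hz hz' => h.8 z hz' hz⟩

theorem Term.conv_dupR_comm {P Q : Term} {α₁ α₂ α : OutName} {x : InName}
    (h : (Term.cut .left (.dupR P α₁ α₂ α) α x Q).Conv) :
    (Term.cut .left (.dupR P α₂ α₁ α) α x Q).Conv := by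
  simp only [Term.Conv, Term.bndI, Term.bndO, Term.Linear, Term.I, Term.O, nameSimps] at h ⊢
  grind

theorem Term.linear_dupR_comm {P Q : Term} {α₁ α₂ α : OutName} {x : InName}
    (h : (Term.cut .left (.dupR P α₁ α₂ α) α x Q).Linear) :
    (Term.cut .left (.dupR P α₂ α₁ α) α x Q).Linear := by
  simp only [Term.Linear, Term.I, Term.O, nameSimps] at h ⊢
  grind

theorem Fresh.dupR_comm {P Q Q₁ Q₂ : Term} {α₁ α₂ α : OutName} {x : InName}
    (h : Fresh (Term.cut .left (.dupR P α₁ α₂ α) α x Q) Q₁ Q₂) :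
    Fresh (Term.cut .left (.dupR P α₂ α₁ α) α x Q) Q₂ Q₁ := by
  obtain ⟨h1, h2, h3, h4, h5, h6, h7, h8⟩ := h.symm
  refine ⟨h1, h2, h3, h4, fun z hz => ?_, fun z hz => ?_, h7, h8⟩
  · have := h5 z hz
    simp only [Term.O, Term.bndO, nameSimps] at this ⊢
    grind
  · have := h6 z hz
    simp only [Term.O, Term.bndO, nameSimps] at this ⊢
    grind

/-- The order of the two names in the duplicator affects neither free names nor, these names being
distinct, types. The cases with the indices exchanged thus reduce to those above. -/
theorem CopiesL.dupR_comm {𝔸 : Type*} {P Q Q₁ Q₂ T : Term} {α₁ α₂ α : OutName}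
    {x x₁ x₂ : InName} (hne : α₁ ≠ α₂)
    (h : CopiesL 𝔸 (.cut .left (.dupR P α₂ α₁ α) α x Q) x Q x₂ Q₂ x₁ Q₁ T) :
    CopiesL 𝔸 (.cut .left (.dupR P α₁ α₂ α) α x Q) x Q x₁ Q₁ x₂ Q₂ T := by
  obtain ⟨h1, h2, h3, h4⟩ := h
  refine ⟨h1, fun z => ?_, fun z => ?_, fun γ γ' δ δ' t hγ hδ hA =>
    h4 γ γ' δ δ' ?_ hγ ?_ fun A hA' => (hA A hA').symm⟩
  · rw [h2]; simp only [Term.I]; tauto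
  · rw [h3]; simp only [Term.O, Finset.erase_right_comm (a := α₁)]; tauto
  · simpa only [WellTyped, Function.update_comm hne] using t
  · simpa only [Term.O, Finset.erase_right_comm (a := α₁)] using hδ

set_option maxHeartbeats 1000000 in
-- Nothing is copied here. As neither `α₁` nor `α₂` is principal, linearity places both in `R`, and
-- the duplicator moves inward together with its cut.
theorem Refines.dupR_ctx1 {𝔸 : Type*} {C : Ctx1} {R Q : Term} {α₁ α₂ α : OutName} {x : InName}
    (h₁ : C.prinO ≠ some α₁) (h₂ : C.prinO ≠ some α₂)
    (hc : (Term.cut .left (.dupR (C.fill R) α₁ α₂ α) α x Q).Conv)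
    (hl : (Term.cut .left (.dupR (C.fill R) α₁ α₂ α) α x Q).Linear) :
    Refines 𝔸 (.cut .left (.dupR (C.fill R) α₁ α₂ α) α x Q)
      (C.fill (.cut .left (.dupR R α₁ α₂ α) α x Q)) := by
  cases C <;> simp only [Ctx1.fill] at hc hl ⊢ <;>
    simp only [Ctx1.prinO, ne_eq, Option.some.injEq, reduceCtorEq, not_false_iff] at h₁ h₂
  all_goals simp only [Term.Conv, Term.bndI, Term.bndO, Term.Linear, Term.I, Term.O, nameSimps] at hc hl
  all_goals simp only [not_or] at hc
  all_goals obtain ⟨⟨c1, c2, -, -⟩, ⟨d1, d2, -, -⟩, c3, d3⟩ := hc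
  all_goals refine .of_wellTyped ⟨?_, ?_, ?_⟩ fun γ δ ⟨A, h, hD⟩ => ?_
  case exp.refine_4 =>
    obtain ⟨B, C, e, h⟩ := h
    refine ⟨B, C, by grind only [= Function.update_apply], A, h.congr ?_ ?_, hD.congr ?_ ?_⟩ <;>
      grind only [= Function.update_apply]
  case erL.refine_4 =>
    simp only [WellTyped] at h
    refine ⟨A, h.congr ?_ ?_, hD.congr ?_ ?_⟩ <;>
      grind only [= Function.update_apply]
  case erR.refine_4 =>
    simp only [WellTyped] at h
    refine ⟨A, h.congr ?_ ?_, hD.congr ?_ ?_⟩ <;>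
      grind only [= Function.update_apply]
  case dupL.refine_4 =>
    simp only [WellTyped] at h
    refine ⟨A, WellTyped.congr (P := R) h ?_ ?_, hD.congr ?_ ?_⟩ <;>
      grind only [= Function.update_apply]
  case dupR.refine_4 =>
    simp only [WellTyped] at h
    refine ⟨A, WellTyped.congr (P := R) h ?_ ?_, hD.congr ?_ ?_⟩ <;>
      grind only [= Function.update_apply]
  all_goals simp only [Term.Linear, Term.I, Term.O, nameSimps]
  all_goals grind only

set_option maxHeartbeats 1000000 in
theorem Refines.dupR_ctx2_left {𝔸 : Type*} {C : Ctx2} {R₁ R₂ Q : Term} {α₁ α₂ α : OutName}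
    {x : InName} (h₁ : α₁ ∈ R₁.O) (h₂ : α₂ ∈ R₁.O)
    (hc : (Term.cut .left (.dupR (C.fill R₁ R₂) α₁ α₂ α) α x Q).Conv)
    (hl : (Term.cut .left (.dupR (C.fill R₁ R₂) α₁ α₂ α) α x Q).Linear) :
    Refines 𝔸 (.cut .left (.dupR (C.fill R₁ R₂) α₁ α₂ α) α x Q)
      (C.fill (.cut .left (.dupR R₁ α₁ α₂ α) α x Q) R₂) := by
  cases C <;> simp only [Ctx2.fill] at hc hl ⊢
  all_goals simp only [Term.Conv, Term.bndI, Term.bndO, Term.Linear, Term.I, Term.O, nameSimps] at hc hl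
  all_goals simp only [not_or] at hc
  all_goals obtain ⟨⟨c1, c2, -, -⟩, ⟨d1, d2, -, -⟩, c3, d3⟩ := hc
  all_goals refine .of_wellTyped ⟨?_, ?_, ?_⟩ fun γ δ ⟨A, h, hD⟩ => ?_
  case imp.refine_4 =>
    obtain ⟨B, C, e, h, h'⟩ := h
    refine ⟨B, C, e, ⟨A, WellTyped.congr (P := R₁) h ?_ ?_, hD.congr ?_ ?_⟩, h'.congr ?_ ?_⟩ <;>
      grind only [= Function.update_apply]
  case cut.refine_4 =>
    obtain ⟨B, h, h'⟩ := h
    refine ⟨B, ⟨A, WellTyped.congr (P := R₁) h ?_ ?_, hD.congr ?_ ?_⟩, h'.congr ?_ ?_⟩ <;>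
      grind only [= Function.update_apply]
  all_goals simp only [Term.Linear, Term.I, Term.O, nameSimps]
  all_goals grind only

set_option maxHeartbeats 1000000 in
theorem Refines.dupR_ctx2_right {𝔸 : Type*} {C : Ctx2} {R₁ R₂ Q : Term} {α₁ α₂ α : OutName}
    {x : InName} (h₁ : α₁ ∈ R₂.O) (h₂ : α₂ ∈ R₂.O)
    (hc : (Term.cut .left (.dupR (C.fill R₁ R₂) α₁ α₂ α) α x Q).Conv)
    (hl : (Term.cut .left (.dupR (C.fill R₁ R₂) α₁ α₂ α) α x Q).Linear) :
    Refines 𝔸 (.cut .left (.dupR (C.fill R₁ R₂) α₁ α₂ α) α x Q)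
      (C.fill R₁ (.cut .left (.dupR R₂ α₁ α₂ α) α x Q)) := by
  cases C <;> simp only [Ctx2.fill] at hc hl ⊢
  all_goals simp only [Term.Conv, Term.bndI, Term.bndO, Term.Linear, Term.I, Term.O, nameSimps] at hc hl
  all_goals simp only [not_or] at hc
  all_goals obtain ⟨⟨c1, c2, -, -⟩, ⟨d1, d2, -, -⟩, c3, d3⟩ := hc
  all_goals refine .of_wellTyped ⟨?_, ?_, ?_⟩ fun γ δ ⟨A, h, hD⟩ => ?_
  case imp.refine_4 =>
    obtain ⟨B, C, e, h, h'⟩ := h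
    refine ⟨B, C, e, h.congr ?_ ?_, A, WellTyped.congr (P := R₂) h' ?_ ?_, hD.congr ?_ ?_⟩ <;>
      grind only [= Function.update_apply]
  case cut.refine_4 =>
    obtain ⟨B, h, h'⟩ := h
    refine ⟨B, h.congr ?_ ?_, A, WellTyped.congr (P := R₂) h' ?_ ?_, hD.congr ?_ ?_⟩ <;>
      grind only [= Function.update_apply]
  all_goals simp only [Term.Linear, Term.I, Term.O, nameSimps]
  all_goals grind only

/-- The copying cases pass through `Indexing.refines_dupBoth_left`, the function supplied being the
result with its two copies abstracted; in the remaining cases the duplicator only moves inward. -/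
theorem SimL.refines (𝔸 : Type*) {P Q S : Term} {α₁ α₂ α : OutName} {x : InName}
    (h : SimL P α₁ α₂ α x Q S) (hc : (Term.cut .left (.dupR P α₁ α₂ α) α x Q).Conv)
    (hl : (Term.cut .left (.dupR P α₁ α₂ α) α x Q).Linear) :
    Refines 𝔸 (.cut .left (.dupR P α₁ α₂ α) α x Q) S := by
  have hQ : Q.Linear := hl.2.1
  have hx : x ∈ Q.I := hl.2.2.2.1
  have hbI : ∀ z ∈ Q.bndI, z ∈ (Term.cut .left (.dupR P α₁ α₂ α) α x Q).bndI := by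
    simp +contextual [Term.bndI]
  have hbO : ∀ z ∈ Q.bndO, z ∈ (Term.cut .left (.dupR P α₁ α₂ α) α x Q).bndO := by
    simp +contextual [Term.bndO]
  have hI : Q.I.erase x ⊆ (Term.cut .left (.dupR P α₁ α₂ α) α x Q).I :=
    Finset.subset_union_right
  have hO : Q.O ⊆ (Term.cut .left (.dupR P α₁ α₂ α) α x Q).O := Finset.subset_union_right
  cases h with
  | prin₁ C R f₁ f₂ g₁ g₂ e h₁ hi =>
    subst e
    exact hi.refines_dupBoth_left
      (fun x₁ Q₁ x₂ Q₂ => .cut .inactive (C.fill (.cut .left R α₂ x₂ Q₂)) α₁ x₁ Q₁)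
      hQ hx hbI hbO hI hO fun x₁ Q₁ x₂ Q₂ hf h1 h2 => .prin h₁ hc hl hf h1 h2
  | prin₂ C R f₁ f₂ g₁ g₂ e h₁ hi =>
    subst e
    exact hi.refines_dupBoth_left
      (fun x₁ Q₁ x₂ Q₂ => .cut .inactive (C.fill (.cut .left R α₁ x₁ Q₁)) α₂ x₂ Q₂)
      hQ hx hbI hbO hI hO fun x₁ Q₁ x₂ Q₂ hf h1 h2 => .dupR_comm hl.1.2.1
        (.prin h₁ (Term.conv_dupR_comm hc) (Term.linear_dupR_comm hl) hf.dupR_comm h2 h1)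
  | other C R e h₁ h₂ => subst e; exact .dupR_ctx1 h₁ h₂ hc hl
  | split₁₂ C R₁ R₂ f₁ f₂ g₁ g₂ e _ h₁ h₂ hi =>
    subst e
    exact hi.refines_dupBoth_left
      (fun x₁ Q₁ x₂ Q₂ => C.fill (.cut .left R₁ α₁ x₁ Q₁) (.cut .left R₂ α₂ x₂ Q₂))
      hQ hx hbI hbO hI hO fun x₁ Q₁ x₂ Q₂ hf h1 h2 => .split h₁ h₂ hc hl hf h1 h2
  | split₂₁ C R₁ R₂ f₁ f₂ g₁ g₂ e _ h₁ h₂ hi =>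
    subst e
    exact hi.refines_dupBoth_left
      (fun x₁ Q₁ x₂ Q₂ => C.fill (.cut .left R₁ α₂ x₂ Q₂) (.cut .left R₂ α₁ x₁ Q₁))
      hQ hx hbI hbO hI hO fun x₁ Q₁ x₂ Q₂ hf h1 h2 => .dupR_comm hl.1.2.1
        (.split h₁ h₂ (Term.conv_dupR_comm hc) (Term.linear_dupR_comm hl) hf.dupR_comm h2 h1)
  | both₁ C R₁ R₂ e _ h₁ h₂ => subst e; exact .dupR_ctx2_left h₁ h₂ hc hl
  | both₂ C R₁ R₂ e _ h₁ h₂ => subst e; exact .dupR_ctx2_right h₁ h₂ hc hl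

/-! ### Right simultaneous substitution -/

set_option maxHeartbeats 1000000 in
-- Mirror image of `CopiesL.prin`. Among terms with one immediate subterm only left erasers and left
-- duplicators have a principal inname, so an exporter does not arise.
theorem CopiesR.prin {𝔸 : Type*} {C : Ctx1} {R P P₁ P₂ : Term} {α₁ α₂ α : OutName}
    {x x₁ x₂ : InName} (h₁ : C.prinI = some x₁)
    (hc : (Term.cut .right P α x (.dupL x x₁ x₂ (C.fill R))).Conv)
    (hl : (Term.cut .right P α x (.dupL x x₁ x₂ (C.fill R))).Linear)
    (hf : Fresh (.cut .right P α x (.dupL x x₁ x₂ (C.fill R))) P₁ P₂)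
    (h1 : α₁ ∈ P₁.O) (h2 : α₂ ∈ P₂.O) :
    CopiesR 𝔸 (.cut .right P α x (.dupL x x₁ x₂ (C.fill R))) α P α₁ P₁ α₂ P₂
      (.cut .inactive P₁ α₁ x₁ (C.fill (.cut .right P₂ α₂ x₂ R))) := by
  obtain ⟨f1, f2, f3, f4, f5, f6, f7, f8⟩ := hf
  cases C <;> simp only [Ctx1.prinI, Option.some.injEq, reduceCtorEq] at h₁ <;> subst h₁ <;>
    simp only [Ctx1.fill] at hc hl f3 f4 f5 f6 ⊢
  all_goals simp only [Term.Conv, Term.bndI, Term.bndO, Term.Linear, Term.I, Term.O, nameSimps] at hc hl f3 f4 f5 f6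
  all_goals simp only [not_or] at hc
  all_goals obtain ⟨⟨c1, -, c2, -⟩, ⟨d1, -, d2, -⟩, c3, d3⟩ := hc
  all_goals refine ⟨?_, ?_, ?_, fun γ γ' δ δ' ⟨A, hD, h⟩ hγ hδ hA => ?_⟩
  case erL.refine_4 =>
    simp only [WellTyped] at h
    obtain ⟨k1, k2⟩ := hA A hD
    simp only [Term.I, Term.O, nameSimps] at hγ hδ
    refine ⟨A, k1.congr ?_ ?_, A, k2.congr ?_ ?_, h.congr ?_ ?_⟩ <;>
      grind only [= Function.update_apply]
  case dupL.refine_4 =>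
    simp only [WellTyped] at h
    obtain ⟨k1, k2⟩ := hA A hD
    simp only [Term.I, Term.O, nameSimps] at hγ hδ
    refine ⟨A, k1.congr ?_ ?_, A, k2.congr ?_ ?_, h.congr ?_ ?_⟩ <;>
      grind only [= Function.update_apply]
  all_goals simp only [Term.Linear, Term.I, Term.O, nameSimps]
  all_goals grind only

set_option maxHeartbeats 1000000 in
-- This case has no counterpart on the left: an importer has a principal inname but two subterms, so
-- the second copy must follow `x₂` into the subterm that contains it. Cuts have no principal name
-- and drop out.
theorem CopiesR.prin_left {𝔸 : Type*} {C : Ctx2} {R₁ R₂ P P₁ P₂ : Term} {α₁ α₂ α : OutName}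
    {x x₁ x₂ : InName} (h₁ : C.prinI = some x₁) (h₂ : x₂ ∈ R₁.I)
    (hc : (Term.cut .right P α x (.dupL x x₁ x₂ (C.fill R₁ R₂))).Conv)
    (hl : (Term.cut .right P α x (.dupL x x₁ x₂ (C.fill R₁ R₂))).Linear)
    (hf : Fresh (.cut .right P α x (.dupL x x₁ x₂ (C.fill R₁ R₂))) P₁ P₂)
    (h1 : α₁ ∈ P₁.O) (h2 : α₂ ∈ P₂.O) :
    CopiesR 𝔸 (.cut .right P α x (.dupL x x₁ x₂ (C.fill R₁ R₂))) α P α₁ P₁ α₂ P₂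
      (.cut .inactive P₁ α₁ x₁ (C.fill (.cut .right P₂ α₂ x₂ R₁) R₂)) := by
  obtain ⟨f1, f2, f3, f4, f5, f6, f7, f8⟩ := hf
  cases C <;> simp only [Ctx2.prinI, Option.some.injEq, reduceCtorEq] at h₁ <;> subst h₁ <;>
    simp only [Ctx2.fill] at hc hl f3 f4 f5 f6 ⊢
  all_goals simp only [Term.Conv, Term.bndI, Term.bndO, Term.Linear, Term.I, Term.O, nameSimps] at hc hl f3 f4 f5 f6
  all_goals simp only [not_or] at hc
  all_goals obtain ⟨⟨c1, -, c2, -⟩, ⟨d1, -, d2, -⟩, c3, d3⟩ := hc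
  all_goals refine ⟨?_, ?_, ?_, fun γ γ' δ δ' ⟨A, hD, h⟩ hγ hδ hA => ?_⟩
  case imp.refine_4 =>
    obtain ⟨B, D, e, h, h'⟩ := h
    obtain ⟨k1, k2⟩ := hA A hD
    simp only [Term.I, Term.O, nameSimps] at hγ hδ
    refine ⟨A, k1.congr ?_ ?_, B, D, by grind only [= Function.update_apply], ⟨A, k2.congr ?_ ?_,
      h.congr ?_ ?_⟩, h'.congr ?_ ?_⟩ <;>
      grind only [= Function.update_apply]
  all_goals simp only [Term.Linear, Term.I, Term.O, nameSimps]
  all_goals grind only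

set_option maxHeartbeats 1000000 in
theorem CopiesR.prin_right {𝔸 : Type*} {C : Ctx2} {R₁ R₂ P P₁ P₂ : Term} {α₁ α₂ α : OutName}
    {x x₁ x₂ : InName} (h₁ : C.prinI = some x₁) (h₂ : x₂ ∈ R₂.I)
    (hc : (Term.cut .right P α x (.dupL x x₁ x₂ (C.fill R₁ R₂))).Conv)
    (hl : (Term.cut .right P α x (.dupL x x₁ x₂ (C.fill R₁ R₂))).Linear)
    (hf : Fresh (.cut .right P α x (.dupL x x₁ x₂ (C.fill R₁ R₂))) P₁ P₂)
    (h1 : α₁ ∈ P₁.O) (h2 : α₂ ∈ P₂.O) :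
    CopiesR 𝔸 (.cut .right P α x (.dupL x x₁ x₂ (C.fill R₁ R₂))) α P α₁ P₁ α₂ P₂
      (.cut .inactive P₁ α₁ x₁ (C.fill R₁ (.cut .right P₂ α₂ x₂ R₂))) := by
  obtain ⟨f1, f2, f3, f4, f5, f6, f7, f8⟩ := hf
  cases C <;> simp only [Ctx2.prinI, Option.some.injEq, reduceCtorEq] at h₁ <;> subst h₁ <;>
    simp only [Ctx2.fill] at hc hl f3 f4 f5 f6 ⊢
  all_goals simp only [Term.Conv, Term.bndI, Term.bndO, Term.Linear, Term.I, Term.O, nameSimps] at hc hl f3 f4 f5 f6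
  all_goals simp only [not_or] at hc
  all_goals obtain ⟨⟨c1, -, c2, -⟩, ⟨d1, -, d2, -⟩, c3, d3⟩ := hc
  all_goals refine ⟨?_, ?_, ?_, fun γ γ' δ δ' ⟨A, hD, h⟩ hγ hδ hA => ?_⟩
  case imp.refine_4 =>
    obtain ⟨B, D, e, h, h'⟩ := h
    obtain ⟨k1, k2⟩ := hA A hD
    simp only [Term.I, Term.O, nameSimps] at hγ hδ
    refine ⟨A, k1.congr ?_ ?_, B, D, by grind only [= Function.update_apply], h.congr ?_ ?_,
      A, k2.congr ?_ ?_, h'.congr ?_ ?_⟩ <;>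
      grind only [= Function.update_apply]
  all_goals simp only [Term.Linear, Term.I, Term.O, nameSimps]
  all_goals grind only

set_option maxHeartbeats 1000000 in
theorem CopiesR.split {𝔸 : Type*} {C : Ctx2} {R₁ R₂ P P₁ P₂ : Term} {α₁ α₂ α : OutName}
    {x x₁ x₂ : InName} (h₁ : x₁ ∈ R₁.I) (h₂ : x₂ ∈ R₂.I)
    (hc : (Term.cut .right P α x (.dupL x x₁ x₂ (C.fill R₁ R₂))).Conv)
    (hl : (Term.cut .right P α x (.dupL x x₁ x₂ (C.fill R₁ R₂))).Linear)
    (hf : Fresh (.cut .right P α x (.dupL x x₁ x₂ (C.fill R₁ R₂))) P₁ P₂)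
    (h1 : α₁ ∈ P₁.O) (h2 : α₂ ∈ P₂.O) :
    CopiesR 𝔸 (.cut .right P α x (.dupL x x₁ x₂ (C.fill R₁ R₂))) α P α₁ P₁ α₂ P₂
      (C.fill (.cut .right P₁ α₁ x₁ R₁) (.cut .right P₂ α₂ x₂ R₂)) := by
  obtain ⟨f1, f2, f3, f4, f5, f6, f7, f8⟩ := hf
  cases C <;> simp only [Ctx2.fill] at hc hl f3 f4 f5 f6 ⊢
  all_goals simp only [Term.Conv, Term.bndI, Term.bndO, Term.Linear, Term.I, Term.O, nameSimps] at hc hl f3 f4 f5 f6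
  all_goals simp only [not_or] at hc
  all_goals obtain ⟨⟨c1, -, c2, -⟩, ⟨d1, -, d2, -⟩, c3, d3⟩ := hc
  all_goals refine ⟨?_, ?_, ?_, fun γ γ' δ δ' ⟨A, hD, h⟩ hγ hδ hA => ?_⟩
  case imp.refine_4 =>
    obtain ⟨B, D, e, h, h'⟩ := h
    obtain ⟨k1, k2⟩ := hA A hD
    simp only [Term.I, Term.O, nameSimps] at hγ hδ
    refine ⟨B, D, by grind only [= Function.update_apply], ⟨A, k1.congr ?_ ?_, h.congr ?_ ?_⟩,
      A, k2.congr ?_ ?_, h'.congr ?_ ?_⟩ <;>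
      grind only [= Function.update_apply]
  case cut.refine_4 =>
    obtain ⟨B, h, h'⟩ := h
    obtain ⟨k1, k2⟩ := hA A hD
    simp only [Term.I, Term.O, nameSimps] at hγ hδ
    refine ⟨B, ⟨A, k1.congr ?_ ?_, h.congr ?_ ?_⟩, A, k2.congr ?_ ?_, h'.congr ?_ ?_⟩ <;>
      grind only [= Function.update_apply]
  all_goals simp only [Term.Linear, Term.I, Term.O, nameSimps]
  all_goals grind only

theorem Term.conv_dupL_comm {P Q : Term} {α : OutName} {x x₁ x₂ : InName}
    (h : (Term.cut .right P α x (.dupL x x₁ x₂ Q)).Conv) :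
    (Term.cut .right P α x (.dupL x x₂ x₁ Q)).Conv := by
  simp only [Term.Conv, Term.bndI, Term.bndO, Term.Linear, Term.I, Term.O, nameSimps] at h ⊢
  grind

theorem Term.linear_dupL_comm {P Q : Term} {α : OutName} {x x₁ x₂ : InName}
    (h : (Term.cut .right P α x (.dupL x x₁ x₂ Q)).Linear) :
    (Term.cut .right P α x (.dupL x x₂ x₁ Q)).Linear := by
  simp only [Term.Linear, Term.I, Term.O, nameSimps] at h ⊢
  grind

theorem Fresh.dupL_comm {P Q P₁ P₂ : Term} {α : OutName} {x x₁ x₂ : InName}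
    (h : Fresh (Term.cut .right P α x (.dupL x x₁ x₂ Q)) P₁ P₂) :
    Fresh (Term.cut .right P α x (.dupL x x₂ x₁ Q)) P₂ P₁ := by
  obtain ⟨h1, h2, h3, h4, h5, h6, h7, h8⟩ := h.symm
  refine ⟨h1, h2, fun z hz => ?_, fun z hz => ?_, h5, h6, h7, h8⟩
  · have := h3 z hz
    simp only [Term.I, Term.bndI, nameSimps] at this ⊢
    grind
  · have := h4 z hz
    simp only [Term.I, Term.bndI, nameSimps] at this ⊢
    grind

/-- As on the left, this reduces the cases with the indices exchanged to the others. -/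
theorem CopiesR.dupL_comm {𝔸 : Type*} {P Q P₁ P₂ T : Term} {α₁ α₂ α : OutName}
    {x x₁ x₂ : InName} (hne : x₁ ≠ x₂)
    (h : CopiesR 𝔸 (.cut .right P α x (.dupL x x₂ x₁ Q)) α P α₂ P₂ α₁ P₁ T) :
    CopiesR 𝔸 (.cut .right P α x (.dupL x x₁ x₂ Q)) α P α₁ P₁ α₂ P₂ T := by
  obtain ⟨h1, h2, h3, h4⟩ := h
  refine ⟨h1, fun z => ?_, fun z => ?_, fun γ γ' δ δ' t hγ hδ hA =>
    h4 γ γ' δ δ' ?_ ?_ hδ fun A hA' => (hA A hA').symm⟩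
  · rw [h2]; simp only [Term.I, Finset.erase_right_comm (a := x₁)]; tauto
  · rw [h3]; simp only [Term.O]; tauto
  · simpa only [WellTyped, Function.update_comm hne] using t
  · simpa only [Term.I, Finset.erase_right_comm (a := x₁)] using hγ

set_option maxHeartbeats 1000000 in
theorem Refines.dupL_ctx1 {𝔸 : Type*} {C : Ctx1} {R P : Term} {α : OutName} {x x₁ x₂ : InName}
    (h₁ : C.prinI ≠ some x₁) (h₂ : C.prinI ≠ some x₂)
    (hc : (Term.cut .right P α x (.dupL x x₁ x₂ (C.fill R))).Conv)
    (hl : (Term.cut .right P α x (.dupL x x₁ x₂ (C.fill R))).Linear) :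
    Refines 𝔸 (.cut .right P α x (.dupL x x₁ x₂ (C.fill R)))
      (C.fill (.cut .right P α x (.dupL x x₁ x₂ R))) := by
  cases C <;> simp only [Ctx1.fill] at hc hl ⊢ <;>
    simp only [Ctx1.prinI, ne_eq, Option.some.injEq, reduceCtorEq, not_false_iff] at h₁ h₂
  all_goals simp only [Term.Conv, Term.bndI, Term.bndO, Term.Linear, Term.I, Term.O, nameSimps] at hc hl
  all_goals simp only [not_or] at hc
  all_goals obtain ⟨⟨c1, -, c2, -⟩, ⟨d1, -, d2, -⟩, c3, d3⟩ := hc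
  all_goals refine .of_wellTyped ⟨?_, ?_, ?_⟩ fun γ δ ⟨A, hD, h⟩ => ?_
  case exp.refine_4 =>
    obtain ⟨B, D, e, h⟩ := h
    refine ⟨B, D, e, A, hD.congr ?_ ?_, WellTyped.congr (P := R) h ?_ ?_⟩ <;>
      grind only [= Function.update_apply]
  case erL.refine_4 =>
    simp only [WellTyped] at h
    refine ⟨A, hD.congr ?_ ?_, WellTyped.congr (P := R) h ?_ ?_⟩ <;>
      grind only [= Function.update_apply]
  case erR.refine_4 =>
    simp only [WellTyped] at h
    refine ⟨A, hD.congr ?_ ?_, WellTyped.congr (P := R) h ?_ ?_⟩ <;>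
      grind only [= Function.update_apply]
  case dupL.refine_4 =>
    simp only [WellTyped] at h
    refine ⟨A, hD.congr ?_ ?_, WellTyped.congr (P := R) h ?_ ?_⟩ <;>
      grind only [= Function.update_apply]
  case dupR.refine_4 =>
    simp only [WellTyped] at h
    refine ⟨A, hD.congr ?_ ?_, WellTyped.congr (P := R) h ?_ ?_⟩ <;>
      grind only [= Function.update_apply]
  all_goals simp only [Term.Linear, Term.I, Term.O, nameSimps]
  all_goals grind only

set_option maxHeartbeats 1000000 in
theorem Refines.dupL_ctx2_left {𝔸 : Type*} {C : Ctx2} {R₁ R₂ P : Term} {α : OutName}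
    {x x₁ x₂ : InName} (h₁ : x₁ ∈ R₁.I) (h₂ : x₂ ∈ R₁.I)
    (hc : (Term.cut .right P α x (.dupL x x₁ x₂ (C.fill R₁ R₂))).Conv)
    (hl : (Term.cut .right P α x (.dupL x x₁ x₂ (C.fill R₁ R₂))).Linear) :
    Refines 𝔸 (.cut .right P α x (.dupL x x₁ x₂ (C.fill R₁ R₂)))
      (C.fill (.cut .right P α x (.dupL x x₁ x₂ R₁)) R₂) := by
  cases C <;> simp only [Ctx2.fill] at hc hl ⊢
  all_goals simp only [Term.Conv, Term.bndI, Term.bndO, Term.Linear, Term.I, Term.O, nameSimps] at hc hl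
  all_goals simp only [not_or] at hc
  all_goals obtain ⟨⟨c1, -, c2, -⟩, ⟨d1, -, d2, -⟩, c3, d3⟩ := hc
  all_goals refine .of_wellTyped ⟨?_, ?_, ?_⟩ fun γ δ ⟨A, hD, h⟩ => ?_
  case imp.refine_4 =>
    obtain ⟨B, D, e, h, h'⟩ := h
    refine ⟨B, D, by grind only [= Function.update_apply], ⟨A, hD.congr ?_ ?_, WellTyped.congr (P := R₁) h ?_ ?_⟩, h'.congr ?_ ?_⟩ <;>
      grind only [= Function.update_apply]
  case cut.refine_4 =>
    obtain ⟨B, h, h'⟩ := h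
    refine ⟨B, ⟨A, hD.congr ?_ ?_, WellTyped.congr (P := R₁) h ?_ ?_⟩, h'.congr ?_ ?_⟩ <;>
      grind only [= Function.update_apply]
  all_goals simp only [Term.Linear, Term.I, Term.O, nameSimps]
  all_goals grind only

set_option maxHeartbeats 1000000 in
theorem Refines.dupL_ctx2_right {𝔸 : Type*} {C : Ctx2} {R₁ R₂ P : Term} {α : OutName}
    {x x₁ x₂ : InName} (h₁ : x₁ ∈ R₂.I) (h₂ : x₂ ∈ R₂.I)
    (hc : (Term.cut .right P α x (.dupL x x₁ x₂ (C.fill R₁ R₂))).Conv)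
    (hl : (Term.cut .right P α x (.dupL x x₁ x₂ (C.fill R₁ R₂))).Linear) :
    Refines 𝔸 (.cut .right P α x (.dupL x x₁ x₂ (C.fill R₁ R₂)))
      (C.fill R₁ (.cut .right P α x (.dupL x x₁ x₂ R₂))) := by
  cases C <;> simp only [Ctx2.fill] at hc hl ⊢
  all_goals simp only [Term.Conv, Term.bndI, Term.bndO, Term.Linear, Term.I, Term.O, nameSimps] at hc hl
  all_goals simp only [not_or] at hc
  all_goals obtain ⟨⟨c1, -, c2, -⟩, ⟨d1, -, d2, -⟩, c3, d3⟩ := hc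
  all_goals refine .of_wellTyped ⟨?_, ?_, ?_⟩ fun γ δ ⟨A, hD, h⟩ => ?_
  case imp.refine_4 =>
    obtain ⟨B, D, e, h, h'⟩ := h
    refine ⟨B, D, by grind only [= Function.update_apply], h.congr ?_ ?_, A, hD.congr ?_ ?_, WellTyped.congr (P := R₂) h' ?_ ?_⟩ <;>
      grind only [= Function.update_apply]
  case cut.refine_4 =>
    obtain ⟨B, h, h'⟩ := h
    refine ⟨B, h.congr ?_ ?_, A, hD.congr ?_ ?_, WellTyped.congr (P := R₂) h' ?_ ?_⟩ <;>
      grind only [= Function.update_apply]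
  all_goals simp only [Term.Linear, Term.I, Term.O, nameSimps]
  all_goals grind only

theorem SimR.refines (𝔸 : Type*) {P Q S : Term} {α : OutName} {x x₁ x₂ : InName}
    (h : SimR P α x x₁ x₂ Q S) (hc : (Term.cut .right P α x (.dupL x x₁ x₂ Q)).Conv)
    (hl : (Term.cut .right P α x (.dupL x x₁ x₂ Q)).Linear) :
    Refines 𝔸 (.cut .right P α x (.dupL x x₁ x₂ Q)) S := by
  have hP : P.Linear := hl.1
  have hα : α ∈ P.O := hl.2.2.1
  have hbI : ∀ z ∈ P.bndI, z ∈ (Term.cut .right P α x (.dupL x x₁ x₂ Q)).bndI := by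
    simp +contextual [Term.bndI]
  have hbO : ∀ z ∈ P.bndO, z ∈ (Term.cut .right P α x (.dupL x x₁ x₂ Q)).bndO := by
    simp +contextual [Term.bndO]
  have hI : P.I ⊆ (Term.cut .right P α x (.dupL x x₁ x₂ Q)).I := Finset.subset_union_left
  have hO : P.O.erase α ⊆ (Term.cut .right P α x (.dupL x x₁ x₂ Q)).O :=
    Finset.subset_union_left
  have hne : x₁ ≠ x₂ := hl.2.1.2.1
  have hc' := Term.conv_dupL_comm hc
  have hl' := Term.linear_dupL_comm hl
  cases h with
  | prin₁ C R f₁ f₂ g₁ g₂ e h₁ hi =>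
    subst e
    exact hi.refines_dupBoth_right
      (fun α₁ P₁ α₂ P₂ => .cut .inactive P₁ α₁ x₁ (C.fill (.cut .right P₂ α₂ x₂ R)))
      hP hα hbI hbO hI hO fun _ _ _ _ hf h1 h2 => .prin h₁ hc hl hf h1 h2
  | prin₂ C R f₁ f₂ g₁ g₂ e h₁ hi =>
    subst e
    exact hi.refines_dupBoth_right
      (fun α₁ P₁ α₂ P₂ => .cut .inactive P₂ α₂ x₂ (C.fill (.cut .right P₁ α₁ x₁ R)))
      hP hα hbI hbO hI hO fun _ _ _ _ hf h1 h2 =>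
        .dupL_comm hne (.prin h₁ hc' hl' hf.dupL_comm h2 h1)
  | prin₁_left C R₁ R₂ f₁ f₂ g₁ g₂ e _ h₁ h₂ hi =>
    subst e
    exact hi.refines_dupBoth_right
      (fun α₁ P₁ α₂ P₂ => .cut .inactive P₁ α₁ x₁ (C.fill (.cut .right P₂ α₂ x₂ R₁) R₂))
      hP hα hbI hbO hI hO fun _ _ _ _ hf h1 h2 => .prin_left h₁ h₂ hc hl hf h1 h2
  | prin₂_left C R₁ R₂ f₁ f₂ g₁ g₂ e _ h₁ h₂ hi =>
    subst e
    exact hi.refines_dupBoth_right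
      (fun α₁ P₁ α₂ P₂ => .cut .inactive P₂ α₂ x₂ (C.fill (.cut .right P₁ α₁ x₁ R₁) R₂))
      hP hα hbI hbO hI hO fun _ _ _ _ hf h1 h2 =>
        .dupL_comm hne (.prin_left h₁ h₂ hc' hl' hf.dupL_comm h2 h1)
  | prin₁_right C R₁ R₂ f₁ f₂ g₁ g₂ e _ h₁ h₂ hi =>
    subst e
    exact hi.refines_dupBoth_right
      (fun α₁ P₁ α₂ P₂ => .cut .inactive P₁ α₁ x₁ (C.fill R₁ (.cut .right P₂ α₂ x₂ R₂)))
      hP hα hbI hbO hI hO fun _ _ _ _ hf h1 h2 => .prin_right h₁ h₂ hc hl hf h1 h2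
  | prin₂_right C R₁ R₂ f₁ f₂ g₁ g₂ e _ h₁ h₂ hi =>
    subst e
    exact hi.refines_dupBoth_right
      (fun α₁ P₁ α₂ P₂ => .cut .inactive P₂ α₂ x₂ (C.fill R₁ (.cut .right P₁ α₁ x₁ R₂)))
      hP hα hbI hbO hI hO fun _ _ _ _ hf h1 h2 =>
        .dupL_comm hne (.prin_right h₁ h₂ hc' hl' hf.dupL_comm h2 h1)
  | other C R e h₁ h₂ => subst e; exact .dupL_ctx1 h₁ h₂ hc hl
  | split₁₂ C R₁ R₂ f₁ f₂ g₁ g₂ e _ h₁ h₂ hi =>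
    subst e
    exact hi.refines_dupBoth_right
      (fun α₁ P₁ α₂ P₂ => C.fill (.cut .right P₁ α₁ x₁ R₁) (.cut .right P₂ α₂ x₂ R₂))
      hP hα hbI hbO hI hO fun _ _ _ _ hf h1 h2 => .split h₁ h₂ hc hl hf h1 h2
  | split₂₁ C R₁ R₂ f₁ f₂ g₁ g₂ e _ h₁ h₂ hi =>
    subst e
    exact hi.refines_dupBoth_right
      (fun α₁ P₁ α₂ P₂ => C.fill (.cut .right P₂ α₂ x₂ R₁) (.cut .right P₁ α₁ x₁ R₂))
      hP hα hbI hbO hI hO fun _ _ _ _ hf h1 h2 =>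
        .dupL_comm hne (.split h₁ h₂ hc' hl' hf.dupL_comm h2 h1)
  | both₁ C R₁ R₂ e _ h₁ h₂ => subst e; exact .dupL_ctx2_left h₁ h₂ hc hl
  | both₂ C R₁ R₂ e _ h₁ h₂ => subst e; exact .dupL_ctx2_right h₁ h₂ hc hl

/-! ### Reduction rules and witness reduction -/

/-- By linearity `α` is not free in `P`, so the type of the cut has no influence on `P`. The erasers
restore the free names lost with `Q`, and linearity of the cut keeps those names apart from the
names of `P`. -/
theorem Refines.erasL {𝔸 : Type*} {P Q : Term} {α : OutName} {x : InName}
    (hl : (Term.cut .left (.erR P α) α x Q).Linear) :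
    Refines 𝔸 (.cut .left (.erR P α) α x Q) (erBoth (Q.I.erase x) P Q.O) := by
  obtain ⟨⟨hP, hα⟩, hQ, -, hx, hI, hO⟩ := hl
  obtain ⟨h1, h2, h3, h4⟩ := erBoth_spec 𝔸 (Q.I.erase x) P Q.O
  rw [Term.O, Finset.erase_insert hα] at hO
  refine ⟨h3 hP hI.symm hO.symm, ?_, ?_, fun γ δ ⟨A, h, _⟩ =>
    h4 γ δ (WellTyped.congr (P := P) h (fun _ _ => rfl) fun z hz => ?_)⟩
  · rw [h1, Term.I, Term.I, Finset.union_comm]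
  · rw [h2, Term.O, Term.O, Finset.erase_insert hα, Finset.union_comm]
  · rw [Function.update_of_ne]; rintro rfl; exact hα hz

theorem Refines.erasR {𝔸 : Type*} {P Q : Term} {α : OutName} {x : InName}
    (hl : (Term.cut .right P α x (.erL x Q)).Linear) :
    Refines 𝔸 (.cut .right P α x (.erL x Q)) (erBoth P.I Q (P.O.erase α)) := by
  obtain ⟨hP, ⟨hQ, hx⟩, hα, -, hI, hO⟩ := hl
  obtain ⟨h1, h2, h3, h4⟩ := erBoth_spec 𝔸 P.I Q (P.O.erase α)
  rw [Term.I, Finset.erase_insert hx] at hI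
  refine ⟨h3 hQ hI hO, ?_, ?_, fun γ δ ⟨A, _, h⟩ =>
    h4 γ δ (WellTyped.congr (P := Q) h (fun z hz => ?_) fun _ _ => rfl)⟩
  · rw [h1, Term.I, Term.I, Finset.erase_insert hx]
  · rw [h2, Term.O, Term.O]
  · rw [Function.update_of_ne]; rintro rfl; exact hx hz

/-- The capsule forces the type of the cut to be that of `y`. Being free in the redex, `y` is not
bound in `Q` by the convention on names; by linearity it is not another free name of `Q`, so the
renaming is injective. -/
theorem Refines.renL {𝔸 : Type*} {Q : Term} {α : OutName} {x y : InName}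
    (hc : (Term.cut .inactive (.cap y α) α x Q).Conv)
    (hl : (Term.cut .inactive (.cap y α) α x Q).Linear) :
    Refines 𝔸 (.cut .inactive (.cap y α) α x Q) (Q.renI y x) := by
  simp only [Term.Conv, Term.bndI, Term.bndO, Term.Linear, Term.I, Term.O, nameSimps] at hc hl
  obtain ⟨h1, h2, h3, h4⟩ := Term.rename_spec (𝔸 := 𝔸) (P := Q) (f := Function.update id x y)
    (g := id) (by grind [Function.update_apply]) (by grind) (by grind [Function.update_apply])
    (by grind)
  refine .of_wellTyped ⟨h3.2 hl.2.1, fun z => ?_, fun z => ?_⟩ fun γ δ ⟨A, e, t⟩ => (h4 γ δ).2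
    (t.congr (fun z hz => ?_) fun _ _ => rfl)
  · simp only [Term.renI, h1, Term.I, Finset.mem_image, Function.update_apply, nameSimps]
    grind
  · simp [Term.renI, h2, Term.O]
  · simp only [WellTyped, Function.update_self] at e
    grind [Function.update_apply]

theorem Refines.renR {𝔸 : Type*} {P : Term} {α β : OutName} {x : InName}
    (hc : (Term.cut .inactive P α x (.cap x β)).Conv)
    (hl : (Term.cut .inactive P α x (.cap x β)).Linear) :
    Refines 𝔸 (.cut .inactive P α x (.cap x β)) (P.renO β α) := by
  simp only [Term.Conv, Term.bndI, Term.bndO, Term.Linear, Term.I, Term.O, nameSimps] at hc hl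
  obtain ⟨h1, h2, h3, h4⟩ := Term.rename_spec (𝔸 := 𝔸) (P := P) (f := id)
    (g := Function.update id α β) (by grind) (by grind [Function.update_apply]) (by grind)
    (by grind [Function.update_apply])
  refine .of_wellTyped ⟨h3.2 hl.1, fun z => ?_, fun z => ?_⟩ fun γ δ ⟨A, t, e⟩ => (h4 γ δ).2
    (t.congr (fun _ _ => rfl) fun z hz => ?_)
  · simp [Term.renO, h1, Term.I]
  · simp only [Term.renO, h2, Term.O, Finset.mem_image, Function.update_apply, nameSimps]
    grind
  · simp only [WellTyped, Function.update_self] at e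
    grind [Function.update_apply]

set_option maxHeartbeats 2000000 in
-- Apart from the logical actions, the rules treated here directly change only the state of a cut or
-- the scope in which subterms stand. The convention on names and linearity show that the old and
-- new assignments agree on the free names of each subterm.
theorem Root.refines (𝔸 : Type*) {T T' : Term} (h : Root T T') (hc : T.Conv) (hl : T.Linear)
    (hL : ∀ {P Q S : Term} {α₁ α₂ α : OutName} {x : InName}, SimL P α₁ α₂ α x Q S →
      (Term.cut .left (.dupR P α₁ α₂ α) α x Q).Conv →
      (Term.cut .left (.dupR P α₁ α₂ α) α x Q).Linear →
      Refines 𝔸 (.cut .left (.dupR P α₁ α₂ α) α x Q) S)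
    (hR : ∀ {P Q S : Term} {α : OutName} {x x₁ x₂ : InName}, SimR P α x x₁ x₂ Q S →
      (Term.cut .right P α x (.dupL x x₁ x₂ Q)).Conv →
      (Term.cut .right P α x (.dupL x x₁ x₂ Q)).Linear →
      Refines 𝔸 (.cut .right P α x (.dupL x x₁ x₂ Q)) S) : Refines 𝔸 T T' := by
  cases h
  case erasL => exact .erasL hl
  case erasR => exact .erasR hl
  case duplL h => exact hL h hc hl
  case duplR h => exact hR h hc hl
  case renL => exact .renL hc hl
  case renR => exact .renR hc hl
  all_goals clear hL hR
  all_goals simp only [Term.Conv, Term.bndI, Term.bndO, Term.Linear, Term.I, Term.O, nameSimps] at hc hl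
  all_goals simp only [not_or] at hc
  all_goals refine .of_wellTyped ⟨?_, ?_, ?_⟩ fun γ δ h => ?_
  case expL.refine_4 =>
    obtain ⟨C, ⟨A, B, e, hP⟩, hR⟩ := h
    refine ⟨A, B, by grind only [= Function.update_apply], C, hP.congr ?_ ?_, hR.congr ?_ ?_⟩ <;>
      grind only [= Function.update_apply]
  case impL₁.refine_4 =>
    obtain ⟨C, ⟨A, B, e, hP, hQ⟩, hR⟩ := h
    refine ⟨A, B, e, ⟨C, hP.congr ?_ ?_, hR.congr ?_ ?_⟩, hQ.congr ?_ ?_⟩ <;>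
      grind only [= Function.update_apply]
  case impL₂.refine_4 =>
    obtain ⟨C, ⟨A, B, e, hP, hQ⟩, hR⟩ := h
    refine ⟨A, B, e, hP.congr ?_ ?_, C, hQ.congr ?_ ?_, hR.congr ?_ ?_⟩ <;>
      grind only [= Function.update_apply]
  case cutL₁.refine_4 =>
    obtain ⟨C, ⟨A, hP, hQ⟩, hR⟩ := h
    refine ⟨A, ⟨C, hP.congr ?_ ?_, hR.congr ?_ ?_⟩, hQ.congr ?_ ?_⟩ <;>
      grind only [= Function.update_apply]
  case cutL₂.refine_4 =>
    obtain ⟨C, ⟨A, hP, hQ⟩, hR⟩ := h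
    refine ⟨A, hP.congr ?_ ?_, C, hQ.congr ?_ ?_, hR.congr ?_ ?_⟩ <;>
      grind only [= Function.update_apply]
  case erLL.refine_4 =>
    obtain ⟨C, hP, hR⟩ := h
    exact ⟨C, hP, hR⟩
  case erRL.refine_4 =>
    obtain ⟨C, hP, hR⟩ := h
    exact ⟨C, hP, hR⟩
  case dupLL.refine_4 =>
    obtain ⟨C, hP, hR⟩ := h
    simp only [WellTyped] at hP
    refine ⟨C, hP.congr ?_ ?_, hR.congr ?_ ?_⟩ <;>
      grind only [= Function.update_apply]
  case dupRL.refine_4 =>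
    obtain ⟨C, hP, hR⟩ := h
    simp only [WellTyped] at hP
    refine ⟨C, hP.congr ?_ ?_, hR.congr ?_ ?_⟩ <;>
      grind only [= Function.update_apply]
  case expR.refine_4 =>
    obtain ⟨C, hP, ⟨A, B, e, hQ⟩⟩ := h
    refine ⟨A, B, e, C, hP.congr ?_ ?_, hQ.congr ?_ ?_⟩ <;>
      grind only [= Function.update_apply]
  case impR₁.refine_4 =>
    obtain ⟨C, hP, ⟨A, B, e, hQ, hR⟩⟩ := h
    refine ⟨A, B, by grind only [= Function.update_apply], ⟨C, hP.congr ?_ ?_, hQ.congr ?_ ?_⟩, hR.congr ?_ ?_⟩ <;>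
      grind only [= Function.update_apply]
  case impR₂.refine_4 =>
    obtain ⟨C, hP, ⟨A, B, e, hQ, hR⟩⟩ := h
    refine ⟨A, B, by grind only [= Function.update_apply], hQ.congr ?_ ?_, C, hP.congr ?_ ?_, hR.congr ?_ ?_⟩ <;>
      grind only [= Function.update_apply]
  case cutR₁.refine_4 =>
    obtain ⟨C, hP, ⟨A, hQ, hR⟩⟩ := h
    refine ⟨A, ⟨C, hP.congr ?_ ?_, hQ.congr ?_ ?_⟩, hR.congr ?_ ?_⟩ <;>
      grind only [= Function.update_apply]
  case cutR₂.refine_4 =>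
    obtain ⟨C, hP, ⟨A, hQ, hR⟩⟩ := h
    refine ⟨A, hQ.congr ?_ ?_, C, hP.congr ?_ ?_, hR.congr ?_ ?_⟩ <;>
      grind only [= Function.update_apply]
  case erLR.refine_4 =>
    obtain ⟨C, hP, hQ⟩ := h
    exact ⟨C, hP, hQ⟩
  case erRR.refine_4 =>
    obtain ⟨C, hP, hQ⟩ := h
    exact ⟨C, hP, hQ⟩
  case dupLR.refine_4 =>
    obtain ⟨C, hP, hQ⟩ := h
    simp only [WellTyped] at hQ
    refine ⟨C, hP.congr ?_ ?_, hQ.congr ?_ ?_⟩ <;>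
      grind only [= Function.update_apply]
  case dupRR.refine_4 =>
    obtain ⟨C, hP, hQ⟩ := h
    simp only [WellTyped] at hQ
    refine ⟨C, hP.congr ?_ ?_, hQ.congr ?_ ?_⟩ <;>
      grind only [= Function.update_apply]
  case cutcL.refine_4 =>
    obtain ⟨C, ⟨A, hP, e⟩, hR⟩ := h
    -- The capsule `⟨x.β⟩` equates the types of the two cuts, so a single cut of this type can
    -- replace them.
    simp only [WellTyped, Function.update_self] at e
    subst e
    refine ⟨A, hP.congr ?_ ?_, hR⟩ <;>
      grind only [= Function.update_apply]
  case cutcR.refine_4 =>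
    obtain ⟨C, hP, ⟨A, e, hR⟩⟩ := h
    simp only [WellTyped, Function.update_self] at e
    refine ⟨A, hP.congr ?_ ?_, hR.congr ?_ ?_⟩ <;>
      grind only [= Function.update_apply]
  case insert₁.refine_4 =>
    obtain ⟨C, ⟨A, B, e, hP⟩, ⟨A', B', e', hQ, hR⟩⟩ := h
    simp only [Function.update_self] at e e'
    -- Both sides of the cut have the type `C`; injectivity of the arrow identifies the argument
    -- types and the result types, which are the types of the two new cuts.
    obtain ⟨rfl, rfl⟩ : A = A' ∧ B = B' := by simpa using e.symm.trans e'
    refine ⟨B, ⟨A, hQ.congr ?_ ?_, hP.congr ?_ ?_⟩, hR.congr ?_ ?_⟩ <;>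
      grind only [= Function.update_apply]
  case insert₂.refine_4 =>
    obtain ⟨C, ⟨A, B, e, hP⟩, ⟨A', B', e', hQ, hR⟩⟩ := h
    simp only [Function.update_self] at e e'
    obtain ⟨rfl, rfl⟩ : A = A' ∧ B = B' := by simpa using e.symm.trans e'
    refine ⟨A, hQ.congr ?_ ?_, B, hP.congr ?_ ?_, hR.congr ?_ ?_⟩ <;>
      grind only [= Function.update_apply]
  case actL.refine_4 =>
    exact h
  case actR.refine_4 =>
    exact h
  case deactL.refine_4 =>
    exact h
  case deactR.refine_4 =>
    exact h
  all_goals simp only [Term.Linear, Term.I, Term.O, nameSimps]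
  all_goals grind only

/-- Linearity has to be carried along: a step up to congruence starts from a congruent term, whose
linearity comes from the congruence itself. -/
theorem Red.refines (𝔸 : Type*) {T T' : Term} (h : Red T T') (hl : T.Linear) :
    Refines 𝔸 T T' := by
  induction h with
  | root hc h => exact h.refines 𝔸 hc hl (SimL.refines 𝔸) (SimR.refines 𝔸)
  | ctx1 C _ ih => exact .ctx1 C ih hl
  | ctx2_left C Q _ ih => exact .ctx2 C ih .refl hl
  | ctx2_right C P _ ih => exact .ctx2 C .refl ih hl
  | cong h₁ _ h₂ ih =>
    have r₁ := (h₁.interchangeable 𝔸).1 hl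
    have r₂ := r₁.trans (ih r₁.linear)
    exact r₂.trans ((h₂.interchangeable 𝔸).1 r₂.linear)

end StarX

theorem mainTheorem2 {𝔸 : Type*} (S S' : StarX.Term) (Γ Δ : StarX.Cxt 𝔸)
    (hS : S.Linear) (hT : StarX.Typed Γ S Δ) (hR : StarX.Red S S') :
    StarX.Typed Γ S' Δ := by
  -- Supplies the default type for the total assignments chosen next.
  have := hT.nonempty
  obtain ⟨γ, hγ, eΓ⟩ := hT.functional.1.exists_eq_declarations hT.dom_eq.1
  obtain ⟨δ, hδ, eΔ⟩ := hT.functional.2.exists_eq_declarations hT.dom_eq.2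
  have r := hR.refines 𝔸 hS
  -- The contexts are the declarations of `γ`, `δ` on the free names of `S`, which are also those of
  -- `S'`.
  rw [eΓ, eΔ, ← r.I_eq, ← r.O_eq]
  exact (r.wellTyped γ δ (hT.wellTyped hγ hδ)).typed r.linear
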